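/- **Setting.** Fix $p\ge 0$. For each network size $N$ let $E=E^{(N)}\in\{0,1\}^{N\times N}$ be a fixed symmetric adjacency matrix with $E_{ii}=1$, let $n_i=\sum_{j\ne i}E_{ij}$, and let $\widetilde E_{ij}=E_{ij}/n_i$ for $i\neq j$, $\widetilde E_{ii}=0$ (a row of $\widetilde E$ with $n_i=0$ is $0$). The data are $(C,A,M,Y)$, where the confounders $C=(C_1,\dots,C_N)$, $C_i\in\mathbb R^p$, have an arbitrary law not depending on the parameter; given $C$, the exposures $A_i\in\{0,1\}$ are independent with $P(A_i=1\mid C)=\pi(C_i,\alpha)=e^{\alpha^TC_i}/(1+e^{\alpha^TC_i})$; and $$M=X_m\gamma+Eb^M+\epsilon^M,\qquad Y=X_y\beta+Eb^Y+\epsilon^Y,$$ with $X_m=(\mathbf 1,A,\widetilde EA,C,\widetilde EC)$, $X_y=(\mathbf 1,A,\widetilde EA,M,\widetilde EM,C,\widetilde EC)$, where $b^M,\epsilon^M,b^Y,\epsilon^Y$ are $N$-dimensional centred Gaussian vectors with covariances $\sigma^2_{b^M}I,\sigma^2_mI,\sigma^2_{b^Y}I,\sigma_y^2I$, independent of each other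 and of $(C,A)$. The parameter is $\varphi=(\beta,\gamma,\alpha,\sigma_y^2,\sigma_{b^Y}^2,\sigma_m^2,\sigma_{b^M}^2)\in\mathbb R^K$. Let $\Theta\subset\mathbb R^K$ be compact with all four variances positive on $\Theta$, and let the true parameter $\varphi_0$ be an interior point of $\Theta$. Let $$l(\varphi)=\log f_{\mathcal N(0,\Sigma_y)}(Y-X_y\beta)+\log f_{\mathcal N(0,\Sigma_m)}(M-X_m\gamma)+\sum_{i}\Big\{A_i\log\tfrac{\pi(C_i,\alpha)}{1-\pi(C_i,\alpha)}+\log(1-\pi(C_i,\alpha))\Big\},$$ $\Sigma_y=\sigma_y^2I+\sigma_{b^Y}^2EE^T$, $\Sigma_m=\sigma_m^2I+\sigma_{b^M}^2EE^T$, be the marginal log-likelihood ($f_{\mathcal N(0,\Sigma)}$ being the centred Gaussian density with covariance $\Sigma$), and let $\widehat\varphi_N$ be a measurable maximizer of $l$ over $\Theta$. Put $J_N(\varphi)=-\nabla^2l(\varphi)$ and $B_N(\varphi)=\mathbb E_\varphi J_N(\varphi)$; for $\Phi=(\varphi_1,\dots,\varphi_K)$ let $J_N(\Phi)$ be the matrix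 whose $k$-th row is the $k$-th row of $J_N(\varphi_k)$. Square roots of matrices are the symmetric positive semidefinite ones, $\|\cdot\|_F$ is the Frobenius norm, and $\mathbb E_\varphi,P_\varphi$ refer to data generated under $\varphi$. **Assumption 5.** For all large $N$, $B_N$ exists (the entries of $J_N(\varphi)$ are $P_\varphi$-integrable), is positive definite and is continuous on $\Theta$; and $\sup_{\varphi\in\Theta}\|B_N^{-1}(\varphi)\|_F\to0$. **Assumption 6.** $\sup_{\varphi\in\Theta}\mathbb E_\varphi\|B_N^{-1/2}(\varphi)J_N(\varphi)B_N^{-1/2}(\varphi)-I\|_F^2\to0$. **Assumption 7.** For all $\epsilon,\eta>0$: (i) $\sup\{\|B_N^{-1/2}(\varphi)B_N^{1/2}(\varphi')-I\|_F:\varphi,\varphi'\in\Theta,\ \|B_N^{1/2}(\varphi)(\varphi-\varphi')\|\le\epsilon\}\to0$; (ii) for every $\varphi\in\Theta$, $P_\varphi\big[\sup\|B_N^{-1/2}(\varphi)\{J_N(\Phi)-J_N(\varphi)\}B_N^{-1/2}(\varphi)\|_F>\eta\big]\to0$, the supremum being over $\varphi_1,\dots,\varphi_K\in\Theta$ with $\|B_N^{1/2}(\varphi)(\varphi-\varphi_k)\|\le\epsilon$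 for all $k$. **Assumption 8.** $g=g_N:\Theta\to\mathbb R$ is real analytic (and may depend on $N$). Let $Q_N=\nabla g_N(\varphi_0)^TB_N^{-1}(\varphi_0)\nabla g_N(\varphi_0)$. (i) For large $N$, $\nabla g_N(\varphi_0)\ne0$, and $\|\nabla g_N(\varphi_0)\|$ and $\|\nabla^2g_N(\varphi')\|_F$ are bounded uniformly in large $N$ and in $\varphi'\in\Theta$ within some $\epsilon>0$ of $\varphi_0$. (ii) Let $\lambda_{N,1}\ge\dots\ge\lambda_{N,K}$ be the eigenvalues of $B_N^{-1}(\varphi_0)$ with orthonormal eigenvectors $v_{N,k}$, and $\nabla g_N(\varphi_0)=\sum_kz_{N,k}v_{N,k}$; then $z_{N,k}=O(1)$ for all $k$. (iii) There are $1\le r\le K$ and $\delta_1=\dots=\delta_r<\delta_{r+1}\le\dots\le\delta_K$ (just $\delta_1=\dots=\delta_K$ if $r=K$) with $\lambda_{N,k}=O(N^{-\delta_k})$ for all $k$, and this order is exact for the leading eigenvalues: $N^{-\delta_k}=O(\lambda_{N,k})$ for $k\le r$; the leading component of the gradient does not degenerate: $\liminf_N\sum_{k\le r}z_{N,k}^2>0$;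 and each sequence $u_{N,k}=\sqrt{\lambda_{N,k}}\,z_{N,k}v_{N,k}/\sqrt{\sum_j\lambda_{N,j}z_{N,j}^2}$ is Cauchy as $N\to\infty$. **Theorem.** Under these assumptions, as $N\to\infty$, with data generated under $\varphi_0$, $$\text{(i)}\ \ g_N(\widehat\varphi_N)-g_N(\varphi_0)\xrightarrow{p}0,\qquad\text{(ii)}\ \ Q_N^{-1/2}\{g_N(\widehat\varphi_N)-g_N(\varphi_0)\}\xrightarrow{d}\mathcal N(0,1).$$ -/

import Mathlib

open MeasureTheory ProbabilityTheory Filter Topology Matrix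
open scoped MatrixOrder

noncomputable section

namespace RenSem

/-! ## Matrices and derivatives -/

/-- The Frobenius norm `√ tr(HᵀH)`. -/
def frob {m n : Type*} [Fintype m] [Fintype n] (H : Matrix m n ℝ) : ℝ :=
  Real.sqrt (Matrix.trace (Hᵀ * H))

/-- The symmetric positive semidefinite square root `H^{1/2}`. -/
def msqrt {n : Type*} [Fintype n] [DecidableEq n] (H : Matrix n n ℝ) : Matrix n n ℝ :=
  CFC.sqrt H

/-- `H^{-1/2}`. -/
def misqrt {n : Type*} [Fintype n] [DecidableEq n] (H : Matrix n n ℝ) : Matrix n n ℝ :=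
  (msqrt H)⁻¹

/-- The Hessian matrix of `f` at `x`, with entries `∂²f / ∂x_k ∂x_l`. -/
def hessian {n : Type*} [Fintype n] [DecidableEq n] (f : EuclideanSpace ℝ n → ℝ)
    (x : EuclideanSpace ℝ n) : Matrix n n ℝ :=
  Matrix.of fun k l =>
    fderiv ℝ (fun y => fderiv ℝ f y (EuclideanSpace.single l 1)) x (EuclideanSpace.single k 1)

/-! ## Parameters

`p` is the dimension of the vector of confounders of one unit. -/

/-- Indices of the outcome coefficients: `β₀, …, β₄`, then `β₅ ∈ ℝᵖ`, then `β₆ ∈ ℝᵖ`. -/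
abbrev YIdx (p : ℕ) : Type := Fin 5 ⊕ Fin p ⊕ Fin p

/-- Indices of the mediator coefficients: `γ₀, γ₁, γ₂`, then `γ₃ ∈ ℝᵖ`, then `γ₄ ∈ ℝᵖ`. -/
abbrev MIdx (p : ℕ) : Type := Fin 3 ⊕ Fin p ⊕ Fin p

/-- Indices of the grand parameter vector `φ = (β, γ, α, σ²_y, σ²_{b^Y}, σ²_m, σ²_{b^M})`. -/
abbrev ParamIdx (p : ℕ) : Type := YIdx p ⊕ MIdx p ⊕ Fin p ⊕ Fin 4

/-- The space `ℝᴷ` of parameter vectors. -/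
abbrev Param (p : ℕ) : Type := EuclideanSpace ℝ (ParamIdx p)

/-- The number `K` of parameters. -/
abbrev numParam (p : ℕ) : ℕ := Fintype.card (ParamIdx p)

variable {p N : ℕ}

def beta (φ : Param p) : YIdx p → ℝ := fun j => φ (Sum.inl j)

def gamma (φ : Param p) : MIdx p → ℝ := fun j => φ (Sum.inr (Sum.inl j))

def alpha (φ : Param p) : Fin p → ℝ := fun j => φ (Sum.inr (Sum.inr (Sum.inl j)))

/-- The four variance components `σ²_y, σ²_{b^Y}, σ²_m, σ²_{b^M}`, in this order. -/
def variances (φ : Param p) : Fin 4 → ℝ := fun j => φ (Sum.inr (Sum.inr (Sum.inr j)))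

/-! ## The network -/

open Classical in
/-- The adjacency matrix `E` of the network, with `E_ii = 1`. -/
def adj (G : SimpleGraph (Fin N)) : Matrix (Fin N) (Fin N) ℝ :=
  Matrix.of fun i j => if i = j ∨ G.Adj i j then 1 else 0

/-- The degree `n_i = ∑_{j ≠ i} E_ij`. -/
def deg (G : SimpleGraph (Fin N)) (i : Fin N) : ℝ :=
  ∑ j ∈ Finset.univ.erase i, adj G i j

/-- The row-normalised matrix: `E_ij / n_i` for `i ≠ j`, and `0` on the diagonal. It averages over
the neighbours of a unit; the average over an empty neighbourhood is `0`. -/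
def nbrAvg (G : SimpleGraph (Fin N)) : Matrix (Fin N) (Fin N) ℝ :=
  Matrix.of fun i j => if i = j then 0 else (deg G i)⁻¹ * adj G i j

/-! ## The structural equations -/

/-- Confounders: one vector in `ℝᵖ` per unit. -/
abbrev Cov (p N : ℕ) : Type := Fin N → Fin p → ℝ

/-- The observed data `(C, A, M, Y)`. -/
abbrev Data (p N : ℕ) : Type :=
  Cov p N × (Fin N → ℝ) × (Fin N → ℝ) × (Fin N → ℝ)

/-- The logistic allocation probability `π(c, α) = exp(αᵀc) / (1 + exp(αᵀc))`. -/
def propensity (a c : Fin p → ℝ) : ℝ :=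
  Real.exp (a ⬝ᵥ c) / (1 + Real.exp (a ⬝ᵥ c))

/-- The design matrix `X_m = (1, A, ẼA, C, ẼC)`. -/
def designM (G : SimpleGraph (Fin N)) (C : Cov p N) (A : Fin N → ℝ) :
    Matrix (Fin N) (MIdx p) ℝ :=
  Matrix.of fun i => Sum.elim ![1, A i, (nbrAvg G *ᵥ A) i]
    (Sum.elim (C i) (fun q => (nbrAvg G *ᵥ fun j => C j q) i))

/-- The design matrix `X_y = (1, A, ẼA, M, ẼM, C, ẼC)`. -/
def designY (G : SimpleGraph (Fin N)) (C : Cov p N) (A M : Fin N → ℝ) :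
    Matrix (Fin N) (YIdx p) ℝ :=
  Matrix.of fun i => Sum.elim ![1, A i, (nbrAvg G *ᵥ A) i, M i, (nbrAvg G *ᵥ M) i]
    (Sum.elim (C i) (fun q => (nbrAvg G *ᵥ fun j => C j q) i))

/-- The exogenous variables: confounders `C`, exposure noise `U`, and
`b^M, ε^M, b^Y, ε^Y`. -/
abbrev Noise (p N : ℕ) : Type :=
  Cov p N × (Fin N → unitInterval) ×
    (Fin N → ℝ) × (Fin N → ℝ) × (Fin N → ℝ) × (Fin N → ℝ)

/-- Exposures: `A_i = 1` if `U_i ≤ π(C_i, α)`, and `A_i = 0` otherwise. -/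
def exposure (a : Fin p → ℝ) (C : Cov p N) (U : Fin N → unitInterval) : Fin N → ℝ :=
  fun i => if (U i : ℝ) ≤ propensity a (C i) then 1 else 0

/-- Mediators: `M = X_m γ + E b^M + ε^M`. -/
def mediator (G : SimpleGraph (Fin N)) (φ : Param p) (C : Cov p N) (A b ε : Fin N → ℝ) :
    Fin N → ℝ :=
  designM G C A *ᵥ gamma φ + adj G *ᵥ b + ε

/-- Outcomes: `Y = X_y β + E b^Y + ε^Y`. -/
def outcome (G : SimpleGraph (Fin N)) (φ : Param p) (C : Cov p N) (A M b ε : Fin N → ℝ) :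
    Fin N → ℝ :=
  designY G C A M *ᵥ beta φ + adj G *ᵥ b + ε

/-- The data generated from the exogenous variables by the structural equations. -/
def generate (G : SimpleGraph (Fin N)) (φ : Param p) (ω : Noise p N) : Data p N :=
  let C := ω.1
  let A := exposure (alpha φ) C ω.2.1
  let M := mediator G φ C A ω.2.2.1 ω.2.2.2.1
  let Y := outcome G φ C A M ω.2.2.2.2.1 ω.2.2.2.2.2
  (C, A, M, Y)

/-- The law `MVN(0, s · I)` on `ℝᴺ`. -/
def iidGaussian (N : ℕ) (s : ℝ) : Measure (Fin N → ℝ) :=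
  Measure.pi fun _ => gaussianReal 0 s.toNNReal

/-- The joint law of the exogenous variables: `C` has the law `μC`, the `U_i` are uniform on
`[0,1]`, `b^M, ε^M, b^Y, ε^Y` are centred Gaussian with their variances, and everything is
independent. -/
def noiseLaw (μC : Measure (Cov p N)) (φ : Param p) : Measure (Noise p N) :=
  μC.prod ((Measure.pi fun _ => (volume : Measure unitInterval)).prod
    ((iidGaussian N (variances φ 3)).prod ((iidGaussian N (variances φ 2)).prod
      ((iidGaussian N (variances φ 1)).prod (iidGaussian N (variances φ 0))))))

/-- A growing sequence of linear random effects network structural equation models: for each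
number `N` of units a fixed network and a law of the confounders. -/
structure Model (p : ℕ) where
  graph : ∀ N : ℕ, SimpleGraph (Fin N)
  covLaw : ∀ N : ℕ, Measure (Cov p N)
  isProb : ∀ N : ℕ, IsProbabilityMeasure (covLaw N)

/-- The law of the data of the network of size `N` under the parameter `φ`. -/
def dataLaw (S : Model p) (N : ℕ) (φ : Param p) : Measure (Data p N) :=
  (noiseLaw (S.covLaw N) φ).map (generate (S.graph N) φ)

instance (N : ℕ) (s : ℝ) : IsProbabilityMeasure (iidGaussian N s) := by
  unfold iidGaussian; infer_instance

instance (μC : Measure (Cov p N)) [IsProbabilityMeasure μC] (φ : Param p) :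
    IsProbabilityMeasure (noiseLaw μC φ) := by
  unfold noiseLaw; infer_instance

theorem measurable_exposure (a : Fin p → ℝ) :
    Measurable fun x : Cov p N × (Fin N → unitInterval) => exposure a x.1 x.2 := by
  refine measurable_pi_lambda _ fun i => ?_
  refine Measurable.ite (measurableSet_le ?_ ?_) measurable_const measurable_const
  · fun_prop
  · unfold propensity dotProduct
    fun_prop

theorem measurable_generate (G : SimpleGraph (Fin N)) (φ : Param p) :
    Measurable (generate G φ) := by
  have hA : Measurable fun ω : Noise p N => exposure (alpha φ) ω.1 ω.2.1 :=
    (measurable_exposure (alpha φ)).comp (measurable_fst.prodMk (measurable_fst.comp measurable_snd))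
  have hAi := fun i => (measurable_pi_apply i).comp hA
  simp only [Function.comp_def] at hAi
  have hM : Measurable fun ω : Noise p N =>
      mediator G φ ω.1 (exposure (alpha φ) ω.1 ω.2.1) ω.2.2.1 ω.2.2.2.1 := by
    refine measurable_pi_lambda _ fun i => ?_
    simp only [mediator, designM, Matrix.mulVec, dotProduct, Pi.add_apply, Fintype.sum_sum_type,
      Fin.sum_univ_three, Matrix.of_apply, Sum.elim_inl, Sum.elim_inr, Matrix.cons_val]
    fun_prop
  have hMi := fun i => (measurable_pi_apply i).comp hM
  simp only [Function.comp_def] at hMi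
  have hY : Measurable fun ω : Noise p N =>
      outcome G φ ω.1 (exposure (alpha φ) ω.1 ω.2.1)
        (mediator G φ ω.1 (exposure (alpha φ) ω.1 ω.2.1) ω.2.2.1 ω.2.2.2.1)
        ω.2.2.2.2.1 ω.2.2.2.2.2 := by
    refine measurable_pi_lambda _ fun i => ?_
    simp only [outcome, designY, Matrix.mulVec, dotProduct, Pi.add_apply, Fintype.sum_sum_type,
      Fin.sum_univ_five, Matrix.of_apply, Sum.elim_inl, Sum.elim_inr, Matrix.cons_val]
    fun_prop
  exact measurable_fst.prodMk (hA.prodMk (hM.prodMk hY))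

instance (S : Model p) (N : ℕ) (φ : Param p) : IsProbabilityMeasure (dataLaw S N φ) := by
  have := S.isProb N
  exact Measure.isProbabilityMeasure_map (measurable_generate _ _).aemeasurable

/-! ## Likelihood and information -/

/-- The covariance matrix `s · I + t · E Eᵀ`. -/
def covMatrix (G : SimpleGraph (Fin N)) (s t : ℝ) : Matrix (Fin N) (Fin N) ℝ :=
  s • (1 : Matrix (Fin N) (Fin N) ℝ) + t • (adj G * (adj G)ᵀ)

/-- The log-density of `MVN(0, V)` at `w`. -/
def gaussLogDensity (V : Matrix (Fin N) (Fin N) ℝ) (w : Fin N → ℝ) : ℝ :=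
  -((N : ℝ) / 2) * Real.log (2 * Real.pi) - 1 / 2 * Real.log V.det - 1 / 2 * (w ⬝ᵥ (V⁻¹ *ᵥ w))

/-- The marginal log-likelihood `l(φ) = l_y(φ) + l_m(φ) + l_a(φ)` of the data, the random effects
being integrated out. -/
def logLik (G : SimpleGraph (Fin N)) (d : Data p N) (φ : Param p) : ℝ :=
  let C := d.1
  let A := d.2.1
  let M := d.2.2.1
  let Y := d.2.2.2
  gaussLogDensity (covMatrix G (variances φ 0) (variances φ 1)) (Y - designY G C A M *ᵥ beta φ)
  + gaussLogDensity (covMatrix G (variances φ 2) (variances φ 3)) (M - designM G C A *ᵥ gamma φ)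
  + ((∑ i, A i * Real.log (propensity (alpha φ) (C i) / (1 - propensity (alpha φ) (C i))))
      + ∑ i, Real.log (1 - propensity (alpha φ) (C i)))

/-- The observed information matrix `J_N(φ) = -∇² l(φ)`. -/
def obsInfo (S : Model p) (N : ℕ) (φ : Param p) (d : Data p N) :
    Matrix (ParamIdx p) (ParamIdx p) ℝ :=
  -hessian (logLik (S.graph N) d) φ

/-- The mosaic matrix `J_N(Φ)`, whose `k`-th row is the `k`-th row of `J_N(φ_k)`. -/
def mosaicInfo (S : Model p) (N : ℕ) (Φ : ParamIdx p → Param p) (d : Data p N) :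
    Matrix (ParamIdx p) (ParamIdx p) ℝ :=
  Matrix.of fun k l => obsInfo S N (Φ k) d k l

/-- The Fisher information matrix `B_N(φ) = 𝔼_φ J_N(φ)`. -/
def fisherInfo (S : Model p) (N : ℕ) (φ : Param p) : Matrix (ParamIdx p) (ParamIdx p) ℝ :=
  Matrix.of fun k l => ∫ d, obsInfo S N φ d k l ∂(dataLaw S N φ)

/-- `φhat` is a maximum likelihood estimator over `Θ`, when `φ₀` generates the data. -/
structure IsMLE (S : Model p) (Θ : Set (Param p)) (φ₀ : Param p)
    (φhat : ∀ N : ℕ, Data p N → Param p) : Prop where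
  aemeasurable : ∀ N, AEMeasurable (φhat N) (dataLaw S N φ₀)
  mem : ∀ N, ∀ᵐ d ∂(dataLaw S N φ₀), φhat N d ∈ Θ
  isMax : ∀ N, ∀ᵐ d ∂(dataLaw S N φ₀), IsMaxOn (logLik (S.graph N) d) Θ (φhat N d)

/-! ## Regularity conditions -/

/-- Growth of information: `B_N` exists, is positive definite and continuous on `Θ` (for all large
`N`), and `sup_Θ ‖B_N⁻¹‖_F → 0`. -/
structure InfoGrowth (S : Model p) (Θ : Set (Param p)) : Prop where
  integrable : ∀ᶠ N in atTop, ∀ φ ∈ Θ, ∀ k l,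
    Integrable (fun d => obsInfo S N φ d k l) (dataLaw S N φ)
  posDef : ∀ᶠ N in atTop, ∀ φ ∈ Θ, (fisherInfo S N φ).PosDef
  continuousOn : ∀ᶠ N in atTop, ContinuousOn (fisherInfo S N) Θ
  inv_tendsto : ∀ η : ℝ, 0 < η → ∀ᶠ N in atTop, ∀ φ ∈ Θ, frob ((fisherInfo S N φ)⁻¹) ≤ η

/-- `sup_{φ ∈ Θ} 𝔼_φ ‖B_N^{-1/2} J_N B_N^{-1/2} - I‖_F² → 0`. -/
def InfoStability (S : Model p) (Θ : Set (Param p)) : Prop :=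
  ∀ η : ℝ, 0 < η → ∀ᶠ N in atTop, ∀ φ ∈ Θ,
    ∫⁻ d, ENNReal.ofReal (frob (misqrt (fisherInfo S N φ) * obsInfo S N φ d *
      misqrt (fisherInfo S N φ) - 1) ^ 2) ∂(dataLaw S N φ) ≤ ENNReal.ofReal η

/-- Local continuity of the expected (`expected`) and of the observed (`observed`) information, on
the scale of `B_N^{-1/2}`. -/
structure InfoContinuity (S : Model p) (Θ : Set (Param p)) : Prop where
  expected : ∀ ε : ℝ, 0 < ε → ∀ η : ℝ, 0 < η → ∀ᶠ N in atTop, ∀ φ ∈ Θ, ∀ φ' ∈ Θ,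
    ‖WithLp.toLp 2 (msqrt (fisherInfo S N φ) *ᵥ (φ - φ').ofLp)‖ ≤ ε →
      frob (misqrt (fisherInfo S N φ) * msqrt (fisherInfo S N φ') - 1) ≤ η
  observed : ∀ ε : ℝ, 0 < ε → ∀ η : ℝ, 0 < η → ∀ φ ∈ Θ, Tendsto (fun N => dataLaw S N φ
    {d | ∃ Φ : ParamIdx p → Param p, (∀ k, Φ k ∈ Θ) ∧
      (∀ k, ‖WithLp.toLp 2 (msqrt (fisherInfo S N φ) *ᵥ (φ - Φ k).ofLp)‖ ≤ ε) ∧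
      η < frob (misqrt (fisherInfo S N φ) * (mosaicInfo S N Φ d - obsInfo S N φ d) *
        misqrt (fisherInfo S N φ))}) atTop (𝓝 0)

/-- The sandwich variance `Q_N = ∇g_N(φ₀)ᵀ B_N⁻¹(φ₀) ∇g_N(φ₀)`. -/
def sandwich (S : Model p) (φ₀ : Param p) (g : ℕ → Param p → ℝ) (N : ℕ) : ℝ :=
  (gradient (g N) φ₀).ofLp ⬝ᵥ ((fisherInfo S N φ₀)⁻¹ *ᵥ (gradient (g N) φ₀).ofLp)

/-- The coefficient `z_{N,k}` of the gradient of `g_N` at `φ₀` along the eigenvector `v_{N,k}`. -/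
def gradCoeff (φ₀ : Param p) (g : ℕ → Param p → ℝ)
    (v : ℕ → OrthonormalBasis (Fin (numParam p)) ℝ (Param p)) (N : ℕ) (k : Fin (numParam p)) : ℝ :=
  inner ℝ (v N k) (gradient (g N) φ₀)

/-- `u_{N,k} = √λ_{N,k} z_{N,k} v_{N,k} / √(∑_j λ_{N,j} z_{N,j}²)`. -/
def unitCoeff (φ₀ : Param p) (g : ℕ → Param p → ℝ) (lam : ℕ → Fin (numParam p) → ℝ)
    (v : ℕ → OrthonormalBasis (Fin (numParam p)) ℝ (Param p)) (N : ℕ) (k : Fin (numParam p)) :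
    Param p :=
  (Real.sqrt (lam N k) * gradCoeff φ₀ g v N k /
    Real.sqrt (∑ j, lam N j * gradCoeff φ₀ g v N j ^ 2)) • v N k

/-- The conditions on the functions `g_N` and on the eigenstructure of `B_N⁻¹(φ₀)`: `lam N` lists
its eigenvalues in nonincreasing order and `v N` is a corresponding orthonormal eigenbasis. The
leading eigenvalues are the first `r` ones; the rate `N^{-δ_k}` is their exact order, and the
gradient of `g_N` does not become orthogonal to their eigenvectors. -/
structure GradientEigenstructure (S : Model p) (Θ : Set (Param p)) (φ₀ : Param p)
    (g : ℕ → Param p → ℝ) (lam : ℕ → Fin (numParam p) → ℝ)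
    (v : ℕ → OrthonormalBasis (Fin (numParam p)) ℝ (Param p))
    (δ : Fin (numParam p) → ℝ) (r : ℕ) : Prop where
  grad_ne_zero : ∀ᶠ N in atTop, gradient (g N) φ₀ ≠ 0
  grad_bounded : ∃ C₁ : ℝ, ∀ᶠ N in atTop, ‖gradient (g N) φ₀‖ ≤ C₁
  hess_bounded : ∃ ε : ℝ, 0 < ε ∧ ∃ C₂ : ℝ, ∀ᶠ N in atTop, ∀ φ' ∈ Metric.ball φ₀ ε ∩ Θ,
    frob (hessian (g N) φ') ≤ C₂
  eigen_antitone : ∀ᶠ N in atTop, Antitone (lam N)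
  eigen : ∀ᶠ N in atTop, ∀ k, (fisherInfo S N φ₀)⁻¹ *ᵥ (v N k).ofLp = lam N k • (v N k).ofLp
  coeff_bounded : ∀ k, (fun N => gradCoeff φ₀ g v N k) =O[atTop] fun _ => (1 : ℝ)
  one_le_r : 1 ≤ r
  r_le : r ≤ numParam p
  rate_monotone : Monotone δ
  rate_eq : ∀ j k : Fin (numParam p), (j : ℕ) < r → (k : ℕ) < r → δ j = δ k
  rate_lt : ∀ j k : Fin (numParam p), (j : ℕ) < r → r ≤ (k : ℕ) → δ j < δ k
  eigen_upper : ∀ k, (fun N => lam N k) =O[atTop] fun N : ℕ => (N : ℝ) ^ (-δ k)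
  eigen_lower : ∀ k : Fin (numParam p), (k : ℕ) < r →
    (fun N : ℕ => (N : ℝ) ^ (-δ k)) =O[atTop] fun N => lam N k
  leading : ∃ c : ℝ, 0 < c ∧ ∀ᶠ N in atTop,
    c ≤ ∑ k : Fin (numParam p), if (k : ℕ) < r then gradCoeff φ₀ g v N k ^ 2 else 0
  cauchy : ∀ k, CauchySeq fun N => unitCoeff φ₀ g lam v N k

end RenSem

end

open MeasureTheory ProbabilityTheory Filter Topology Matrix
open scoped MatrixOrder

noncomputable section

namespace RenSem

section

set_option linter.unusedSectionVars false

/-! ## Frobenius norm and square roots -/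

section LinearAlgebra

variable {m n : Type*} [Fintype m] [Fintype n]

/-! The proof reduces the model to independent standard noise and then runs likelihood asymptotics
in the norm `infoNorm B x = ‖B^{1/2} x‖`, where `B` is the Fisher information at the true parameter.

Reduction. Since `E` is symmetric, one orthogonal matrix diagonalises every covariance `sI + tEEᵀ`
(`covMatrix_eq_specRot`). Rotating and standardising the two noise vectors writes the data as a
function of confounders, uniform variables and two standard Gaussian vectors (`dataLaw_eq_map`). The
log-likelihood ratio between `φ + b` and `φ` becomes a sum of two Gaussian parts and a logistic part
(`logLik_sub`), whose arguments `X`, `y`, `η` (scaled regression, relative variance change, linear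
predictor) are linear in `b`. The Fisher information splits accordingly (`fisher_quad`). Inserting
directions supported on one coordinate block into the stability assumption gives a law of large
numbers for each block.

Tightness. The maximiser is global, so a local expansion is not enough. The Gaussian parts are at
most a negative quadratic plus a score whose weights depend on the competing parameter. The weights
have the form `1 / (aP_i + b(1 - P_i))`, and a geometric expansion bounds all such weighted scores
at once by a statistic of bounded mean (`abs_sum_div_le_supStat`, `exists_scoreBound_const`). The
logistic part is concave, so its local quadratic bound, which comes from continuity of the observed
information, extends to all distances (`bernPart_smul_ge`). Together these confine the maximiser to
an information ball of bounded radius (`infoNorm_le_of_logLik_le`). As `B⁻¹ → 0`, that ball lies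
inside `Θ`, the gradient vanishes at the maximiser, and a row-wise mean value theorem gives
`cᵀB(φhat - φ) ≈ score(c)` (`IsRegular.expansion`).

Central limit theorem. For a direction of information one, the noise layers are integrated out one
at a time (`tendsto_integral_redScore`). Conditionally, a Gaussian block has an explicit
characteristic function, nearly Gaussian once all relative variance changes are small. The logistic
block has moment generating function `exp(r² I(ξ)/2)`, with `I(ξ)` the information at an
intermediate point. Closeness of moment generating functions is turned into closeness of
characteristic functions by comparing Taylor coefficients (`exists_charFun_close`). No Lindeberg
condition is needed.

Delta method. The direction `Q^{-1/2} B⁻¹∇g` has information one and turns the linearised equation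
into a statement on `Q^{-1/2} ∇gᵀ(φhat - φ)`. The eigenvalue conditions make `B⁻¹` at most a
constant times `Q` (`variance_rate`), so the second-order remainder is `O(Q)` in probability,
negligible after division by `√Q` because `Q → 0`. -/

theorem frob_nonneg (H : Matrix m n ℝ) : 0 ≤ frob H := Real.sqrt_nonneg _

theorem frob_sq (H : Matrix m n ℝ) : frob H ^ 2 = ∑ i, ∑ j, H i j ^ 2 := by
  have h : Matrix.trace (Hᵀ * H) = ∑ i, ∑ j, H i j ^ 2 := by
    rw [Finset.sum_comm]
    simp only [Matrix.trace, Matrix.diag, Matrix.mul_apply, Matrix.transpose_apply, sq]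
  rw [frob, Real.sq_sqrt, h]
  rw [h]; positivity

theorem norm_toLp_sq (x : n → ℝ) : ‖WithLp.toLp 2 x‖ ^ 2 = x ⬝ᵥ x := by
  rw [EuclideanSpace.real_norm_sq_eq]
  simp [dotProduct, sq]

theorem abs_dotProduct_le (x y : n → ℝ) :
    |x ⬝ᵥ y| ≤ ‖WithLp.toLp 2 x‖ * ‖WithLp.toLp 2 y‖ := by
  have h := abs_real_inner_le_norm (WithLp.toLp 2 y) (WithLp.toLp 2 x)
  rw [EuclideanSpace.inner_toLp_toLp] at h
  simpa [mul_comm] using h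

theorem norm_mulVec_le_frob (H : Matrix m n ℝ) (x : n → ℝ) :
    ‖WithLp.toLp 2 (H *ᵥ x)‖ ≤ frob H * ‖WithLp.toLp 2 x‖ := by
  refine abs_le_of_sq_le_sq' ?_ (mul_nonneg (frob_nonneg H) (norm_nonneg _)) |>.2
  rw [mul_pow, frob_sq, EuclideanSpace.real_norm_sq_eq, EuclideanSpace.real_norm_sq_eq,
    Finset.sum_mul]
  refine Finset.sum_le_sum fun i _ => ?_
  simpa [Matrix.mulVec, dotProduct] using
    Finset.sum_mul_sq_le_sq_mul_sq Finset.univ (fun j => H i j) x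

theorem abs_dotProduct_mulVec_le (H : Matrix n n ℝ) (x y : n → ℝ) :
    |x ⬝ᵥ (H *ᵥ y)| ≤ frob H * (‖WithLp.toLp 2 x‖ * ‖WithLp.toLp 2 y‖) := by
  refine (abs_dotProduct_le x _).trans ?_
  have := mul_le_mul_of_nonneg_left (norm_mulVec_le_frob H y) (norm_nonneg (WithLp.toLp 2 x))
  linarith

variable [DecidableEq n] {B : Matrix n n ℝ}

theorem msqrt_mul_msqrt (hB : B.PosDef) : msqrt B * msqrt B = B :=
  CFC.sqrt_mul_sqrt_self B (Matrix.nonneg_iff_posSemidef.2 hB.posSemidef)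

theorem msqrt_transpose (B : Matrix n n ℝ) : (msqrt B)ᵀ = msqrt B := by
  have h : (msqrt B).PosSemidef := Matrix.nonneg_iff_posSemidef.1 (CFC.sqrt_nonneg B)
  simpa using h.isHermitian.eq

theorem isUnit_det_msqrt (hB : B.PosDef) : IsUnit (msqrt B).det := by
  have h : (msqrt B).det * (msqrt B).det = B.det := by rw [← Matrix.det_mul, msqrt_mul_msqrt hB]
  have h2 : B.det ≠ 0 := hB.det_pos.ne'
  rw [isUnit_iff_ne_zero]
  intro h0
  rw [h0] at h
  exact h2 (by simpa using h.symm)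

theorem misqrt_mul_msqrt (hB : B.PosDef) : misqrt B * msqrt B = 1 :=
  Matrix.nonsing_inv_mul _ (isUnit_det_msqrt hB)

theorem msqrt_mul_misqrt (hB : B.PosDef) : msqrt B * misqrt B = 1 :=
  Matrix.mul_nonsing_inv _ (isUnit_det_msqrt hB)

theorem misqrt_transpose (B : Matrix n n ℝ) : (misqrt B)ᵀ = misqrt B := by
  rw [misqrt, Matrix.transpose_nonsing_inv, msqrt_transpose]

theorem misqrt_mul_misqrt (hB : B.PosDef) : misqrt B * misqrt B = B⁻¹ := by
  rw [misqrt, ← Matrix.mul_inv_rev, msqrt_mul_msqrt hB]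

theorem dotProduct_misqrt (B : Matrix n n ℝ) (x y : n → ℝ) :
    x ⬝ᵥ (misqrt B *ᵥ y) = (misqrt B *ᵥ x) ⬝ᵥ y := by
  rw [Matrix.dotProduct_mulVec, ← Matrix.mulVec_transpose, misqrt_transpose]

theorem dotProduct_msqrt (B : Matrix n n ℝ) (x y : n → ℝ) :
    x ⬝ᵥ (msqrt B *ᵥ y) = (msqrt B *ᵥ x) ⬝ᵥ y := by
  rw [Matrix.dotProduct_mulVec, ← Matrix.mulVec_transpose, msqrt_transpose]

/-- The norm `‖B^{1/2} x‖`. -/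
def infoNorm (B : Matrix n n ℝ) (x : n → ℝ) : ℝ := ‖WithLp.toLp 2 (msqrt B *ᵥ x)‖

theorem infoNorm_nonneg (B : Matrix n n ℝ) (x : n → ℝ) : 0 ≤ infoNorm B x := norm_nonneg _

theorem infoNorm_sq (hB : B.PosDef) (x : n → ℝ) : infoNorm B x ^ 2 = x ⬝ᵥ (B *ᵥ x) := by
  rw [infoNorm, norm_toLp_sq, ← dotProduct_msqrt, Matrix.mulVec_mulVec, msqrt_mul_msqrt hB]

theorem misqrt_mulVec_msqrt (hB : B.PosDef) (x : n → ℝ) : misqrt B *ᵥ (msqrt B *ᵥ x) = x := by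
  rw [Matrix.mulVec_mulVec, misqrt_mul_msqrt hB, Matrix.one_mulVec]

theorem msqrt_mulVec_misqrt (hB : B.PosDef) (x : n → ℝ) : msqrt B *ᵥ (misqrt B *ᵥ x) = x := by
  rw [Matrix.mulVec_mulVec, msqrt_mul_misqrt hB, Matrix.one_mulVec]

theorem infoNorm_misqrt (hB : B.PosDef) (x : n → ℝ) :
    infoNorm B (misqrt B *ᵥ x) = ‖WithLp.toLp 2 x‖ := by
  rw [infoNorm, msqrt_mulVec_misqrt hB]

theorem norm_misqrt_mulVec_sq (hB : B.PosDef) (x : n → ℝ) :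
    ‖WithLp.toLp 2 (misqrt B *ᵥ x)‖ ^ 2 = x ⬝ᵥ (B⁻¹ *ᵥ x) := by
  rw [norm_toLp_sq, ← dotProduct_misqrt, Matrix.mulVec_mulVec, misqrt_mul_misqrt hB]

/-- As `x = B^{-1/2} (B^{1/2} x)`, the left side is the quadratic form of `B⁻¹` at `B^{1/2} x`.
Together with `B⁻¹ → 0` this makes information balls of fixed radius shrink in the Euclidean norm.
-/
theorem norm_sq_le_infoNorm (hB : B.PosDef) (x : n → ℝ) :
    ‖WithLp.toLp 2 x‖ ^ 2 ≤ frob B⁻¹ * infoNorm B x ^ 2 := by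
  have h := norm_misqrt_mulVec_sq hB (msqrt B *ᵥ x)
  rw [misqrt_mulVec_msqrt hB] at h
  rw [h, infoNorm, sq]
  exact (le_abs_self _).trans (abs_dotProduct_mulVec_le _ _ _)

theorem infoNorm_smul (B : Matrix n n ℝ) (r : ℝ) (x : n → ℝ) :
    infoNorm B (r • x) = |r| * infoNorm B x := by
  rw [infoNorm, Matrix.mulVec_smul, WithLp.toLp_smul, norm_smul, Real.norm_eq_abs, infoNorm]

theorem infoNorm_neg (B : Matrix n n ℝ) (x : n → ℝ) :
    infoNorm B (-x) = infoNorm B x := by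
  rw [infoNorm, Matrix.mulVec_neg, WithLp.toLp_neg, norm_neg, infoNorm]

/-- Substitute `x = B^{-1/2} (B^{1/2} x)` on both sides of the form. The normalised Frobenius bounds
of the assumptions enter the proof through this inequality. -/
theorem abs_quad_le_of_frob (hB : B.PosDef) (H : Matrix n n ℝ) (x y : n → ℝ) :
    |x ⬝ᵥ (H *ᵥ y)| ≤ frob (misqrt B * H * misqrt B) * (infoNorm B x * infoNorm B y) := by
  have h : x ⬝ᵥ (H *ᵥ y) =
      (msqrt B *ᵥ x) ⬝ᵥ ((misqrt B * H * misqrt B) *ᵥ (msqrt B *ᵥ y)) := by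
    rw [← Matrix.mulVec_mulVec, ← Matrix.mulVec_mulVec, misqrt_mulVec_msqrt hB, dotProduct_misqrt,
      misqrt_mulVec_msqrt hB]
  rw [h]
  exact abs_dotProduct_mulVec_le _ _ _

theorem misqrt_conj_sub (hB : B.PosDef) (H : Matrix n n ℝ) :
    misqrt B * (H - B) * misqrt B = misqrt B * H * misqrt B - 1 := by
  rw [mul_sub, sub_mul]
  congr 1
  nth_rewrite 2 [← msqrt_mul_msqrt hB]
  rw [← mul_assoc, misqrt_mul_msqrt hB, one_mul, msqrt_mul_misqrt hB]

/-- The error is relative to `xᵀBx` and uniform in `x`, so it can be applied to directions supported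
on a single coordinate block. -/
theorem abs_quad_sub_le (hB : B.PosDef) (H : Matrix n n ℝ) (x : n → ℝ) :
    |x ⬝ᵥ (H *ᵥ x) - x ⬝ᵥ (B *ᵥ x)| ≤
      frob (misqrt B * H * misqrt B - 1) * (x ⬝ᵥ (B *ᵥ x)) := by
  have h := abs_quad_le_of_frob hB (H - B) x x
  rwa [misqrt_conj_sub hB, Matrix.sub_mulVec, dotProduct_sub, ← sq, infoNorm_sq hB] at h

/-- Expansion of the quadratic form of a matrix in an orthonormal eigenbasis. -/
theorem quadForm_eq_sum_eigen {ι : Type*} [Fintype ι] (H : Matrix n n ℝ)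
    (v : OrthonormalBasis ι ℝ (EuclideanSpace ℝ n)) (lam : ι → ℝ)
    (hv : ∀ k, H *ᵥ (v k).ofLp = lam k • (v k).ofLp) (x : EuclideanSpace ℝ n) :
    x.ofLp ⬝ᵥ (H *ᵥ x.ofLp) = ∑ k, lam k * inner ℝ (v k) x ^ 2 := by
  have hx : x.ofLp = ∑ k, inner ℝ (v k) x • (v k).ofLp := by
    conv_lhs => rw [← v.sum_repr' x]
    simp
  have hH : H *ᵥ x.ofLp = ∑ k, (inner ℝ (v k) x * lam k) • (v k).ofLp := by
    conv_lhs => rw [hx]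
    rw [Matrix.mulVec_sum]
    refine Finset.sum_congr rfl fun k _ => ?_
    rw [Matrix.mulVec_smul, hv, smul_smul]
  rw [hH, dotProduct_sum]
  refine Finset.sum_congr rfl fun k _ => ?_
  rw [dotProduct_smul]
  have : x.ofLp ⬝ᵥ (v k).ofLp = inner ℝ (v k) x := by
    rw [EuclideanSpace.inner_eq_star_dotProduct]; simp
  rw [this, smul_eq_mul]; ring

end LinearAlgebra

/-! ## Hessians -/

section Hessian

variable {n : Type*} [Fintype n] [DecidableEq n] {f : EuclideanSpace ℝ n → ℝ}
  {x : EuclideanSpace ℝ n}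

theorem eq_sum_single (c : EuclideanSpace ℝ n) :
    c = ∑ k, c k • EuclideanSpace.single k (1 : ℝ) := by
  ext j
  simp [Finset.sum_apply, Pi.single_apply]

theorem differentiableAt_fderiv (hf : ContDiffAt ℝ 2 f x) :
    DifferentiableAt ℝ (fderiv ℝ f) x :=
  (hf.fderiv_right (m := 1) (by norm_num)).differentiableAt (by norm_num)

theorem hessian_apply (hf : ContDiffAt ℝ 2 f x) (k l : n) :
    hessian f x k l =
      fderiv ℝ (fderiv ℝ f) x (EuclideanSpace.single k 1) (EuclideanSpace.single l 1) := by
  rw [hessian, Matrix.of_apply,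
    ((differentiableAt_fderiv hf).hasFDerivAt.clm_apply (hasFDerivAt_const _ _)).fderiv]
  simp

theorem dotProduct_hessian (hf : ContDiffAt ℝ 2 f x) (c d : EuclideanSpace ℝ n) :
    c.ofLp ⬝ᵥ (hessian f x *ᵥ d.ofLp) = fderiv ℝ (fderiv ℝ f) x c d := by
  conv_rhs => rw [eq_sum_single c, eq_sum_single d]
  simp only [map_sum, map_smul, _root_.sum_apply, _root_.smul_apply,
    dotProduct, Matrix.mulVec, hessian_apply hf, smul_eq_mul]
  simp only [Finset.mul_sum]
  rw [Finset.sum_comm]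
  refine Finset.sum_congr rfl fun k _ => Finset.sum_congr rfl fun l _ => ?_
  ring

theorem hasDerivAt_line (y c : EuclideanSpace ℝ n) (r : ℝ) :
    HasDerivAt (fun s : ℝ => y + s • c) c r := by
  simpa using ((hasDerivAt_id r).smul_const c).const_add y

theorem hasDerivAt_fderiv_line (c d : EuclideanSpace ℝ n) {y : EuclideanSpace ℝ n} {r : ℝ}
    (hf : ContDiffAt ℝ 2 f (y + r • c)) :
    HasDerivAt (fun s : ℝ => fderiv ℝ f (y + s • c) d)
      (fderiv ℝ (fderiv ℝ f) (y + r • c) c d) r := by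
  have h1 := (differentiableAt_fderiv hf).hasFDerivAt.comp_hasDerivAt r (hasDerivAt_line y c r)
  simpa using h1.clm_apply (hasDerivAt_const r d)

/-- The Hessian quadratic form as a second derivative along a line. -/
theorem quad_hessian_eq (hf : ContDiffAt ℝ 2 f x) (c : EuclideanSpace ℝ n) {ψ : ℝ → ℝ} {m : ℝ}
    (h1 : ∀ᶠ r in 𝓝 (0 : ℝ), HasDerivAt (fun s : ℝ => f (x + s • c)) (ψ r) r)
    (h2 : HasDerivAt ψ m 0) :
    c.ofLp ⬝ᵥ (hessian f x *ᵥ c.ofLp) = m := by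
  rw [dotProduct_hessian hf]
  have hc : Tendsto (fun s : ℝ => x + s • c) (𝓝 0) (𝓝 x) := by
    have : ContinuousAt (fun s : ℝ => x + s • c) 0 := by fun_prop
    simpa [ContinuousAt] using this
  have h3 : ψ =ᶠ[𝓝 0] fun s => fderiv ℝ f (x + s • c) c := by
    have h4 := hc.eventually (hf.eventually (by simp))
    filter_upwards [h1, h4] with r hr hr'
    have h5 := (hr'.differentiableAt (by norm_num)).hasFDerivAt.comp_hasDerivAt r
      (hasDerivAt_line x c r)
    exact hr.unique h5
  have h6 := (h2.congr_of_eventuallyEq h3.symm)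
  have h7 := hasDerivAt_fderiv_line (f := f) (y := x) (r := 0) c c (by simpa using hf)
  simpa using h7.unique h6

/-- Row-wise mean value theorem for the gradient. -/
theorem exists_mosaic (y h : EuclideanSpace ℝ n)
    (hf : ∀ r ∈ Set.Icc (0 : ℝ) 1, ContDiffAt ℝ 2 f (y + r • h)) (k : n) :
    ∃ r ∈ Set.Ioo (0 : ℝ) 1, fderiv ℝ f (y + h) (EuclideanSpace.single k 1) -
      fderiv ℝ f y (EuclideanSpace.single k 1) = (hessian f (y + r • h) *ᵥ h.ofLp) k := by
  have hd := fun r (hr : r ∈ Set.Icc (0 : ℝ) 1) =>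
    hasDerivAt_fderiv_line h (EuclideanSpace.single k 1) (hf r hr)
  obtain ⟨r, hr, he⟩ := exists_hasDerivAt_eq_slope
    (fun s : ℝ => fderiv ℝ f (y + s • h) (EuclideanSpace.single k 1)) _ zero_lt_one
    (fun r hr => (hd r hr).continuousAt.continuousWithinAt)
    (fun r hr => hd r (Set.Ioo_subset_Icc_self hr))
  refine ⟨r, hr, ?_⟩
  have hfr := hf r (Set.Ioo_subset_Icc_self hr)
  -- The mean value theorem yields `D²f(h, e_k)`, while row `k` of the Hessian is `D²f(e_k, h)`;
  -- symmetry of the second derivative exchanges the two.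
  have hs := hfr.isSymmSndFDerivAt (by simp) h (EuclideanSpace.single k 1)
  rw [hs, ← dotProduct_hessian hfr] at he
  simp only [one_smul, zero_smul, add_zero, sub_zero, div_one] at he
  rw [← he]
  simp

/-- Second-order Taylor bound along a segment. -/
theorem abs_taylor_le (y h : EuclideanSpace ℝ n)
    (hf : ∀ r ∈ Set.Icc (0 : ℝ) 1, ContDiffAt ℝ 2 f (y + r • h)) {C : ℝ}
    (hC : ∀ r ∈ Set.Icc (0 : ℝ) 1, frob (hessian f (y + r • h)) ≤ C) :
    |f (y + h) - f y - fderiv ℝ f y h| ≤ C * ‖h‖ ^ 2 := by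
  have hd1 : ∀ r ∈ Set.Icc (0 : ℝ) 1,
      HasDerivAt (fun s : ℝ => f (y + s • h)) (fderiv ℝ f (y + r • h) h) r := fun r hr =>
    ((hf r hr).differentiableAt (by norm_num)).hasFDerivAt.comp_hasDerivAt r (hasDerivAt_line y h r)
  have hd2 := fun r (hr : r ∈ Set.Icc (0 : ℝ) 1) => hasDerivAt_fderiv_line h h (hf r hr)
  -- Two mean value theorems: the increment is the slope at `r`, and its difference from the slope
  -- at `0` is `r` times a second derivative. With `r < 1` the constant is `C` rather than `C/2`,
  -- which suffices.
  obtain ⟨r, hr, he⟩ := exists_hasDerivAt_eq_slope (fun s : ℝ => f (y + s • h)) _ zero_lt_one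
    (fun r hr => (hd1 r hr).continuousAt.continuousWithinAt)
    (fun r hr => hd1 r (Set.Ioo_subset_Icc_self hr))
  have hsub : Set.Icc 0 r ⊆ Set.Icc (0 : ℝ) 1 := Set.Icc_subset_Icc_right hr.2.le
  obtain ⟨q, hq, he'⟩ := exists_hasDerivAt_eq_slope (fun s : ℝ => fderiv ℝ f (y + s • h) h) _ hr.1
    (fun r hr => (hd2 r (hsub hr)).continuousAt.continuousWithinAt)
    (fun r hr => hd2 r (hsub (Set.Ioo_subset_Icc_self hr)))
  have hq' := hsub (Set.Ioo_subset_Icc_self hq)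
  rw [← dotProduct_hessian (hf q hq')] at he'
  simp only [one_smul, zero_smul, add_zero, sub_zero, div_one] at he he'
  rw [← he, ← (div_mul_cancel₀ (fderiv ℝ f (y + r • h) h - fderiv ℝ f y h) hr.1.ne'), ← he',
    abs_mul]
  have hb := abs_dotProduct_mulVec_le (hessian f (y + q • h)) h.ofLp h.ofLp
  rw [WithLp.toLp_ofLp, ← sq] at hb
  have hb' := hb.trans (mul_le_mul_of_nonneg_right (hC q hq') (sq_nonneg ‖h‖))
  rw [abs_of_pos hr.1]
  calc _ ≤ C * ‖h‖ ^ 2 * r := mul_le_mul_of_nonneg_right hb' hr.1.le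
    _ ≤ C * ‖h‖ ^ 2 * 1 := mul_le_mul_of_nonneg_left hr.2.le ((abs_nonneg _).trans hb')
    _ = _ := mul_one _

end Hessian

end

section

variable {p N : ℕ}

/-! ## Spectral decomposition of the network -/

theorem adj_transpose (G : SimpleGraph (Fin N)) : (adj G)ᵀ = adj G := by
  classical
  ext i j
  simp only [adj, Matrix.transpose_apply, Matrix.of_apply]
  congr 1
  rw [eq_comm (a := j), G.adj_comm]

theorem adj_isHermitian (G : SimpleGraph (Fin N)) : (adj G).IsHermitian := by
  rw [Matrix.IsHermitian, Matrix.conjTranspose_eq_transpose_of_trivial, adj_transpose]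

/-- An orthogonal matrix diagonalising the network. -/
def specRot (G : SimpleGraph (Fin N)) : Matrix (Fin N) (Fin N) ℝ :=
  (adj_isHermitian G).eigenvectorUnitary

/-- The eigenvalues of the network. -/
def specVal (G : SimpleGraph (Fin N)) : Fin N → ℝ := (adj_isHermitian G).eigenvalues

/-- The eigenvalues of `s · I + t · E Eᵀ`. -/
def cvar (G : SimpleGraph (Fin N)) (s t : ℝ) (i : Fin N) : ℝ := s + t * specVal G i ^ 2

theorem specRot_transpose_mul (G : SimpleGraph (Fin N)) : (specRot G)ᵀ * specRot G = 1 := by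
  have h := Unitary.coe_star_mul_self (adj_isHermitian G).eigenvectorUnitary
  rwa [Matrix.star_eq_conjTranspose, Matrix.conjTranspose_eq_transpose_of_trivial] at h

theorem specRot_mul_transpose (G : SimpleGraph (Fin N)) : specRot G * (specRot G)ᵀ = 1 := by
  have h := Unitary.coe_mul_star_self (adj_isHermitian G).eigenvectorUnitary
  rwa [Unitary.coe_star, Matrix.star_eq_conjTranspose, Matrix.conjTranspose_eq_transpose_of_trivial] at h

theorem adj_eq_specRot (G : SimpleGraph (Fin N)) :
    adj G = specRot G * diagonal (specVal G) * (specRot G)ᵀ := by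
  have h := (adj_isHermitian G).spectral_theorem
  rw [Unitary.conjStarAlgAut_apply, Matrix.star_eq_conjTranspose,
    Matrix.conjTranspose_eq_transpose_of_trivial] at h
  exact h

/-- Symmetry gives `EEᵀ = E²`, diagonal in the eigenbasis of `E`. The rotation does not involve `s`
and `t`, so likelihoods at different parameters separate over the same coordinates. -/
theorem covMatrix_eq_specRot (G : SimpleGraph (Fin N)) (s t : ℝ) :
    covMatrix G s t = specRot G * diagonal (cvar G s t) * (specRot G)ᵀ := by
  have h1 : adj G * (adj G)ᵀ =
      specRot G * diagonal (fun i => specVal G i ^ 2) * (specRot G)ᵀ := by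
    rw [adj_transpose, adj_eq_specRot]
    calc _ = specRot G * diagonal (specVal G) * ((specRot G)ᵀ * specRot G) *
          diagonal (specVal G) * (specRot G)ᵀ := by simp only [mul_assoc]
      _ = specRot G * (diagonal (specVal G) * diagonal (specVal G)) * (specRot G)ᵀ := by
          rw [specRot_transpose_mul]; simp only [mul_assoc, mul_one]
      _ = _ := by rw [Matrix.diagonal_mul_diagonal]; simp only [sq]
  have h2 : diagonal (cvar G s t) = s • (1 : Matrix (Fin N) (Fin N) ℝ) +
      t • diagonal (fun i => specVal G i ^ 2) := by
    ext i j
    by_cases hij : i = j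
    · subst hij; simp [cvar]
    · simp [hij]
  rw [covMatrix, h1, h2, mul_add, add_mul, Matrix.mul_smul, Matrix.mul_smul, Matrix.smul_mul,
    Matrix.smul_mul, mul_one, specRot_mul_transpose]

theorem cvar_pos (G : SimpleGraph (Fin N)) {s t : ℝ} (hs : 0 < s) (ht : 0 < t) (i : Fin N) :
    0 < cvar G s t i := by
  unfold cvar; positivity

theorem covMatrix_inv (G : SimpleGraph (Fin N)) {s t : ℝ} (hs : 0 < s) (ht : 0 < t) :
    (covMatrix G s t)⁻¹ =
      specRot G * diagonal (fun i => (cvar G s t i)⁻¹) * (specRot G)ᵀ := by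
  refine Matrix.inv_eq_right_inv ?_
  rw [covMatrix_eq_specRot]
  calc _ = specRot G * diagonal (cvar G s t) * ((specRot G)ᵀ * specRot G) *
        diagonal (fun i => (cvar G s t i)⁻¹) * (specRot G)ᵀ := by simp only [mul_assoc]
    _ = specRot G * (diagonal (cvar G s t) * diagonal (fun i => (cvar G s t i)⁻¹)) *
        (specRot G)ᵀ := by rw [specRot_transpose_mul]; simp only [mul_assoc, mul_one]
    _ = 1 := by
        rw [Matrix.diagonal_mul_diagonal]
        simp only [mul_inv_cancel₀ (cvar_pos G hs ht _).ne', Matrix.diagonal_one, mul_one,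
          specRot_mul_transpose]

theorem det_covMatrix (G : SimpleGraph (Fin N)) (s t : ℝ) :
    (covMatrix G s t).det = ∏ i, cvar G s t i := by
  rw [covMatrix_eq_specRot, Matrix.det_mul_right_comm, specRot_mul_transpose, one_mul,
    Matrix.det_diagonal]

theorem gaussLogDensity_covMatrix (G : SimpleGraph (Fin N)) {s t : ℝ} (hs : 0 < s) (ht : 0 < t)
    (w : Fin N → ℝ) :
    gaussLogDensity (covMatrix G s t) w = -((N : ℝ) / 2) * Real.log (2 * Real.pi) -
      1 / 2 * ∑ i, (Real.log (cvar G s t i) + ((specRot G)ᵀ *ᵥ w) i ^ 2 / cvar G s t i) := by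
  have h1 : w ⬝ᵥ ((covMatrix G s t)⁻¹ *ᵥ w) =
      ∑ i, ((specRot G)ᵀ *ᵥ w) i ^ 2 / cvar G s t i := by
    rw [covMatrix_inv G hs ht, ← Matrix.mulVec_mulVec, ← Matrix.mulVec_mulVec,
      Matrix.dotProduct_mulVec, ← Matrix.mulVec_transpose, dotProduct]
    refine Finset.sum_congr rfl fun i _ => ?_
    rw [Matrix.mulVec_diagonal]
    field_simp
  rw [gaussLogDensity, h1, det_covMatrix, Real.log_prod (fun i _ => (cvar_pos G hs ht i).ne'),
    Finset.sum_add_distrib]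
  ring

/-! ## The law of the noise in the eigenbasis -/

/-- The noise `E b + ε` in the eigenbasis of the network, standardised. -/
def stdNoise (G : SimpleGraph (Fin N)) (s t : ℝ) (x : (Fin N → ℝ) × (Fin N → ℝ)) : Fin N → ℝ :=
  fun i => ((specRot G)ᵀ *ᵥ (adj G *ᵥ x.1 + x.2)) i / Real.sqrt (cvar G s t i)

theorem measurable_stdNoise (G : SimpleGraph (Fin N)) (s t : ℝ) :
    Measurable (stdNoise G s t) := by
  refine measurable_pi_lambda _ fun i => ?_
  simp only [stdNoise, Matrix.mulVec, dotProduct, Pi.add_apply]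
  fun_prop

theorem integral_cexp_iidGaussian {s : ℝ} (hs : 0 ≤ s) (a : Fin N → ℝ) :
    ∫ x, Complex.exp (((a ⬝ᵥ x : ℝ) : ℂ) * Complex.I) ∂(iidGaussian N s) =
      Complex.exp (-(s * (a ⬝ᵥ a) : ℝ) / 2) := by
  have h : ∀ x : Fin N → ℝ, Complex.exp (((a ⬝ᵥ x : ℝ) : ℂ) * Complex.I) =
      ∏ i, Complex.exp ((a i : ℂ) * (x i : ℂ) * Complex.I) := by
    intro x
    rw [← Complex.exp_sum]
    congr 1
    rw [dotProduct, Complex.ofReal_sum, Finset.sum_mul]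
    simp
  simp_rw [h]
  rw [iidGaussian, integral_fintype_prod_eq_prod
    (f := fun i (x : ℝ) => Complex.exp ((a i : ℂ) * (x : ℂ) * Complex.I))]
  simp_rw [← charFun_apply_real, charFun_gaussianReal]
  rw [← Complex.exp_sum]
  congr 1
  rw [dotProduct]
  push_cast
  rw [Finset.mul_sum, ← Finset.sum_neg_distrib, Finset.sum_div]
  refine Finset.sum_congr rfl fun i _ => ?_
  have : ((s.toNNReal : ℝ) : ℂ) = s := by rw [Real.coe_toNNReal s hs]
  rw [this]
  ring

/-- Compared through characteristic functions: a linear form `ℓ` of the standardised noise is a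
linear form of `(b, ε)`, and its variance is `(Od)ᵀ(sI + tEEᵀ)(Od) = |ℓ|²`, with `O` the rotation
and `d` the vector `ℓ` divided by the standard deviations. -/
theorem measurePreserving_stdNoise (G : SimpleGraph (Fin N)) {s t : ℝ} (hs : 0 < s) (ht : 0 < t) :
    MeasurePreserving (stdNoise G s t) ((iidGaussian N t).prod (iidGaussian N s))
      (iidGaussian N 1) := by
  refine ⟨measurable_stdNoise G s t, ?_⟩
  have := Measure.isProbabilityMeasure_map (μ := (iidGaussian N t).prod (iidGaussian N s))
    (measurable_stdNoise G s t).aemeasurable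
  refine Measure.ext_of_charFunDual ?_
  ext L
  set ℓ : Fin N → ℝ := fun i => L (Pi.single i 1) with hℓ
  have hL : ∀ x : Fin N → ℝ, L x = ℓ ⬝ᵥ x := by
    intro x
    conv_lhs => rw [← Finset.univ_sum_single x]
    rw [map_sum, dotProduct]
    refine Finset.sum_congr rfl fun i _ => ?_
    have : Pi.single i (x i) = x i • (Pi.single i (1 : ℝ) : Fin N → ℝ) := by
      rw [← Pi.single_smul]; simp
    rw [this, map_smul, hℓ, smul_eq_mul, mul_comm]
  set d : Fin N → ℝ := fun i => ℓ i / Real.sqrt (cvar G s t i) with hd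
  have hLs : ∀ x, ℓ ⬝ᵥ stdNoise G s t x =
      (adj G *ᵥ (specRot G *ᵥ d)) ⬝ᵥ x.1 + (specRot G *ᵥ d) ⬝ᵥ x.2 := by
    intro x
    have h1 : ℓ ⬝ᵥ stdNoise G s t x = d ⬝ᵥ ((specRot G)ᵀ *ᵥ (adj G *ᵥ x.1 + x.2)) := by
      simp only [dotProduct, stdNoise, hd]
      exact Finset.sum_congr rfl fun i _ => by ring
    rw [h1, Matrix.dotProduct_mulVec, Matrix.vecMul_transpose, dotProduct_add,
      Matrix.dotProduct_mulVec, ← Matrix.mulVec_transpose, adj_transpose]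
  have hq : t * ((adj G *ᵥ (specRot G *ᵥ d)) ⬝ᵥ (adj G *ᵥ (specRot G *ᵥ d))) +
      s * ((specRot G *ᵥ d) ⬝ᵥ (specRot G *ᵥ d)) = ℓ ⬝ᵥ ℓ := by
    have h1 : (specRot G *ᵥ d) ⬝ᵥ (covMatrix G s t *ᵥ (specRot G *ᵥ d)) = ℓ ⬝ᵥ ℓ := by
      rw [covMatrix_eq_specRot, ← Matrix.mulVec_mulVec, ← Matrix.mulVec_mulVec,
        Matrix.mulVec_mulVec _ (specRot G)ᵀ, specRot_transpose_mul, Matrix.one_mulVec,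
        Matrix.dotProduct_mulVec, ← Matrix.mulVec_transpose, Matrix.mulVec_mulVec,
        specRot_transpose_mul, Matrix.one_mulVec]
      simp only [dotProduct, Matrix.mulVec_diagonal, hd]
      refine Finset.sum_congr rfl fun i _ => ?_
      have hv := cvar_pos G hs ht i
      have h2 : Real.sqrt (cvar G s t i) ≠ 0 := (Real.sqrt_pos.2 hv).ne'
      field_simp
      rw [Real.sq_sqrt hv.le]
    rw [← h1, covMatrix, Matrix.add_mulVec, Matrix.smul_mulVec, Matrix.smul_mulVec,
      Matrix.one_mulVec, dotProduct_add, dotProduct_smul, dotProduct_smul, ← Matrix.mulVec_mulVec,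
      adj_transpose, Matrix.dotProduct_mulVec _ (adj G) (adj G *ᵥ (specRot G *ᵥ d)),
      ← Matrix.mulVec_transpose, adj_transpose]
    simp only [smul_eq_mul]
    ring
  rw [charFunDual_apply, charFunDual_apply]
  simp_rw [hL]
  rw [integral_cexp_iidGaussian zero_le_one, integral_map (measurable_stdNoise G s t).aemeasurable
    (Measurable.aestronglyMeasurable (by simp only [dotProduct]; fun_prop))]
  simp_rw [hLs]
  have h3 : ∀ x : (Fin N → ℝ) × (Fin N → ℝ),
      Complex.exp ((((adj G *ᵥ (specRot G *ᵥ d)) ⬝ᵥ x.1 + (specRot G *ᵥ d) ⬝ᵥ x.2 : ℝ) : ℂ) *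
        Complex.I) =
      Complex.exp ((((adj G *ᵥ (specRot G *ᵥ d)) ⬝ᵥ x.1 : ℝ) : ℂ) * Complex.I) *
      Complex.exp ((((specRot G *ᵥ d) ⬝ᵥ x.2 : ℝ) : ℂ) * Complex.I) := by
    intro x
    rw [← Complex.exp_add]; push_cast; ring_nf
  simp_rw [h3]
  rw [integral_prod_mul (fun x => Complex.exp ((((adj G *ᵥ (specRot G *ᵥ d)) ⬝ᵥ x : ℝ) : ℂ) *
    Complex.I)) (fun x => Complex.exp ((((specRot G *ᵥ d) ⬝ᵥ x : ℝ) : ℂ) * Complex.I)),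
    integral_cexp_iidGaussian ht.le, integral_cexp_iidGaussian hs.le, ← Complex.exp_add]
  congr 1
  rw [← hq]
  push_cast
  ring

end

section

variable {p N : ℕ}

/-! ## The experiment in standardised coordinates -/

/-- Standardised exogenous variables: confounders, exposure noise, mediator and outcome noise. -/
abbrev Red (p N : ℕ) : Type :=
  ((Cov p N × (Fin N → unitInterval)) × (Fin N → ℝ)) × (Fin N → ℝ)

/-- The law of the standardised exogenous variables. -/
def redLaw (μC : Measure (Cov p N)) : Measure (Red p N) :=
  ((μC.prod (Measure.pi fun _ => (volume : Measure unitInterval))).prod (iidGaussian N 1)).prod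
    (iidGaussian N 1)

instance (μC : Measure (Cov p N)) [IsProbabilityMeasure μC] :
    IsProbabilityMeasure (redLaw μC) := by
  unfold redLaw; infer_instance

/-- The noise vector with standardised coordinates `w`. -/
def unstd (G : SimpleGraph (Fin N)) (s t : ℝ) (w : Fin N → ℝ) : Fin N → ℝ :=
  specRot G *ᵥ fun i => Real.sqrt (cvar G s t i) * w i

theorem unstd_stdNoise (G : SimpleGraph (Fin N)) {s t : ℝ} (hs : 0 < s) (ht : 0 < t)
    (x : (Fin N → ℝ) × (Fin N → ℝ)) :
    unstd G s t (stdNoise G s t x) = adj G *ᵥ x.1 + x.2 := by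
  have h : (fun i => Real.sqrt (cvar G s t i) * stdNoise G s t x i) =
      (specRot G)ᵀ *ᵥ (adj G *ᵥ x.1 + x.2) := by
    funext i
    exact mul_div_cancel₀ _ (Real.sqrt_pos.2 (cvar_pos G hs ht i)).ne'
  rw [unstd, h, Matrix.mulVec_mulVec, specRot_mul_transpose, Matrix.one_mulVec]

theorem specRot_transpose_mulVec_unstd (G : SimpleGraph (Fin N)) (s t : ℝ) (w : Fin N → ℝ) :
    (specRot G)ᵀ *ᵥ unstd G s t w = fun i => Real.sqrt (cvar G s t i) * w i := by
  rw [unstd, Matrix.mulVec_mulVec, specRot_transpose_mul, Matrix.one_mulVec]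

/-- The exposures. -/
def expo (φ : Param p) (x : Cov p N × (Fin N → unitInterval)) : Fin N → ℝ :=
  exposure (alpha φ) x.1 x.2

/-- The mediators. -/
def med (G : SimpleGraph (Fin N)) (φ : Param p)
    (x : (Cov p N × (Fin N → unitInterval)) × (Fin N → ℝ)) : Fin N → ℝ :=
  designM G x.1.1 (expo φ x.1) *ᵥ gamma φ + unstd G (variances φ 2) (variances φ 3) x.2

/-- The data as a function of the standardised exogenous variables. -/
def redData (G : SimpleGraph (Fin N)) (φ : Param p) (ω : Red p N) : Data p N :=
  (ω.1.1.1, expo φ ω.1.1, med G φ ω.1,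
    designY G ω.1.1.1 (expo φ ω.1.1) (med G φ ω.1) *ᵥ beta φ +
      unstd G (variances φ 0) (variances φ 1) ω.2)

/-- Passage to the standardised exogenous variables. -/
def toRed (G : SimpleGraph (Fin N)) (φ : Param p) (ω : Noise p N) : Red p N :=
  (((ω.1, ω.2.1), stdNoise G (variances φ 2) (variances φ 3) (ω.2.2.1, ω.2.2.2.1)),
    stdNoise G (variances φ 0) (variances φ 1) (ω.2.2.2.2.1, ω.2.2.2.2.2))

theorem redData_toRed (G : SimpleGraph (Fin N)) {φ : Param p} (hφ : ∀ j, 0 < variances φ j)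
    (ω : Noise p N) : redData G φ (toRed G φ ω) = generate G φ ω := by
  have hM : med G φ (toRed G φ ω).1 =
      mediator G φ ω.1 (exposure (alpha φ) ω.1 ω.2.1) ω.2.2.1 ω.2.2.2.1 := by
    simp only [med, toRed, mediator, unstd_stdNoise G (hφ 2) (hφ 3), expo, add_assoc]
  simp only [redData, generate, hM, outcome]
  simp only [toRed, expo, unstd_stdNoise G (hφ 0) (hφ 1), add_assoc]

theorem measurePreserving_toRed (G : SimpleGraph (Fin N)) {φ : Param p}
    (hφ : ∀ j, 0 < variances φ j) (μC : Measure (Cov p N)) [IsProbabilityMeasure μC] :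
    MeasurePreserving (toRed G φ) (noiseLaw μC φ) (redLaw μC) := by
  have hm := measurePreserving_stdNoise G (hφ 2) (hφ 3)
  have hy := measurePreserving_stdNoise G (hφ 0) (hφ 1)
  have h1 := (((MeasurePreserving.id μC).prod (MeasurePreserving.id
    (Measure.pi fun _ : Fin N => (volume : Measure unitInterval)))).prod hm).prod hy
  set ν := (Measure.pi fun _ : Fin N => (volume : Measure unitInterval))
  set g0 := iidGaussian N (variances φ 0)
  set g1 := iidGaussian N (variances φ 1)
  set g2 := iidGaussian N (variances φ 2)
  set g3 := iidGaussian N (variances φ 3)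
  -- The remaining maps only rebracket the product, so that `(b^M, ε^M)` and `(b^Y, ε^Y)` become
  -- pairs to which the standardisation applies.
  have h2 : MeasurePreserving (MeasurableEquiv.prodAssoc.symm) (g3.prod (g2.prod (g1.prod g0)))
      ((g3.prod g2).prod (g1.prod g0)) :=
    (measurePreserving_prodAssoc g3 g2 (g1.prod g0)).symm _
  have h3 : MeasurePreserving (MeasurableEquiv.prodAssoc.symm)
      (μC.prod (ν.prod ((g3.prod g2).prod (g1.prod g0))))
      ((μC.prod ν).prod ((g3.prod g2).prod (g1.prod g0))) :=
    (measurePreserving_prodAssoc μC ν _).symm _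
  have h4 : MeasurePreserving (MeasurableEquiv.prodAssoc.symm)
      ((μC.prod ν).prod ((g3.prod g2).prod (g1.prod g0)))
      (((μC.prod ν).prod (g3.prod g2)).prod (g1.prod g0)) :=
    (measurePreserving_prodAssoc (μC.prod ν) (g3.prod g2) (g1.prod g0)).symm _
  exact h1.comp (h4.comp (h3.comp
    ((MeasurePreserving.id μC).prod ((MeasurePreserving.id ν).prod h2))))

theorem measurable_expo (φ : Param p) :
    Measurable (expo φ : Cov p N × (Fin N → unitInterval) → Fin N → ℝ) :=
  measurable_exposure _

theorem measurable_unstd (G : SimpleGraph (Fin N)) (s t : ℝ) : Measurable (unstd G s t) := by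
  refine measurable_pi_lambda _ fun i => ?_
  simp only [unstd, Matrix.mulVec, dotProduct]
  fun_prop

theorem measurable_designM_mulVec {α : Type*} [MeasurableSpace α] (G : SimpleGraph (Fin N))
    {C : α → Cov p N} {A : α → Fin N → ℝ} (hC : Measurable C) (hA : Measurable A)
    (h : MIdx p → ℝ) : Measurable fun x => designM G (C x) (A x) *ᵥ h := by
  refine measurable_pi_lambda _ fun i => ?_
  simp only [designM, Matrix.mulVec, dotProduct, Fintype.sum_sum_type,
      Fin.sum_univ_three, Matrix.of_apply, Sum.elim_inl, Sum.elim_inr, Matrix.cons_val]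
  fun_prop

theorem measurable_designY_mulVec {α : Type*} [MeasurableSpace α] (G : SimpleGraph (Fin N))
    {C : α → Cov p N} {A M : α → Fin N → ℝ} (hC : Measurable C) (hA : Measurable A)
    (hM : Measurable M) (h : YIdx p → ℝ) :
    Measurable fun x => designY G (C x) (A x) (M x) *ᵥ h := by
  refine measurable_pi_lambda _ fun i => ?_
  simp only [designY, Matrix.mulVec, dotProduct, Fintype.sum_sum_type,
      Fin.sum_univ_five, Matrix.of_apply, Sum.elim_inl, Sum.elim_inr, Matrix.cons_val]
  fun_prop

theorem measurable_med (G : SimpleGraph (Fin N)) (φ : Param p) : Measurable (med G φ) := by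
  unfold med
  exact (measurable_designM_mulVec G (by fun_prop)
    ((measurable_expo φ).comp measurable_fst) _).add
      ((measurable_unstd G _ _).comp measurable_snd)

theorem measurable_redData (G : SimpleGraph (Fin N)) (φ : Param p) :
    Measurable (redData G φ) := by
  have hA : Measurable fun ω : Red p N => expo φ ω.1.1 :=
    (measurable_expo φ).comp (measurable_fst.comp measurable_fst)
  have hM : Measurable fun ω : Red p N => med G φ ω.1 := (measurable_med G φ).comp measurable_fst
  exact (by fun_prop : Measurable fun ω : Red p N => ω.1.1.1).prodMk (hA.prodMk (hM.prodMk
    ((measurable_designY_mulVec G (by fun_prop) hA hM _).add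
      ((measurable_unstd G _ _).comp measurable_snd))))

/-- All later probabilities are computed under `redLaw`, which is a product measure and does not
depend on the parameter. -/
theorem dataLaw_eq_map (S : Model p) (N : ℕ) {φ : Param p} (hφ : ∀ j, 0 < variances φ j) :
    dataLaw S N φ = (redLaw (S.covLaw N)).map (redData (S.graph N) φ) := by
  have := S.isProb N
  rw [← (measurePreserving_toRed (S.graph N) hφ (S.covLaw N)).map_eq,
    Measure.map_map (measurable_redData _ _)
      (measurePreserving_toRed (S.graph N) hφ (S.covLaw N)).measurable, dataLaw]
  congr 1
  funext ω
  exact (redData_toRed _ hφ ω).symm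

/-! ## Linear statistics -/

/-- Fitted values in the eigenbasis, divided by the standard deviations of the noise. -/
def scaledFit {κ : Type*} [Fintype κ] (G : SimpleGraph (Fin N)) (s t : ℝ)
    (X : Matrix (Fin N) κ ℝ) (h : κ → ℝ) : Fin N → ℝ :=
  fun i => ((specRot G)ᵀ *ᵥ (X *ᵥ h)) i / Real.sqrt (cvar G s t i)

/-- Relative changes of the variances in the eigenbasis. -/
def relVar (G : SimpleGraph (Fin N)) (s t ds dt : ℝ) : Fin N → ℝ :=
  fun i => (ds + dt * specVal G i ^ 2) / cvar G s t i

theorem scaledFit_add {κ : Type*} [Fintype κ] (G : SimpleGraph (Fin N)) (s t : ℝ)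
    (X : Matrix (Fin N) κ ℝ) (h h' : κ → ℝ) :
    scaledFit G s t X (h + h') = scaledFit G s t X h + scaledFit G s t X h' := by
  funext i
  simp [scaledFit, Matrix.mulVec_add, add_div]

theorem scaledFit_smul {κ : Type*} [Fintype κ] (G : SimpleGraph (Fin N)) (s t : ℝ)
    (X : Matrix (Fin N) κ ℝ) (r : ℝ) (h : κ → ℝ) :
    scaledFit G s t X (r • h) = r • scaledFit G s t X h := by
  funext i
  simp [scaledFit, Matrix.mulVec_smul, mul_div_assoc]

/-- Standardised mediator regression along a direction of the parameter space. -/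
def regM (G : SimpleGraph (Fin N)) (φ : Param p) (x : Cov p N × (Fin N → unitInterval)) :
    Param p →ₗ[ℝ] (Fin N → ℝ) where
  toFun b := scaledFit G (variances φ 2) (variances φ 3) (designM G x.1 (expo φ x)) (gamma b)
  map_add' _ _ := scaledFit_add _ _ _ _ _ _
  map_smul' _ _ := scaledFit_smul _ _ _ _ _ _

/-- Standardised outcome regression along a direction of the parameter space. -/
def regY (G : SimpleGraph (Fin N)) (φ : Param p)
    (x : (Cov p N × (Fin N → unitInterval)) × (Fin N → ℝ)) : Param p →ₗ[ℝ] (Fin N → ℝ) where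
  toFun b := scaledFit G (variances φ 0) (variances φ 1)
    (designY G x.1.1 (expo φ x.1) (med G φ x)) (beta b)
  map_add' _ _ := scaledFit_add _ _ _ _ _ _
  map_smul' _ _ := scaledFit_smul _ _ _ _ _ _

/-- Relative change of the mediator variances along a direction of the parameter space. -/
def relM (G : SimpleGraph (Fin N)) (φ : Param p) : Param p →ₗ[ℝ] (Fin N → ℝ) where
  toFun b := relVar G (variances φ 2) (variances φ 3) (variances b 2) (variances b 3)
  map_add' b b' := by funext i; simp [relVar, variances]; ring
  map_smul' r b := by funext i; simp [relVar, variances]; ring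

/-- Relative change of the outcome variances along a direction of the parameter space. -/
def relY (G : SimpleGraph (Fin N)) (φ : Param p) : Param p →ₗ[ℝ] (Fin N → ℝ) where
  toFun b := relVar G (variances φ 0) (variances φ 1) (variances b 0) (variances b 1)
  map_add' b b' := by funext i; simp [relVar, variances]; ring
  map_smul' r b := by funext i; simp [relVar, variances]; ring

/-- The linear predictors of the exposure model. -/
def linA (C : Cov p N) : Param p →ₗ[ℝ] (Fin N → ℝ) where
  toFun b := fun i => alpha b ⬝ᵥ C i
  map_add' b b' := by
    funext i
    simp only [Pi.add_apply, ← add_dotProduct]; rfl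
  map_smul' r b := by
    funext i
    simp only [Pi.smul_apply, RingHom.id_apply, ← smul_dotProduct]; rfl

theorem measurable_scaledFit {α κ : Type*} [MeasurableSpace α] [Fintype κ]
    (G : SimpleGraph (Fin N)) (s t : ℝ) {X : α → Matrix (Fin N) κ ℝ} {h : κ → ℝ}
    (hX : Measurable fun x => X x *ᵥ h) : Measurable fun x => scaledFit G s t (X x) h := by
  have hX' := fun i => (measurable_pi_apply i).comp hX
  simp only [Function.comp_def] at hX'
  refine measurable_pi_lambda _ fun i => ?_
  change Measurable fun x => (∑ j, (specRot G)ᵀ i j * (X x *ᵥ h) j) / Real.sqrt (cvar G s t i)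
  fun_prop

theorem measurable_regM (G : SimpleGraph (Fin N)) (φ b : Param p) :
    Measurable fun x => regM G φ x b :=
  measurable_scaledFit G _ _ (measurable_designM_mulVec G measurable_fst (measurable_expo φ) _)

theorem measurable_regY (G : SimpleGraph (Fin N)) (φ b : Param p) :
    Measurable fun x => regY G φ x b :=
  measurable_scaledFit G _ _ (measurable_designY_mulVec G (by fun_prop)
    ((measurable_expo φ).comp measurable_fst) (measurable_med G φ) _)

theorem measurable_linA (b : Param p) : Measurable fun C : Cov p N => linA C b := by
  refine measurable_pi_lambda _ fun i => ?_
  simp only [linA, LinearMap.coe_mk, AddHom.coe_mk, dotProduct]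
  fun_prop

/-! ## The log-likelihood in standardised coordinates -/

/-- Log-likelihood ratio of a Gaussian block in standardised coordinates. -/
def gaussPart (w X y : Fin N → ℝ) : ℝ :=
  -(1 / 2) * ∑ i, (Real.log (1 + y i) + (w i - X i) ^ 2 / (1 + y i) - w i ^ 2)

/-- Log-likelihood ratio of the exposures. -/
def bernPart (A θ η : Fin N → ℝ) : ℝ :=
  ∑ i, (A i * η i - Real.log (1 + Real.exp (θ i + η i)) + Real.log (1 + Real.exp (θ i)))

/-- The relative change of variance is linear in the parameter increment, and one plus it is the
ratio of new to old variance in the eigenbasis. -/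
theorem one_add_relVar (G : SimpleGraph (Fin N)) {s t : ℝ} (hs : 0 < s) (ht : 0 < t)
    (s' t' : ℝ) (i : Fin N) :
    1 + relVar G s t (s' - s) (t' - t) i = cvar G s' t' i / cvar G s t i := by
  have h := (cvar_pos G hs ht i).ne'
  rw [relVar, eq_div_iff h, add_mul, div_mul_cancel₀ _ h]
  simp only [cvar]; ring

/-- After rotation and division by the standard deviations at `(s, t)`, the residual has coordinates
`w i - X i` and the new variances are `1 + y i`; the normalising constants cancel in the difference.
-/
theorem gaussLogDensity_sub (G : SimpleGraph (Fin N)) {s t s' t' : ℝ} (hs : 0 < s) (ht : 0 < t)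
    (hs' : 0 < s') (ht' : 0 < t') {κ : Type*} [Fintype κ] (X : Matrix (Fin N) κ ℝ)
    (h : κ → ℝ) (w : Fin N → ℝ) :
    gaussLogDensity (covMatrix G s' t') (unstd G s t w - X *ᵥ h) -
      gaussLogDensity (covMatrix G s t) (unstd G s t w) =
    gaussPart w (scaledFit G s t X h) (relVar G s t (s' - s) (t' - t)) := by
  rw [gaussLogDensity_covMatrix G hs ht, gaussLogDensity_covMatrix G hs' ht', gaussPart,
    Matrix.mulVec_sub, specRot_transpose_mulVec_unstd]
  have : ∀ a b c : ℝ, a - 1 / 2 * b - (a - 1 / 2 * c) = -(1 / 2) * (b - c) := by intros; ring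
  rw [this, ← Finset.sum_sub_distrib]
  congr 1
  refine Finset.sum_congr rfl fun i _ => ?_
  have hv := cvar_pos G hs ht i
  have hv' := cvar_pos G hs' ht' i
  have hr := Real.sqrt_pos.2 hv
  have h1 : ((specRot G)ᵀ *ᵥ (X *ᵥ h)) i =
      Real.sqrt (cvar G s t i) * scaledFit G s t X h i := by
    rw [scaledFit, mul_div_cancel₀ _ hr.ne']
  rw [one_add_relVar G hs ht, Real.log_div hv'.ne' hv.ne', Pi.sub_apply, h1, ← mul_sub, mul_pow,
    mul_pow, Real.sq_sqrt hv.le]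
  field_simp
  ring

theorem one_sub_propensity (a c : Fin p → ℝ) :
    1 - propensity a c = (1 + Real.exp (a ⬝ᵥ c))⁻¹ := by
  unfold propensity
  have : 1 + Real.exp (a ⬝ᵥ c) ≠ 0 := by positivity
  field_simp
  ring

theorem log_propensity_div (a c : Fin p → ℝ) :
    Real.log (propensity a c / (1 - propensity a c)) = a ⬝ᵥ c := by
  have h : 1 + Real.exp (a ⬝ᵥ c) ≠ 0 := by positivity
  rw [one_sub_propensity, propensity, div_inv_eq_mul, div_mul_cancel₀ _ h, Real.log_exp]

theorem log_one_sub_propensity (a c : Fin p → ℝ) :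
    Real.log (1 - propensity a c) = -Real.log (1 + Real.exp (a ⬝ᵥ c)) := by
  rw [one_sub_propensity, Real.log_inv]

/-- The log-likelihood ratio in standardised coordinates. -/
def redLR (G : SimpleGraph (Fin N)) (φ : Param p) (ω : Red p N) (b : Param p) : ℝ :=
  gaussPart ω.2 (regY G φ ω.1 b) (relY G φ b) + gaussPart ω.1.2 (regM G φ ω.1.1 b) (relM G φ b) +
    bernPart (expo φ ω.1.1) (linA ω.1.1.1 φ) (linA ω.1.1.1 b)

theorem logLik_sub (G : SimpleGraph (Fin N)) {φ b : Param p} (hφ : ∀ j, 0 < variances φ j)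
    (hb : ∀ j, 0 < variances (φ + b) j) (ω : Red p N) :
    logLik G (redData G φ ω) (φ + b) - logLik G (redData G φ ω) φ = redLR G φ ω b := by
  set A := expo φ ω.1.1 with hA
  set M := med G φ ω.1 with hM
  have hvar : ∀ j, variances (φ + b) j - variances φ j = variances b j := fun j => by
    simp [variances]
  have hbeta : beta (φ + b) = beta φ + beta b := rfl
  have hgamma : gamma (φ + b) = gamma φ + gamma b := rfl
  have halpha : alpha (φ + b) = alpha φ + alpha b := rfl
  have hy : gaussLogDensity (covMatrix G (variances (φ + b) 0) (variances (φ + b) 1))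
        ((redData G φ ω).2.2.2 - designY G ω.1.1.1 A M *ᵥ beta (φ + b)) -
      gaussLogDensity (covMatrix G (variances φ 0) (variances φ 1))
        ((redData G φ ω).2.2.2 - designY G ω.1.1.1 A M *ᵥ beta φ) =
      gaussPart ω.2 (regY G φ ω.1 b) (relY G φ b) := by
    have h := gaussLogDensity_sub G (hφ 0) (hφ 1) (hb 0) (hb 1) (designY G ω.1.1.1 A M) (beta b) ω.2
    rw [hvar, hvar] at h
    refine Eq.trans ?_ h
    simp only [redData, ← hA, ← hM, hbeta, Matrix.mulVec_add]
    congr 2 <;> abel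
  have hm : gaussLogDensity (covMatrix G (variances (φ + b) 2) (variances (φ + b) 3))
        (M - designM G ω.1.1.1 A *ᵥ gamma (φ + b)) -
      gaussLogDensity (covMatrix G (variances φ 2) (variances φ 3))
        (M - designM G ω.1.1.1 A *ᵥ gamma φ) =
      gaussPart ω.1.2 (regM G φ ω.1.1 b) (relM G φ b) := by
    have h := gaussLogDensity_sub G (hφ 2) (hφ 3) (hb 2) (hb 3) (designM G ω.1.1.1 A) (gamma b)
      ω.1.2
    rw [hvar, hvar] at h
    refine Eq.trans ?_ h
    rw [hM]
    simp only [med, ← hA, hgamma, Matrix.mulVec_add]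
    congr 2 <;> abel
  have ha : ((∑ i, A i * Real.log (propensity (alpha (φ + b)) (ω.1.1.1 i) /
        (1 - propensity (alpha (φ + b)) (ω.1.1.1 i)))) +
        ∑ i, Real.log (1 - propensity (alpha (φ + b)) (ω.1.1.1 i))) -
      ((∑ i, A i * Real.log (propensity (alpha φ) (ω.1.1.1 i) /
        (1 - propensity (alpha φ) (ω.1.1.1 i)))) +
        ∑ i, Real.log (1 - propensity (alpha φ) (ω.1.1.1 i))) =
      bernPart A (linA ω.1.1.1 φ) (linA ω.1.1.1 b) := by
    simp only [log_propensity_div, log_one_sub_propensity, ← Finset.sum_add_distrib,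
      ← Finset.sum_sub_distrib, bernPart]
    refine Finset.sum_congr rfl fun i _ => ?_
    simp only [linA, LinearMap.coe_mk, AddHom.coe_mk, halpha, add_dotProduct]
    ring
  rw [redLR, ← hy, ← hm, ← ha]
  simp only [logLik, redData, ← hA, ← hM]
  ring

end

section

variable {p N : ℕ}

/-! ## Coordinate blocks -/

/-- The outcome coefficients of a parameter vector, the other coordinates being set to `0`. -/
def keepBeta (c : Param p) : Param p := WithLp.toLp 2 (Sum.elim (beta c) 0)

/-- The mediator coefficients of a parameter vector, the other coordinates being set to `0`. -/
def keepGamma (c : Param p) : Param p := WithLp.toLp 2 (Sum.elim 0 (Sum.elim (gamma c) 0))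

/-- The exposure coefficients of a parameter vector, the other coordinates being set to `0`. -/
def keepAlpha (c : Param p) : Param p :=
  WithLp.toLp 2 (Sum.elim 0 (Sum.elim 0 (Sum.elim (alpha c) 0)))

/-- Each term of the likelihood ratio sees only its own coordinates of the direction. This and the
next lemmas isolate one block by inserting `keepBeta`, `keepGamma` or `keepAlpha`. -/
theorem regY_congr (G : SimpleGraph (Fin N)) (φ : Param p) (x) {b c : Param p}
    (h : beta b = beta c) : regY G φ x b = regY G φ x c :=
  congrArg (scaledFit G _ _ _) h

theorem regM_congr (G : SimpleGraph (Fin N)) (φ : Param p) (x) {b c : Param p}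
    (h : gamma b = gamma c) : regM G φ x b = regM G φ x c :=
  congrArg (scaledFit G _ _ _) h

theorem relY_congr (G : SimpleGraph (Fin N)) (φ : Param p) {b c : Param p}
    (h : variances b = variances c) : relY G φ b = relY G φ c := by
  simp only [relY, LinearMap.coe_mk, AddHom.coe_mk, h]

theorem relM_congr (G : SimpleGraph (Fin N)) (φ : Param p) {b c : Param p}
    (h : variances b = variances c) : relM G φ b = relM G φ c := by
  simp only [relM, LinearMap.coe_mk, AddHom.coe_mk, h]

theorem linA_congr (C : Cov p N) {b c : Param p} (h : alpha b = alpha c) :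
    linA C b = linA C c := by
  simp only [linA, LinearMap.coe_mk, AddHom.coe_mk, h]

theorem regY_eq_zero (G : SimpleGraph (Fin N)) (φ : Param p) (x) {b : Param p}
    (h : beta b = 0) : regY G φ x b = 0 := by
  rw [regY_congr G φ x (c := 0) (by rw [h]; rfl), map_zero]

theorem regM_eq_zero (G : SimpleGraph (Fin N)) (φ : Param p) (x) {b : Param p}
    (h : gamma b = 0) : regM G φ x b = 0 := by
  rw [regM_congr G φ x (c := 0) (by rw [h]; rfl), map_zero]

theorem relY_eq_zero (G : SimpleGraph (Fin N)) (φ : Param p) {b : Param p}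
    (h : variances b = 0) : relY G φ b = 0 := by
  rw [relY_congr G φ (c := 0) (by rw [h]; rfl), map_zero]

theorem relM_eq_zero (G : SimpleGraph (Fin N)) (φ : Param p) {b : Param p}
    (h : variances b = 0) : relM G φ b = 0 := by
  rw [relM_congr G φ (c := 0) (by rw [h]; rfl), map_zero]

theorem linA_eq_zero (C : Cov p N) {b : Param p} (h : alpha b = 0) : linA C b = 0 := by
  rw [linA_congr C (c := 0) (by rw [h]; rfl), map_zero]

/-! ## Score and information in standardised coordinates -/

/-- The logistic function. -/
def sig (x : ℝ) : ℝ := Real.exp x / (1 + Real.exp x)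

/-- The variance of a Bernoulli variable with logit `x`. -/
def bernVar (x : ℝ) : ℝ := sig x * (1 - sig x)

/-- The score of a Gaussian block. -/
def gaussScore (w X y : Fin N → ℝ) : ℝ := ∑ i, (X i * w i + 1 / 2 * y i * (w i ^ 2 - 1))

/-- The score of the exposure block. -/
def bernScore (A θ η : Fin N → ℝ) : ℝ := ∑ i, (A i - sig (θ i)) * η i

/-- The observed information of a Gaussian block. -/
def gaussInfo (w X y : Fin N → ℝ) : ℝ :=
  ∑ i, (X i ^ 2 + 2 * X i * w i * y i + (w i ^ 2 - 1 / 2) * y i ^ 2)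

/-- The observed information of the exposure block. -/
def bernInfo (θ η : Fin N → ℝ) : ℝ := ∑ i, bernVar (θ i) * η i ^ 2

/-- The score in the direction `c`. -/
def redScore (G : SimpleGraph (Fin N)) (φ : Param p) (ω : Red p N) (c : Param p) : ℝ :=
  gaussScore ω.2 (regY G φ ω.1 c) (relY G φ c) +
    gaussScore ω.1.2 (regM G φ ω.1.1 c) (relM G φ c) +
    bernScore (expo φ ω.1.1) (linA ω.1.1.1 φ) (linA ω.1.1.1 c)

theorem sig_pos (x : ℝ) : 0 < sig x := by unfold sig; positivity

theorem one_sub_sig (x : ℝ) : 1 - sig x = (1 + Real.exp x)⁻¹ := by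
  unfold sig
  have : 1 + Real.exp x ≠ 0 := by positivity
  field_simp
  ring

theorem sig_lt_one (x : ℝ) : sig x < 1 := by
  have h : 0 < 1 - sig x := by rw [one_sub_sig]; positivity
  linarith

theorem bernVar_pos (x : ℝ) : 0 < bernVar x :=
  mul_pos (sig_pos x) (sub_pos.2 (sig_lt_one x))

theorem hasDerivAt_log_one_add_exp (x : ℝ) :
    HasDerivAt (fun x => Real.log (1 + Real.exp x)) (sig x) x :=
  ((Real.hasDerivAt_exp x).const_add 1).log (by positivity)

theorem hasDerivAt_sig (x : ℝ) : HasDerivAt sig (bernVar x) x := by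
  have h : 1 + Real.exp x ≠ 0 := by positivity
  have := (Real.hasDerivAt_exp x).div ((Real.hasDerivAt_exp x).const_add 1) h
  refine this.congr_deriv ?_
  rw [bernVar, one_sub_sig, sig]
  field_simp
  ring

theorem hasDerivAt_affine (a c r : ℝ) : HasDerivAt (fun r => a + r * c) c r := by
  simpa using ((hasDerivAt_id r).mul_const c).const_add a

theorem hasDerivAt_bernPart (A θ η₀ η : Fin N → ℝ) (r : ℝ) :
    HasDerivAt (fun r : ℝ => bernPart A θ (η₀ + r • η))
      (∑ i, (A i - sig (θ i + η₀ i + r * η i)) * η i) r := by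
  unfold bernPart
  refine HasDerivAt.fun_sum fun i _ => ?_
  have h1 := (hasDerivAt_affine (η₀ i) (η i) r).const_mul (A i)
  have h2 := (hasDerivAt_log_one_add_exp (θ i + η₀ i + r * η i)).comp r
    (hasDerivAt_affine (θ i + η₀ i) (η i) r)
  have h3 := (h1.sub h2).add_const (Real.log (1 + Real.exp (θ i)))
  refine (h3.congr_deriv (by ring)).congr_of_eventuallyEq (Eventually.of_forall fun s => ?_)
  simp [add_assoc]

theorem hasDerivAt_bernScore (A θ η₀ η : Fin N → ℝ) (r : ℝ) :
    HasDerivAt (fun r : ℝ => ∑ i, (A i - sig (θ i + η₀ i + r * η i)) * η i)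
      (-∑ i, bernVar (θ i + η₀ i + r * η i) * η i ^ 2) r := by
  rw [← Finset.sum_neg_distrib]
  refine HasDerivAt.fun_sum fun i _ => ?_
  have h2 := (hasDerivAt_sig (θ i + η₀ i + r * η i)).comp r
    (hasDerivAt_affine (θ i + η₀ i) (η i) r)
  exact ((h2.const_sub (A i)).mul_const (η i)).congr_deriv (by ring)

theorem hasDerivAt_gaussPart (w X y : Fin N → ℝ) {r : ℝ} (hr : ∀ i, 1 + r * y i ≠ 0) :
    HasDerivAt (fun r : ℝ => gaussPart w (r • X) (r • y))
      (-(1 / 2) * ∑ i, (y i / (1 + r * y i) + (-2 * X i * (w i - r * X i) * (1 + r * y i) -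
        (w i - r * X i) ^ 2 * y i) / (1 + r * y i) ^ 2)) r := by
  unfold gaussPart
  refine HasDerivAt.const_mul _ (HasDerivAt.fun_sum fun i _ => ?_)
  have h1 : HasDerivAt (fun r => 1 + r * y i) (y i) r := hasDerivAt_affine 1 (y i) r
  have h2 : HasDerivAt (fun r => w i - r * X i) (-X i) r := by
    simpa using ((hasDerivAt_id r).mul_const (X i)).const_sub (w i)
  have h3 := ((h1.log (hr i)).add ((h2.pow 2).div h1 (hr i))).sub_const (w i ^ 2)
  exact h3.congr_deriv (by norm_num; ring)

theorem hasDerivAt_gaussScore (w X y : Fin N → ℝ) :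
    HasDerivAt (fun r : ℝ => -(1 / 2) * ∑ i, (y i / (1 + r * y i) +
      (-2 * X i * (w i - r * X i) * (1 + r * y i) -
        (w i - r * X i) ^ 2 * y i) / (1 + r * y i) ^ 2)) (-gaussInfo w X y) 0 := by
  have h : -gaussInfo w X y = -(1 / 2) * ∑ i, (2 * (X i ^ 2 + 2 * X i * w i * y i +
      (w i ^ 2 - 1 / 2) * y i ^ 2)) := by
    rw [gaussInfo, ← Finset.mul_sum]; ring
  rw [h]
  refine HasDerivAt.const_mul _ (HasDerivAt.fun_sum fun i _ => ?_)
  have h1 : HasDerivAt (fun r => 1 + r * y i) (y i) 0 := hasDerivAt_affine 1 (y i) 0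
  have h2 : HasDerivAt (fun r => w i - r * X i) (-X i) 0 := by
    simpa using ((hasDerivAt_id (0 : ℝ)).mul_const (X i)).const_sub (w i)
  have h3 := ((hasDerivAt_const (0 : ℝ) (y i)).div h1 (by norm_num)).add
    ((((h2.const_mul (-2 * X i)).mul h1).sub ((h2.pow 2).mul_const (y i))).div (h1.pow 2)
      (by norm_num))
  refine h3.congr_deriv ?_
  norm_num
  ring

theorem gaussScore_eq (w X y : Fin N → ℝ) :
    -(1 / 2) * ∑ i, (y i / (1 + 0 * y i) + (-2 * X i * (w i - 0 * X i) * (1 + 0 * y i) -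
        (w i - 0 * X i) ^ 2 * y i) / (1 + 0 * y i) ^ 2) = gaussScore w X y := by
  rw [gaussScore, Finset.mul_sum]
  refine Finset.sum_congr rfl fun i _ => ?_
  simp only [zero_mul, add_zero, sub_zero]
  ring

theorem one_add_relY_pos (G : SimpleGraph (Fin N)) {φ b : Param p} (hφ : ∀ j, 0 < variances φ j)
    (hb : ∀ j, 0 < variances (φ + b) j) (i : Fin N) : 0 < 1 + relY G φ b i := by
  have h := one_add_relVar G (hφ 0) (hφ 1) (variances (φ + b) 0) (variances (φ + b) 1) i
  have hvar : ∀ j, variances (φ + b) j - variances φ j = variances b j := fun j => by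
    simp [variances]
  rw [hvar, hvar] at h
  change 0 < 1 + relVar _ _ _ _ _ i
  rw [h]
  exact div_pos (cvar_pos G (hb 0) (hb 1) i) (cvar_pos G (hφ 0) (hφ 1) i)

theorem one_add_relM_pos (G : SimpleGraph (Fin N)) {φ b : Param p} (hφ : ∀ j, 0 < variances φ j)
    (hb : ∀ j, 0 < variances (φ + b) j) (i : Fin N) : 0 < 1 + relM G φ b i := by
  have h := one_add_relVar G (hφ 2) (hφ 3) (variances (φ + b) 2) (variances (φ + b) 3) i
  have hvar : ∀ j, variances (φ + b) j - variances φ j = variances b j := fun j => by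
    simp [variances]
  rw [hvar, hvar] at h
  change 0 < 1 + relVar _ _ _ _ _ i
  rw [h]
  exact div_pos (cvar_pos G (hb 2) (hb 3) i) (cvar_pos G (hφ 2) (hφ 3) i)

theorem contDiff_linear_apply (L : Param p →ₗ[ℝ] (Fin N → ℝ)) (i : Fin N) :
    ContDiff ℝ 2 fun b => L b i :=
  (contDiff_apply ℝ ℝ i).comp (LinearMap.toContinuousLinearMap L).contDiff

theorem contDiffAt_gaussPart (w : Fin N → ℝ) (X y : Param p →ₗ[ℝ] (Fin N → ℝ)) {b : Param p}
    (hb : ∀ i, 0 < 1 + y b i) : ContDiffAt ℝ 2 (fun b => gaussPart w (X b) (y b)) b := by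
  unfold gaussPart
  refine contDiffAt_const.mul (ContDiffAt.sum fun i _ => ?_)
  have hX := (contDiff_linear_apply X i).contDiffAt (x := b)
  have hy := (contDiff_linear_apply y i).contDiffAt (x := b)
  exact (((contDiffAt_const.add hy).log (hb i).ne').add
    (((contDiffAt_const.sub hX).pow 2).div (contDiffAt_const.add hy) (hb i).ne')).sub
      contDiffAt_const

theorem contDiffAt_bernPart (A θ : Fin N → ℝ) (η : Param p →ₗ[ℝ] (Fin N → ℝ)) (b : Param p) :
    ContDiffAt ℝ 2 (fun b => bernPart A θ (η b)) b := by
  unfold bernPart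
  refine ContDiffAt.sum fun i _ => ?_
  have hη := (contDiff_linear_apply η i).contDiffAt (x := b)
  refine ((contDiffAt_const.mul hη).sub ((contDiffAt_const.add
    (contDiffAt_const.add hη).exp).log ?_)).add contDiffAt_const
  positivity

theorem contDiffAt_redLR (G : SimpleGraph (Fin N)) {φ b : Param p} (hφ : ∀ j, 0 < variances φ j)
    (hb : ∀ j, 0 < variances (φ + b) j) (ω : Red p N) : ContDiffAt ℝ 2 (redLR G φ ω) b :=
  ((contDiffAt_gaussPart _ _ _ (one_add_relY_pos G hφ hb)).add
    (contDiffAt_gaussPart _ _ _ (one_add_relM_pos G hφ hb))).add (contDiffAt_bernPart _ _ _ _)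

theorem isOpen_variances_pos : IsOpen {φ : Param p | ∀ j, 0 < variances φ j} := by
  simp only [Set.ofPred_forall]
  refine isOpen_iInter_of_finite fun j => isOpen_lt continuous_const ?_
  unfold variances
  fun_prop

/-- The likelihood ratio formula needs positive variances, which is an open condition, so it holds
near `φ + b` and may be differentiated. -/
theorem logLik_eventuallyEq (G : SimpleGraph (Fin N)) {φ b : Param p}
    (hφ : ∀ j, 0 < variances φ j) (hb : ∀ j, 0 < variances (φ + b) j) (ω : Red p N) :
    logLik G (redData G φ ω) =ᶠ[𝓝 (φ + b)]
      fun φ' => logLik G (redData G φ ω) φ + redLR G φ ω (φ' - φ) := by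
  filter_upwards [isOpen_variances_pos.mem_nhds hb] with φ' hφ'
  have h := logLik_sub G hφ (b := φ' - φ) (by simpa using hφ') ω
  rw [add_sub_cancel] at h
  linarith

theorem contDiffAt_logLik (G : SimpleGraph (Fin N)) {φ b : Param p}
    (hφ : ∀ j, 0 < variances φ j) (hb : ∀ j, 0 < variances (φ + b) j) (ω : Red p N) :
    ContDiffAt ℝ 2 (logLik G (redData G φ ω)) (φ + b) := by
  refine ContDiffAt.congr_of_eventuallyEq ?_ (logLik_eventuallyEq G hφ hb ω)
  have h : ContDiffAt ℝ 2 (redLR G φ ω) (φ + b - φ) := by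
    simpa using contDiffAt_redLR G hφ hb ω
  exact contDiffAt_const.add
    (h.comp (f := fun φ' => φ' - φ) (φ + b) (contDiffAt_id.sub contDiffAt_const))

theorem eventually_one_add_mul_ne_zero (y : Fin N → ℝ) :
    ∀ᶠ r in 𝓝 (0 : ℝ), ∀ i, 1 + r * y i ≠ 0 := by
  rw [eventually_all]
  intro i
  have : ContinuousAt (fun r : ℝ => 1 + r * y i) 0 := by fun_prop
  exact this.eventually_ne (by norm_num)

/-- The derivative `ψ` along a line is explicit near `0`; its value at `0` is the score and its
slope there is minus the observed information. -/
theorem hasDerivAt_redLR (G : SimpleGraph (Fin N)) (φ : Param p) (ω : Red p N) (c : Param p) :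
    ∃ ψ : ℝ → ℝ, (∀ᶠ r in 𝓝 (0 : ℝ), HasDerivAt (fun r : ℝ => redLR G φ ω (r • c)) (ψ r) r) ∧
      ψ 0 = redScore G φ ω c ∧
      HasDerivAt ψ (-(gaussInfo ω.2 (regY G φ ω.1 c) (relY G φ c) +
        gaussInfo ω.1.2 (regM G φ ω.1.1 c) (relM G φ c) +
        bernInfo (linA ω.1.1.1 φ) (linA ω.1.1.1 c))) 0 := by
  refine ⟨fun r => (-(1 / 2) * ∑ i, (relY G φ c i / (1 + r * relY G φ c i) +
      (-2 * regY G φ ω.1 c i * (ω.2 i - r * regY G φ ω.1 c i) * (1 + r * relY G φ c i) -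
        (ω.2 i - r * regY G φ ω.1 c i) ^ 2 * relY G φ c i) / (1 + r * relY G φ c i) ^ 2)) +
      (-(1 / 2) * ∑ i, (relM G φ c i / (1 + r * relM G φ c i) +
      (-2 * regM G φ ω.1.1 c i * (ω.1.2 i - r * regM G φ ω.1.1 c i) * (1 + r * relM G φ c i) -
        (ω.1.2 i - r * regM G φ ω.1.1 c i) ^ 2 * relM G φ c i) / (1 + r * relM G φ c i) ^ 2)) +
      ∑ i, (expo φ ω.1.1 i - sig (linA ω.1.1.1 φ i + (0 : Fin N → ℝ) i +
        r * linA ω.1.1.1 c i)) * linA ω.1.1.1 c i, ?_, ?_, ?_⟩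
  · filter_upwards [eventually_one_add_mul_ne_zero (relY G φ c),
      eventually_one_add_mul_ne_zero (relM G φ c)] with r h1 h2
    have := ((hasDerivAt_gaussPart ω.2 (regY G φ ω.1 c) _ h1).add
      (hasDerivAt_gaussPart ω.1.2 (regM G φ ω.1.1 c) _ h2)).add
      (hasDerivAt_bernPart (expo φ ω.1.1) (linA ω.1.1.1 φ) 0 (linA ω.1.1.1 c) r)
    refine this.congr_of_eventuallyEq (Eventually.of_forall fun s => ?_)
    simp [redLR, map_smul]
  · simp only [gaussScore_eq]
    simp [redScore, bernScore]
  · have := ((hasDerivAt_gaussScore ω.2 (regY G φ ω.1 c) (relY G φ c)).add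
      (hasDerivAt_gaussScore ω.1.2 (regM G φ ω.1.1 c) (relM G φ c))).add
      (hasDerivAt_bernScore (expo φ ω.1.1) (linA ω.1.1.1 φ) 0 (linA ω.1.1.1 c) 0)
    refine this.congr_deriv ?_
    simp only [bernInfo, Pi.zero_apply, add_zero, zero_mul]
    ring

theorem hasDerivAt_logLik_line (G : SimpleGraph (Fin N)) {φ : Param p}
    (hφ : ∀ j, 0 < variances φ j) (ω : Red p N) (c : Param p) :
    ∃ ψ : ℝ → ℝ, (∀ᶠ r in 𝓝 (0 : ℝ),
      HasDerivAt (fun r : ℝ => logLik G (redData G φ ω) (φ + r • c)) (ψ r) r) ∧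
      ψ 0 = redScore G φ ω c ∧
      HasDerivAt ψ (-(gaussInfo ω.2 (regY G φ ω.1 c) (relY G φ c) +
        gaussInfo ω.1.2 (regM G φ ω.1.1 c) (relM G φ c) +
        bernInfo (linA ω.1.1.1 φ) (linA ω.1.1.1 c))) 0 := by
  obtain ⟨ψ, h1, h2, h3⟩ := hasDerivAt_redLR G φ ω c
  refine ⟨ψ, ?_, h2, h3⟩
  have hc : Tendsto (fun s : ℝ => φ + s • c) (𝓝 0) (𝓝 (φ + 0)) := by
    have : ContinuousAt (fun s : ℝ => φ + s • c) 0 := by fun_prop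
    simpa [ContinuousAt] using this
  have h4 := (hc.eventually (logLik_eventuallyEq G hφ (b := 0) (by simpa using hφ) ω)).eventually_nhds
  filter_upwards [h1, h4] with r hr hr'
  refine (hr.const_add (logLik G (redData G φ ω) φ)).congr_of_eventuallyEq ?_
  filter_upwards [hr'] with s hs
  rw [hs]; simp

theorem fderiv_logLik (G : SimpleGraph (Fin N)) {φ : Param p} (hφ : ∀ j, 0 < variances φ j)
    (ω : Red p N) (c : Param p) :
    fderiv ℝ (logLik G (redData G φ ω)) φ c = redScore G φ ω c := by
  obtain ⟨ψ, h1, h2, -⟩ := hasDerivAt_logLik_line G hφ ω c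
  rw [← h2]
  have hd : ContDiffAt ℝ 2 (logLik G (redData G φ ω)) (φ + (0 : ℝ) • c) := by
    rw [zero_smul]
    exact contDiffAt_logLik G hφ (by simpa using hφ) ω
  have h3 := (hd.differentiableAt (by norm_num)).hasFDerivAt.comp_hasDerivAt 0
    (hasDerivAt_line φ c 0)
  have h4 := h3.unique h1.self_of_nhds
  simpa using h4

theorem quad_obsInfo (S : Model p) (N : ℕ) {φ : Param p} (hφ : ∀ j, 0 < variances φ j)
    (ω : Red p N) (c : Param p) :
    c.ofLp ⬝ᵥ (obsInfo S N φ (redData (S.graph N) φ ω) *ᵥ c.ofLp) =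
      gaussInfo ω.2 (regY (S.graph N) φ ω.1 c) (relY (S.graph N) φ c) +
        gaussInfo ω.1.2 (regM (S.graph N) φ ω.1.1 c) (relM (S.graph N) φ c) +
        bernInfo (linA ω.1.1.1 φ) (linA ω.1.1.1 c) := by
  obtain ⟨ψ, h1, -, h3⟩ := hasDerivAt_logLik_line (S.graph N) hφ ω c
  have hd : ContDiffAt ℝ 2 (logLik (S.graph N) (redData (S.graph N) φ ω)) φ := by
    simpa using contDiffAt_logLik (S.graph N) hφ (b := 0) (by simpa using hφ) ω
  have h := quad_hessian_eq hd c h1 h3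
  rw [obsInfo, Matrix.neg_mulVec, dotProduct_neg, h, neg_neg]

/-- Moving along `keepAlpha c` leaves both Gaussian parts constant, so even away from the generating
parameter only the logistic curvature at the shifted predictor remains. -/
theorem quad_obsInfo_alpha (S : Model p) (N : ℕ) {φ b : Param p} (hφ : ∀ j, 0 < variances φ j)
    (hb : ∀ j, 0 < variances (φ + b) j) (ω : Red p N) (c : Param p) :
    (keepAlpha c).ofLp ⬝ᵥ (obsInfo S N (φ + b) (redData (S.graph N) φ ω) *ᵥ (keepAlpha c).ofLp) =
      bernInfo (linA ω.1.1.1 φ + linA ω.1.1.1 b) (linA ω.1.1.1 c) := by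
  set G := S.graph N
  have hd := contDiffAt_logLik G hφ hb ω
  have hcc : linA ω.1.1.1 (keepAlpha c) = linA ω.1.1.1 c := linA_congr _ rfl
  set f0 := logLik G (redData G φ ω) φ + gaussPart ω.2 (regY G φ ω.1 b) (relY G φ b) +
    gaussPart ω.1.2 (regM G φ ω.1.1 b) (relM G φ b)
  have hc : Tendsto (fun s : ℝ => φ + b + s • keepAlpha c) (𝓝 0) (𝓝 (φ + b)) := by
    have : ContinuousAt (fun s : ℝ => φ + b + s • keepAlpha c) 0 := by fun_prop
    simpa [ContinuousAt] using this
  have h4 := (hc.eventually (logLik_eventuallyEq G hφ hb ω)).eventually_nhds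
  have h1 : ∀ᶠ r in 𝓝 (0 : ℝ), HasDerivAt
      (fun r : ℝ => logLik G (redData G φ ω) (φ + b + r • keepAlpha c))
      (∑ i, (expo φ ω.1.1 i - sig (linA ω.1.1.1 φ i + linA ω.1.1.1 b i + r * linA ω.1.1.1 c i)) *
        linA ω.1.1.1 c i) r := by
    filter_upwards [h4] with r hr
    refine ((hasDerivAt_bernPart (expo φ ω.1.1) (linA ω.1.1.1 φ) (linA ω.1.1.1 b)
      (linA ω.1.1.1 c) r).const_add f0).congr_of_eventuallyEq ?_
    filter_upwards [hr] with s hs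
    rw [hs]
    have : φ + b + s • keepAlpha c - φ = b + s • keepAlpha c := by abel
    rw [this, redLR, map_add, map_add, map_add, map_add, map_add, map_smul, map_smul, map_smul,
      map_smul, map_smul, hcc, regY_eq_zero G φ ω.1 (b := keepAlpha c) rfl,
      relY_eq_zero G φ (b := keepAlpha c) rfl, regM_eq_zero G φ ω.1.1 (b := keepAlpha c) rfl,
      relM_eq_zero G φ (b := keepAlpha c) rfl]
    simp only [smul_zero, add_zero, f0]
    ring
  have h := quad_hessian_eq hd (keepAlpha c) h1 (hasDerivAt_bernScore _ _ _ _ 0)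
  rw [obsInfo, Matrix.neg_mulVec, dotProduct_neg, h, neg_neg]
  simp [bernInfo]

end

section

variable {p N : ℕ}

/-! ## Moments of the noise -/

/-- Independent centred summands: the second moment is the variance, and variances add. -/
theorem integral_sq_sum_pi {ι : Type*} [Fintype ι] {Ω : ι → Type*} {mΩ : ∀ i, MeasurableSpace (Ω i)}
    {μ : (i : ι) → Measure (Ω i)} [∀ i, IsProbabilityMeasure (μ i)] {f : Π i, Ω i → ℝ}
    (hf : ∀ i, MemLp (f i) 2 (μ i)) (h0 : ∀ i, ∫ x, f i x ∂(μ i) = 0) :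
    MemLp (fun ω : Π i, Ω i => ∑ i, f i (ω i)) 2 (Measure.pi μ) ∧
      ∫ ω, (∑ i, f i (ω i)) ^ 2 ∂(Measure.pi μ) = ∑ i, ∫ x, f i x ^ 2 ∂(μ i) := by
  have hm : ∀ i, MemLp (fun ω : Π i, Ω i => f i (ω i)) 2 (Measure.pi μ) := fun i =>
    (hf i).comp_measurePreserving (measurePreserving_eval μ i)
  have hsum : MemLp (fun ω : Π i, Ω i => ∑ i, f i (ω i)) 2 (Measure.pi μ) :=
    memLp_finsetSum Finset.univ fun i _ => hm i
  refine ⟨hsum, ?_⟩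
  have he : ∀ i, ∫ ω : Π i, Ω i, f i (ω i) ∂(Measure.pi μ) = 0 := fun i => by
    rw [← h0 i, ← (measurePreserving_eval μ i).map_eq, integral_map
      (measurable_pi_apply i).aemeasurable]
    rw [(measurePreserving_eval μ i).map_eq]
    exact (hf i).aestronglyMeasurable
  have hmean : ∫ ω : Π i, Ω i, ∑ i, f i (ω i) ∂(Measure.pi μ) = 0 := by
    rw [integral_finsetSum _ fun i _ => (hm i).integrable (by norm_num)]
    exact Finset.sum_eq_zero fun i _ => he i
  have hv := variance_sum_pi hf
  have hfun : (∑ i, fun ω : Π i, Ω i => f i (ω i)) = fun ω => ∑ i, f i (ω i) := by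
    funext ω; simp
  rw [hfun, variance_of_integral_eq_zero hsum.aestronglyMeasurable.aemeasurable hmean] at hv
  rw [hv]
  exact Finset.sum_congr rfl fun i _ =>
    variance_of_integral_eq_zero (hf i).aestronglyMeasurable.aemeasurable (h0 i)

theorem lintegral_sq_sum_pi {ι : Type*} [Fintype ι] {Ω : ι → Type*}
    {mΩ : ∀ i, MeasurableSpace (Ω i)}
    {μ : (i : ι) → Measure (Ω i)} [∀ i, IsProbabilityMeasure (μ i)] {f : Π i, Ω i → ℝ}
    (hf : ∀ i, MemLp (f i) 2 (μ i)) (h0 : ∀ i, ∫ x, f i x ∂(μ i) = 0) :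
    ∫⁻ ω, ENNReal.ofReal ((∑ i, f i (ω i)) ^ 2) ∂(Measure.pi μ) =
      ENNReal.ofReal (∑ i, ∫ x, f i x ^ 2 ∂(μ i)) := by
  obtain ⟨h1, h2⟩ := integral_sq_sum_pi hf h0
  rw [← h2, ofReal_integral_eq_lintegral_ofReal h1.integrable_sq
    (ae_of_all _ fun _ => sq_nonneg _)]

theorem memLp_polynomial_gaussianReal (n : ℕ) :
    MemLp (fun x : ℝ => x ^ n) 2 (gaussianReal 0 1) := by
  have h : MemLp (id : ℝ → ℝ) ((2 * n : ℕ) : ENNReal) (gaussianReal 0 1) :=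
    memLp_id_gaussianReal' _ (ENNReal.natCast_ne_top _)
  rw [memLp_two_iff_integrable_sq (by fun_prop)]
  by_cases hn : n = 0
  · subst hn; simp
  have h2 := h.integrable_norm_pow (by omega)
  refine h2.congr (ae_of_all _ fun x => ?_)
  simp only [id, Real.norm_eq_abs]
  rw [pow_mul, sq_abs, ← pow_mul, ← pow_mul, mul_comm]

theorem integral_sq_gaussianReal : ∫ x : ℝ, x ^ 2 ∂(gaussianReal 0 1) = 1 := by
  have h := variance_of_integral_eq_zero (X := fun x : ℝ => x) (μ := gaussianReal 0 1)
    (by fun_prop) integral_id_gaussianReal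
  rw [variance_fun_id_gaussianReal] at h
  simpa using h.symm

theorem integrable_pow_gaussianReal (n : ℕ) :
    Integrable (fun x : ℝ => x ^ n) (gaussianReal 0 1) :=
  (memLp_polynomial_gaussianReal n).integrable (by norm_num)

/-- A constant bounding the second moment of the Gaussian score. -/
def scoreConst : ℝ := 2 + ∫ x : ℝ, (x ^ 2 - 1) ^ 2 ∂(gaussianReal 0 1)

theorem scoreConst_ge : 2 ≤ scoreConst := by
  have : 0 ≤ ∫ x : ℝ, (x ^ 2 - 1) ^ 2 ∂(gaussianReal 0 1) :=
    integral_nonneg fun x => sq_nonneg _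
  unfold scoreConst; linarith

theorem memLp_gaussScore_summand (a b : ℝ) :
    MemLp (fun x : ℝ => a * x + 1 / 2 * b * (x ^ 2 - 1)) 2 (gaussianReal 0 1) := by
  have h1 := (memLp_polynomial_gaussianReal 1).const_mul a
  have h2 := ((memLp_polynomial_gaussianReal 2).sub (memLp_const 1)).const_mul (1 / 2 * b)
  simp only [pow_one] at h1
  exact h1.add h2

theorem integral_gaussScore_summand (a b : ℝ) :
    ∫ x : ℝ, (a * x + 1 / 2 * b * (x ^ 2 - 1)) ∂(gaussianReal 0 1) = 0 := by
  have h1 := integrable_pow_gaussianReal 1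
  have h2 := integrable_pow_gaussianReal 2
  simp only [pow_one] at h1
  have h3 : Integrable (fun x : ℝ => x ^ 2 - 1) (gaussianReal 0 1) := h2.sub (integrable_const 1)
  rw [integral_add (h1.const_mul a) (h3.const_mul _),
    integral_const_mul, integral_const_mul, integral_sub h2 (integrable_const 1),
    integral_sq_gaussianReal]
  simp

theorem integral_sq_gaussScore_summand_le (a b : ℝ) :
    ∫ x : ℝ, (a * x + 1 / 2 * b * (x ^ 2 - 1)) ^ 2 ∂(gaussianReal 0 1) ≤
      scoreConst * (a ^ 2 + 1 / 2 * b ^ 2) := by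
  have hi : Integrable (fun x : ℝ => (x ^ 2 - 1) ^ 2) (gaussianReal 0 1) :=
    ((memLp_polynomial_gaussianReal 2).sub (memLp_const 1)).integrable_sq
  have h2 := integrable_pow_gaussianReal 2
  have h : ∫ x : ℝ, (a * x + 1 / 2 * b * (x ^ 2 - 1)) ^ 2 ∂(gaussianReal 0 1) ≤
      ∫ x : ℝ, (2 * a ^ 2 * x ^ 2 + 1 / 2 * b ^ 2 * (x ^ 2 - 1) ^ 2) ∂(gaussianReal 0 1) := by
    refine integral_mono (memLp_gaussScore_summand a b).integrable_sq
      ((h2.const_mul _).add (hi.const_mul _)) fun x => ?_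
    -- This is `(u + v)² ≤ 2u² + 2v²`. The constant is not sharp, but only boundedness of the second
    -- moment is used.
    have := sq_nonneg (a * x - 1 / 2 * b * (x ^ 2 - 1))
    simp only
    nlinarith
  refine h.trans ?_
  rw [integral_add (h2.const_mul _) (hi.const_mul _), integral_const_mul, integral_const_mul,
    integral_sq_gaussianReal]
  have h0 : 0 ≤ ∫ x : ℝ, (x ^ 2 - 1) ^ 2 ∂(gaussianReal 0 1) :=
    integral_nonneg fun x => sq_nonneg _
  unfold scoreConst
  have h3 := mul_nonneg h0 (sq_nonneg a)
  have h4 := sq_nonneg b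
  nlinarith

theorem toNNReal_one_gaussian : iidGaussian N 1 = Measure.pi fun _ => gaussianReal 0 1 := by
  rw [iidGaussian, Real.toNNReal_one]

theorem lintegral_sq_gaussScore_le (X y : Fin N → ℝ) :
    ∫⁻ w, ENNReal.ofReal (gaussScore w X y ^ 2) ∂(iidGaussian N 1) ≤
      ENNReal.ofReal (scoreConst * ∑ i, (X i ^ 2 + 1 / 2 * y i ^ 2)) := by
  rw [toNNReal_one_gaussian]
  have h := lintegral_sq_sum_pi (μ := fun _ : Fin N => gaussianReal 0 1)
    (f := fun i x => X i * x + 1 / 2 * y i * (x ^ 2 - 1))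
    (fun i => memLp_gaussScore_summand _ _) (fun i => integral_gaussScore_summand _ _)
  refine h.trans_le (ENNReal.ofReal_le_ofReal ?_)
  rw [Finset.mul_sum]
  exact Finset.sum_le_sum fun i _ => integral_sq_gaussScore_summand_le _ _

/-- Expectation of a function of a Bernoulli variable generated from a uniform variable. -/
theorem integral_bernoulli {q : ℝ} (h0 : 0 ≤ q) (h1 : q ≤ 1) (F : ℝ → ℝ) :
    Integrable (fun u : unitInterval => F (if (u : ℝ) ≤ q then 1 else 0)) ∧
    ∫ u : unitInterval, F (if (u : ℝ) ≤ q then 1 else 0) = q * F 1 + (1 - q) * F 0 := by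
  set s : Set unitInterval := Set.Iic ⟨q, h0, h1⟩ with hs
  have hms : MeasurableSet s := measurableSet_Iic
  have hF : (fun u : unitInterval => F (if (u : ℝ) ≤ q then 1 else 0)) =
      fun u => s.indicator (fun _ => F 1) u + sᶜ.indicator (fun _ => F 0) u := by
    funext u
    by_cases hu : (u : ℝ) ≤ q
    · have : u ∈ s := hu
      simp [hu, this]
    · have : u ∉ s := hu
      simp [hu, this]
  have i1 : Integrable (s.indicator fun _ : unitInterval => F 1) :=
    (integrable_const _).indicator hms
  have i2 : Integrable (sᶜ.indicator fun _ : unitInterval => F 0) :=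
    (integrable_const _).indicator hms.compl
  have hv : (volume : Measure unitInterval).real s = q := by
    rw [Measure.real, hs, unitInterval.volume_Iic, ENNReal.toReal_ofReal h0]
  rw [hF]
  refine ⟨i1.add i2, ?_⟩
  rw [integral_add i1 i2, integral_indicator_const _ hms, integral_indicator_const _ hms.compl,
    probReal_compl_eq_one_sub hms, hv]
  simp

theorem lintegral_sq_bernScore (φ c : Param p) (C : Cov p N) :
    ∫⁻ U, ENNReal.ofReal (bernScore (expo φ (C, U)) (linA C φ) (linA C c) ^ 2)
      ∂(Measure.pi fun _ => (volume : Measure unitInterval)) =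
      ENNReal.ofReal (bernInfo (linA C φ) (linA C c)) := by
  have hF : ∀ i (F : ℝ → ℝ), _ := fun i F =>
    integral_bernoulli (sig_pos (linA C φ i)).le (sig_lt_one (linA C φ i)).le F
  have h := lintegral_sq_sum_pi (μ := fun _ : Fin N => (volume : Measure unitInterval))
    (f := fun i u => ((if (u : ℝ) ≤ sig (linA C φ i) then 1 else 0) - sig (linA C φ i)) *
      linA C c i) (fun i => ?_) (fun i => ?_)
  -- The threshold in `expo` is `propensity`, which unfolds to `sig` of the linear predictor, so the
  -- summands agree by definition.
  · refine h.trans ?_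
    rw [bernInfo]
    congr 1
    refine Finset.sum_congr rfl fun i _ => ?_
    rw [(hF i fun a => ((a - sig (linA C φ i)) * linA C c i) ^ 2).2, bernVar]
    ring
  · have hm : Measurable fun u : unitInterval =>
        ((if (u : ℝ) ≤ sig (linA C φ i) then (1 : ℝ) else 0) - sig (linA C φ i)) * linA C c i :=
      ((Measurable.ite (measurableSet_le (by fun_prop) measurable_const) measurable_const
        measurable_const).sub_const _).mul_const _
    rw [memLp_two_iff_integrable_sq hm.aestronglyMeasurable]
    exact (hF i fun a => ((a - sig (linA C φ i)) * linA C c i) ^ 2).1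
  · rw [(hF i fun a => (a - sig (linA C φ i)) * linA C c i).2]
    ring

end

section

variable {p N : ℕ}

/-! ## The Fisher information in standardised coordinates -/

/-- The joint law of confounders and exposure noise. -/
def baseLaw (μC : Measure (Cov p N)) : Measure (Cov p N × (Fin N → unitInterval)) :=
  μC.prod (Measure.pi fun _ => (volume : Measure unitInterval))

/-- The joint law of confounders, exposure noise and mediator noise. -/
def medLaw (μC : Measure (Cov p N)) :
    Measure ((Cov p N × (Fin N → unitInterval)) × (Fin N → ℝ)) :=
  (baseLaw μC).prod (iidGaussian N 1)

instance (μC : Measure (Cov p N)) [IsProbabilityMeasure μC] :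
    IsProbabilityMeasure (baseLaw μC) := by
  unfold baseLaw; infer_instance

instance (μC : Measure (Cov p N)) [IsProbabilityMeasure μC] :
    IsProbabilityMeasure (medLaw μC) := by
  unfold medLaw; infer_instance

/-- Expected information about the outcome coefficients. -/
def expY (G : SimpleGraph (Fin N)) (μC : Measure (Cov p N)) (φ c : Param p) : ℝ :=
  ∫ x, ∑ i, regY G φ x c i ^ 2 ∂(medLaw μC)

/-- Expected information about the mediator coefficients. -/
def expM (G : SimpleGraph (Fin N)) (μC : Measure (Cov p N)) (φ c : Param p) : ℝ :=
  ∫ x, ∑ i, regM G φ x c i ^ 2 ∂(baseLaw μC)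

/-- Expected information about the exposure coefficients. -/
def expA (μC : Measure (Cov p N)) (φ c : Param p) : ℝ :=
  ∫ C, bernInfo (linA C φ) (linA C c) ∂μC

theorem integral_comp_fst {α β : Type*} [MeasurableSpace α] [MeasurableSpace β] (μ : Measure α)
    (ν : Measure β) [IsProbabilityMeasure ν] [SFinite μ] (f : α → ℝ) :
    ∫ z, f z.1 ∂(μ.prod ν) = ∫ x, f x ∂μ := by
  rw [integral_fun_fst]; simp

theorem integrable_of_comp_fst {α β : Type*} [MeasurableSpace α] [MeasurableSpace β]
    {μ : Measure α} {ν : Measure β} [IsProbabilityMeasure ν] [SFinite μ] {f : α → ℝ}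
    (hf : Measurable f) (h : Integrable (fun z : α × β => f z.1) (μ.prod ν)) : Integrable f μ :=
  (measurePreserving_fst.integrable_comp hf.aestronglyMeasurable).1 h

theorem integral_iidGaussian_eval (i : Fin N) {f : ℝ → ℝ} (hf : Measurable f)
    (hi : Integrable f (gaussianReal 0 1)) :
    Integrable (fun w : Fin N → ℝ => f (w i)) (iidGaussian N 1) ∧
      ∫ w, f (w i) ∂(iidGaussian N 1) = ∫ x, f x ∂(gaussianReal 0 1) := by
  have h := measurePreserving_eval (fun _ : Fin N => gaussianReal 0 1) i
  rw [← toNNReal_one_gaussian] at h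
  refine ⟨(h.integrable_comp hf.aestronglyMeasurable).2 hi, ?_⟩
  rw [← h.map_eq, integral_map h.measurable.aemeasurable hf.aestronglyMeasurable]

/-- The cross term vanishes because `w i` is centred and independent of `X`, and `w i ^ 2 - 1/2` has
mean `1/2`. -/
theorem integral_gaussInfo {α : Type*} [MeasurableSpace α] {μ : Measure α}
    [IsProbabilityMeasure μ] {X : α → Fin N → ℝ} (hX : Measurable X)
    (hi : Integrable (fun x => ∑ i, X x i ^ 2) μ) (y : Fin N → ℝ) :
    Integrable (fun z : α × (Fin N → ℝ) => gaussInfo z.2 (X z.1) y) (μ.prod (iidGaussian N 1)) ∧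
    ∫ z, gaussInfo z.2 (X z.1) y ∂(μ.prod (iidGaussian N 1)) =
      ∫ x, ∑ i, X x i ^ 2 ∂μ + 1 / 2 * ∑ i, y i ^ 2 := by
  have hXi : ∀ i, Measurable fun x => X x i := fun i => (measurable_pi_apply i).comp hX
  have hsq : ∀ i, Integrable (fun x => X x i ^ 2) μ := fun i => by
    refine hi.mono' ((hXi i).pow_const 2).aestronglyMeasurable (ae_of_all _ fun x => ?_)
    rw [Real.norm_eq_abs, abs_of_nonneg (sq_nonneg _)]
    exact Finset.single_le_sum (f := fun i => X x i ^ 2) (fun j _ => sq_nonneg _)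
      (Finset.mem_univ i)
  have h1 : ∀ i, Integrable (fun x => X x i) μ := fun i =>
    ((memLp_two_iff_integrable_sq (hXi i).aestronglyMeasurable).2 (hsq i)).integrable (by norm_num)
  have g1 := fun i : Fin N => integral_iidGaussian_eval i (f := fun x => x) measurable_id
    (by simpa using integrable_pow_gaussianReal 1)
  have g2 := fun i : Fin N => integral_iidGaussian_eval i (f := fun x => x ^ 2) (by fun_prop)
    (integrable_pow_gaussianReal 2)
  set ν := iidGaussian N 1
  have e1 : ∀ i, Integrable (fun z : α × (Fin N → ℝ) => X z.1 i ^ 2) (μ.prod ν) := fun i =>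
    (hsq i).comp_fst ν
  have e2 : ∀ i, Integrable (fun z : α × (Fin N → ℝ) => (2 * y i) * (X z.1 i * z.2 i))
      (μ.prod ν) := fun i => ((h1 i).mul_prod (g1 i).1).const_mul _
  have e3 : ∀ i, Integrable (fun z : α × (Fin N → ℝ) => y i ^ 2 * z.2 i ^ 2)
      (μ.prod ν) := fun i => ((g2 i).1.comp_snd μ).const_mul _
  have hs : ∀ z : α × (Fin N → ℝ), gaussInfo z.2 (X z.1) y = ∑ i, (X z.1 i ^ 2 +
      (2 * y i) * (X z.1 i * z.2 i) + (y i ^ 2 * z.2 i ^ 2 - 1 / 2 * y i ^ 2)) := fun z =>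
    Finset.sum_congr rfl fun i _ => by ring
  have e4 : ∀ i, Integrable (fun z : α × (Fin N → ℝ) => y i ^ 2 * z.2 i ^ 2 - 1 / 2 * y i ^ 2)
      (μ.prod ν) := fun i => (e3 i).sub (integrable_const _)
  have e5 : ∀ i, Integrable (fun z : α × (Fin N → ℝ) => X z.1 i ^ 2 +
      (2 * y i) * (X z.1 i * z.2 i)) (μ.prod ν) := fun i => (e1 i).add (e2 i)
  have e6 : ∀ i, Integrable (fun z : α × (Fin N → ℝ) => X z.1 i ^ 2 +
      (2 * y i) * (X z.1 i * z.2 i) + (y i ^ 2 * z.2 i ^ 2 - 1 / 2 * y i ^ 2)) (μ.prod ν) :=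
    fun i => (e5 i).add (e4 i)
  simp_rw [hs]
  refine ⟨integrable_finsetSum _ fun i _ => e6 i, ?_⟩
  rw [integral_finsetSum _ fun i _ => e6 i, integral_finsetSum _ fun i _ => hsq i,
    Finset.mul_sum, ← Finset.sum_add_distrib]
  refine Finset.sum_congr rfl fun i _ => ?_
  rw [integral_add (e5 i) (e4 i), integral_add (e1 i) (e2 i),
    integral_sub (e3 i) (integrable_const _), integral_const_mul, integral_const_mul,
    integral_prod_mul (fun x => X x i) (fun w : Fin N → ℝ => w i),
    integral_comp_fst μ ν (fun x => X x i ^ 2), (g1 i).2,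
    integral_fun_snd (μ := μ) (ν := ν) (fun w : Fin N → ℝ => w i ^ 2), (g2 i).2,
    integral_sq_gaussianReal, integral_id_gaussianReal]
  simp
  ring

/-- The observed information is integrable under the law with parameter `φ`. -/
def InfoIntegrable (S : Model p) (N : ℕ) (φ : Param p) : Prop :=
  ∀ k l, Integrable (fun d => obsInfo S N φ d k l) (dataLaw S N φ)

/-- The entrywise integrals defining the Fisher information are transported to `redLaw` and combined
linearly. -/
theorem integral_quad (S : Model p) (N : ℕ) {φ : Param p} (hφ : ∀ j, 0 < variances φ j)
    (hi : InfoIntegrable S N φ) (c : Param p) :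
    Integrable (fun ω => c.ofLp ⬝ᵥ (obsInfo S N φ (redData (S.graph N) φ ω) *ᵥ c.ofLp))
      (redLaw (S.covLaw N)) ∧
    ∫ ω, c.ofLp ⬝ᵥ (obsInfo S N φ (redData (S.graph N) φ ω) *ᵥ c.ofLp) ∂(redLaw (S.covLaw N)) =
      c.ofLp ⬝ᵥ (fisherInfo S N φ *ᵥ c.ofLp) := by
  have hm := measurable_redData (S.graph N) φ
  have hkl : ∀ k l, Integrable (fun ω => obsInfo S N φ (redData (S.graph N) φ ω) k l)
      (redLaw (S.covLaw N)) ∧ ∫ ω, obsInfo S N φ (redData (S.graph N) φ ω) k l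
      ∂(redLaw (S.covLaw N)) = fisherInfo S N φ k l := by
    intro k l
    have h := hi k l
    rw [dataLaw_eq_map S N hφ] at h
    refine ⟨h.comp_measurable hm, ?_⟩
    rw [fisherInfo, Matrix.of_apply, dataLaw_eq_map S N hφ,
      integral_map hm.aemeasurable h.aestronglyMeasurable]
  have h1 : ∀ k l, Integrable (fun ω => c k * (obsInfo S N φ (redData (S.graph N) φ ω) k l * c l))
      (redLaw (S.covLaw N)) := fun k l => ((hkl k l).1.mul_const _).const_mul _
  have he : ∀ H : Matrix (ParamIdx p) (ParamIdx p) ℝ, c.ofLp ⬝ᵥ (H *ᵥ c.ofLp) =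
      ∑ k, ∑ l, c k * (H k l * c l) := fun H => by
    simp only [dotProduct, Matrix.mulVec, Finset.mul_sum]
  simp_rw [he]
  refine ⟨integrable_finsetSum _ fun k _ => integrable_finsetSum _ fun l _ => h1 k l, ?_⟩
  rw [integral_finsetSum _ fun k _ => integrable_finsetSum _ fun l _ => h1 k l]
  refine Finset.sum_congr rfl fun k _ => ?_
  rw [integral_finsetSum _ fun l _ => h1 k l]
  refine Finset.sum_congr rfl fun l _ => ?_
  rw [integral_const_mul, integral_mul_const, (hkl k l).2]

/-- In this direction no relative variance change occurs, and what is left is nonnegative and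
independent of the outcome noise. -/
theorem quad_obsInfo_keepBeta (S : Model p) (N : ℕ) {φ : Param p} (hφ : ∀ j, 0 < variances φ j)
    (ω : Red p N) (c : Param p) :
    (keepBeta c).ofLp ⬝ᵥ (obsInfo S N φ (redData (S.graph N) φ ω) *ᵥ (keepBeta c).ofLp) =
      ∑ i, regY (S.graph N) φ ω.1 c i ^ 2 := by
  rw [quad_obsInfo S N hφ, regM_eq_zero _ φ _ (b := keepBeta c) rfl,
    relY_eq_zero _ φ (b := keepBeta c) rfl, relM_eq_zero _ φ (b := keepBeta c) rfl,
    linA_eq_zero _ (b := keepBeta c) rfl, regY_congr _ φ _ (b := keepBeta c) (c := c) rfl]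
  simp [gaussInfo, bernInfo]

theorem quad_obsInfo_keepGamma (S : Model p) (N : ℕ) {φ : Param p} (hφ : ∀ j, 0 < variances φ j)
    (ω : Red p N) (c : Param p) :
    (keepGamma c).ofLp ⬝ᵥ (obsInfo S N φ (redData (S.graph N) φ ω) *ᵥ (keepGamma c).ofLp) =
      ∑ i, regM (S.graph N) φ ω.1.1 c i ^ 2 := by
  rw [quad_obsInfo S N hφ, regY_eq_zero _ φ _ (b := keepGamma c) rfl,
    relY_eq_zero _ φ (b := keepGamma c) rfl, relM_eq_zero _ φ (b := keepGamma c) rfl,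
    linA_eq_zero _ (b := keepGamma c) rfl, regM_congr _ φ _ (b := keepGamma c) (c := c) rfl]
  simp [gaussInfo, bernInfo]

theorem quad_obsInfo_keepAlpha (S : Model p) (N : ℕ) {φ : Param p} (hφ : ∀ j, 0 < variances φ j)
    (ω : Red p N) (c : Param p) :
    (keepAlpha c).ofLp ⬝ᵥ (obsInfo S N φ (redData (S.graph N) φ ω) *ᵥ (keepAlpha c).ofLp) =
      bernInfo (linA ω.1.1.1 φ) (linA ω.1.1.1 c) := by
  rw [quad_obsInfo S N hφ, regY_eq_zero _ φ _ (b := keepAlpha c) rfl,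
    relY_eq_zero _ φ (b := keepAlpha c) rfl, relM_eq_zero _ φ (b := keepAlpha c) rfl,
    regM_eq_zero _ φ _ (b := keepAlpha c) rfl, linA_congr _ (b := keepAlpha c) (c := c) rfl]
  simp [gaussInfo]

theorem measurable_sum_sq {α : Type*} [MeasurableSpace α] {X : α → Fin N → ℝ}
    (hX : Measurable X) : Measurable fun x => ∑ i, X x i ^ 2 := by
  have hXi : ∀ i, Measurable fun x => X x i := fun i => (measurable_pi_apply i).comp hX
  fun_prop

theorem measurable_sig : Measurable sig := by unfold sig; fun_prop

theorem measurable_bernInfo_linA (φ c : Param p) :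
    Measurable fun C : Cov p N => bernInfo (linA C φ) (linA C c) := by
  have h1 : ∀ i, Measurable fun C : Cov p N => linA C φ i := fun i =>
    (measurable_pi_apply i).comp (measurable_linA φ)
  have h2 : ∀ i, Measurable fun C : Cov p N => linA C c i := fun i =>
    (measurable_pi_apply i).comp (measurable_linA c)
  have h3 : ∀ i, Measurable fun C : Cov p N => sig (linA C φ i) := fun i =>
    measurable_sig.comp (h1 i)
  unfold bernInfo bernVar
  fun_prop

section

variable (S : Model p) (N : ℕ) {φ : Param p} (hφ : ∀ j, 0 < variances φ j)
  (hi : InfoIntegrable S N φ)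

include hφ hi

/-- No moment condition on the confounders is stated; integrability of the squared regressors is
extracted from that of the observed information in a block direction. -/
theorem integrable_sum_regY (c : Param p) :
    Integrable (fun x => ∑ i, regY (S.graph N) φ x c i ^ 2) (medLaw (S.covLaw N)) := by
  have := S.isProb N
  have h := (integral_quad S N hφ hi (keepBeta c)).1
  simp_rw [quad_obsInfo_keepBeta S N hφ] at h
  exact integrable_of_comp_fst (measurable_sum_sq (measurable_regY _ φ c)) h

theorem integrable_sum_regM (c : Param p) :
    Integrable (fun x => ∑ i, regM (S.graph N) φ x c i ^ 2) (baseLaw (S.covLaw N)) := by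
  have := S.isProb N
  have h := (integral_quad S N hφ hi (keepGamma c)).1
  simp_rw [quad_obsInfo_keepGamma S N hφ] at h
  have hm := measurable_sum_sq (measurable_regM (S.graph N) φ c)
  exact integrable_of_comp_fst (ν := iidGaussian N 1) hm
    (integrable_of_comp_fst (μ := medLaw (S.covLaw N)) (ν := iidGaussian N 1)
      (f := fun z => ∑ i, regM (S.graph N) φ z.1 c i ^ 2) (hm.comp measurable_fst) h)

theorem integrable_bernInfo (c : Param p) :
    Integrable (fun C => bernInfo (linA C φ) (linA C c)) (S.covLaw N) := by
  have := S.isProb N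
  have h := (integral_quad S N hφ hi (keepAlpha c)).1
  simp_rw [quad_obsInfo_keepAlpha S N hφ] at h
  have hm := measurable_bernInfo_linA (N := N) φ c
  refine integrable_of_comp_fst (ν := Measure.pi fun _ : Fin N => (volume : Measure unitInterval)) hm
    (integrable_of_comp_fst (μ := baseLaw (S.covLaw N)) (ν := iidGaussian N 1)
      (f := fun z => bernInfo (linA z.1 φ) (linA z.1 c)) (hm.comp measurable_fst)
      (integrable_of_comp_fst (μ := medLaw (S.covLaw N)) (ν := iidGaussian N 1)
      (f := fun z => bernInfo (linA z.1.1 φ) (linA z.1.1 c))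
      (hm.comp (measurable_fst.comp measurable_fst)) h))

/-- The Fisher information as a sum over the blocks of the model. -/
theorem fisher_quad (c : Param p) :
    c.ofLp ⬝ᵥ (fisherInfo S N φ *ᵥ c.ofLp) =
      expY (S.graph N) (S.covLaw N) φ c + 1 / 2 * ∑ i, relY (S.graph N) φ c i ^ 2 +
      (expM (S.graph N) (S.covLaw N) φ c + 1 / 2 * ∑ i, relM (S.graph N) φ c i ^ 2) +
      expA (S.covLaw N) φ c := by
  have := S.isProb N
  set G := S.graph N
  have hY := integral_gaussInfo (measurable_regY G φ c) (integrable_sum_regY S N hφ hi c)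
    (relY G φ c)
  have hM := integral_gaussInfo (measurable_regM G φ c) (integrable_sum_regM S N hφ hi c)
    (relM G φ c)
  have hA := integrable_bernInfo S N hφ hi c
  have hM' : Integrable (fun ω : Red p N => gaussInfo ω.1.2 (regM G φ ω.1.1 c) (relM G φ c))
      (redLaw (S.covLaw N)) := hM.1.comp_fst (iidGaussian N 1)
  have hA' : Integrable (fun ω : Red p N => bernInfo (linA ω.1.1.1 φ) (linA ω.1.1.1 c))
      (redLaw (S.covLaw N)) :=
    ((hA.comp_fst (Measure.pi fun _ : Fin N => (volume : Measure unitInterval))).comp_fst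
      (iidGaussian N 1)).comp_fst (iidGaussian N 1)
  have hY' : Integrable (fun ω : Red p N => gaussInfo ω.2 (regY G φ ω.1 c) (relY G φ c))
      (redLaw (S.covLaw N)) := hY.1
  have hYM : Integrable (fun ω : Red p N => gaussInfo ω.2 (regY G φ ω.1 c) (relY G φ c) +
      gaussInfo ω.1.2 (regM G φ ω.1.1 c) (relM G φ c)) (redLaw (S.covLaw N)) := hY'.add hM'
  rw [← (integral_quad S N hφ hi c).2]
  simp_rw [quad_obsInfo S N hφ]
  rw [integral_add hYM hA', integral_add hY' hM']
  congr 1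
  · congr 1
    · exact hY.2
    · refine Eq.trans ?_ hM.2
      exact integral_comp_fst (medLaw (S.covLaw N)) (iidGaussian N 1)
        (fun z => gaussInfo z.2 (regM G φ z.1 c) (relM G φ c))
  · refine (integral_comp_fst (medLaw (S.covLaw N)) (iidGaussian N 1)
        (fun z => bernInfo (linA z.1.1 φ) (linA z.1.1 c))).trans ?_
    refine (integral_comp_fst (baseLaw (S.covLaw N)) (iidGaussian N 1)
        (fun z => bernInfo (linA z.1 φ) (linA z.1 c))).trans ?_
    exact integral_comp_fst (S.covLaw N) (Measure.pi fun _ => (volume : Measure unitInterval))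
        (fun z => bernInfo (linA z φ) (linA z c))

end

end

section

variable {p N : ℕ}

/-! ## Global upper bounds for the log-likelihood ratio -/

/-- The contributions of the coordinates to the score of a Gaussian block. -/
def scoreTerm (w X y : Fin N → ℝ) : Fin N → ℝ :=
  fun i => X i * w i + 1 / 2 * y i * (w i ^ 2 - 1)

theorem sum_mul_scoreTerm (β w X y : Fin N → ℝ) :
    ∑ i, β i * scoreTerm w X y i = gaussScore w (β * X) (β * y) :=
  Finset.sum_congr rfl fun i _ => by simp only [scoreTerm, Pi.mul_apply]; ring

/-- Apply `log x ≤ x - 1` at `x = √ρ`. The bound is valid for every positive `ρ`, not only near `1`,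
as a global estimate requires. -/
theorem sub_one_sub_log_ge {ρ : ℝ} (hρ : 0 < ρ) : (Real.sqrt ρ - 1) ^ 2 ≤ ρ - 1 - Real.log ρ := by
  have h1 : Real.log ρ = 2 * Real.log (Real.sqrt ρ) := by
    rw [Real.log_sqrt hρ.le]; ring
  have h2 := Real.log_le_sub_one_of_pos (Real.sqrt_pos.2 hρ)
  have h3 := Real.sq_sqrt hρ.le
  nlinarith

/-- With `ρ = 1/(1+y)` and `ρy = 1 - ρ`, the summand equals `-(ρ - 1 - log ρ)/2 - ρX²/2` plus `ρ`
times the score term. The first two terms are deterministic given `X` and are bounded by a negative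
quadratic; the last is kept exactly. -/
theorem gauss_summand_le {κ w X y : ℝ} (hκ : 0 < κ) (hκ1 : κ ≤ 1) (h1 : κ ≤ 1 + y)
    (h2 : 1 + y ≤ κ⁻¹) :
    -(1 / 2) * (Real.log (1 + y) + (w - X) ^ 2 / (1 + y) - w ^ 2) ≤
      -(κ ^ 3 / 4) * (X ^ 2 + 1 / 2 * y ^ 2) +
        (1 + y)⁻¹ * (X * w + 1 / 2 * y * (w ^ 2 - 1)) := by
  have hy : 0 < 1 + y := hκ.trans_le h1
  set ρ := (1 + y)⁻¹ with hρ
  have hρ0 : 0 < ρ := inv_pos.2 hy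
  have hρ1 : κ ≤ ρ := by
    rw [hρ, le_inv_comm₀ hκ hy]; exact h2
  have hρ2 : ρ ≤ κ⁻¹ := by
    rw [hρ]; exact inv_anti₀ hκ h1
  have hyρ : ρ * y = 1 - ρ := by
    rw [hρ]; field_simp; ring
  have hlog : Real.log (1 + y) = -Real.log ρ := by rw [hρ, Real.log_inv, neg_neg]
  have hs := sub_one_sub_log_ge hρ0
  set σ := Real.sqrt ρ with hσ
  have hσ0 : 0 < σ := Real.sqrt_pos.2 hρ0
  have hσ2 : σ ^ 2 = ρ := Real.sq_sqrt hρ0.le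
  -- Origin of `κ³/4`: `(ρy)² = (1 - ρ)² = (σ - 1)²(σ + 1)²` with `(σ + 1)² ≤ 2(ρ + 1) ≤ 4/κ`, and
  -- `ρ ≥ κ`.
  have hlow : κ ^ 3 / 4 * y ^ 2 ≤ (σ - 1) ^ 2 := by
    have e1 : (ρ * y) ^ 2 = (σ - 1) ^ 2 * (σ + 1) ^ 2 := by rw [hyρ, ← hσ2]; ring
    have e2 : (σ + 1) ^ 2 ≤ 4 * κ⁻¹ := by
      have : 1 ≤ κ⁻¹ := (one_le_inv₀ hκ).2 hκ1
      nlinarith [sq_nonneg (σ - 1)]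
    have e3 : κ ^ 2 * y ^ 2 ≤ (ρ * y) ^ 2 := by
      rw [mul_pow]
      exact mul_le_mul_of_nonneg_right (pow_le_pow_left₀ hκ.le hρ1 2) (sq_nonneg y)
    have e4 : κ ^ 2 * y ^ 2 ≤ (σ - 1) ^ 2 * (4 * κ⁻¹) :=
      (e3.trans e1.le).trans (mul_le_mul_of_nonneg_left e2 (sq_nonneg _))
    calc κ ^ 3 / 4 * y ^ 2 = κ / 4 * (κ ^ 2 * y ^ 2) := by ring
      _ ≤ κ / 4 * ((σ - 1) ^ 2 * (4 * κ⁻¹)) := mul_le_mul_of_nonneg_left e4 (by positivity)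
      _ = (σ - 1) ^ 2 := by field_simp
  have hX : κ ^ 3 / 4 * X ^ 2 ≤ 1 / 2 * (ρ * X ^ 2) := by
    have : κ ^ 3 / 4 ≤ 1 / 2 * ρ := by
      have : κ ^ 3 ≤ κ := by
        calc κ ^ 3 ≤ κ ^ 1 := pow_le_pow_of_le_one hκ.le hκ1 (by norm_num)
          _ = κ := pow_one κ
      linarith
    nlinarith [sq_nonneg X]
  have hdiv : (w - X) ^ 2 / (1 + y) = (w - X) ^ 2 * ρ := div_eq_mul_inv _ _
  rw [hlog, hdiv]
  have key : -(1 / 2) * (-Real.log ρ + (w - X) ^ 2 * ρ - w ^ 2) =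
      -(1 / 2) * (ρ - 1 - Real.log ρ) + 1 / 2 * ((1 - ρ) * (w ^ 2 - 1)) + ρ * (X * w) -
        1 / 2 * (ρ * X ^ 2) := by ring
  rw [key, ← hyρ]
  nlinarith

theorem gaussPart_le {κ : ℝ} (hκ : 0 < κ) (hκ1 : κ ≤ 1) (w X y : Fin N → ℝ)
    (h1 : ∀ i, κ ≤ 1 + y i) (h2 : ∀ i, 1 + y i ≤ κ⁻¹) :
    gaussPart w X y ≤ -(κ ^ 3 / 4) * (∑ i, X i ^ 2 + 1 / 2 * ∑ i, y i ^ 2) +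
      ∑ i, (1 + y i)⁻¹ * scoreTerm w X y i := by
  rw [gaussPart, Finset.mul_sum, Finset.mul_sum, ← Finset.sum_add_distrib, Finset.mul_sum,
    ← Finset.sum_add_distrib]
  exact Finset.sum_le_sum fun i _ => gauss_summand_le hκ hκ1 (h1 i) (h2 i)

/-- A bound for all weighted sums of `ξ` with weights `1 / (a pᵢ + b (1 - pᵢ))`. -/
def supStat (q : ℝ) (P ξ : Fin N → ℝ) : ℝ :=
  ∑' k : ℕ, q ^ k * (|∑ i, P i ^ k * ξ i| + |∑ i, (1 - P i) ^ k * ξ i|)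

theorem abs_sum_pow_mul_le {P : Fin N → ℝ} (h0 : ∀ i, 0 ≤ P i) (h1 : ∀ i, P i ≤ 1)
    (ξ : Fin N → ℝ) (k : ℕ) : |∑ i, P i ^ k * ξ i| ≤ ∑ i, |ξ i| := by
  refine (Finset.abs_sum_le_sum_abs _ _).trans (Finset.sum_le_sum fun i _ => ?_)
  rw [abs_mul, abs_of_nonneg (pow_nonneg (h0 i) k)]
  exact mul_le_of_le_one_left (abs_nonneg _) (pow_le_one₀ (h0 i) (h1 i))

theorem summable_supStat {q : ℝ} (hq0 : 0 ≤ q) (hq1 : q < 1) {P : Fin N → ℝ}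
    (h0 : ∀ i, 0 ≤ P i) (h1 : ∀ i, P i ≤ 1) (ξ : Fin N → ℝ) :
    Summable fun k : ℕ => q ^ k * (|∑ i, P i ^ k * ξ i| + |∑ i, (1 - P i) ^ k * ξ i|) := by
  refine Summable.of_nonneg_of_le (fun k => by positivity) (fun k => ?_)
    ((summable_geometric_of_lt_one hq0 hq1).mul_right (∑ i, |ξ i| + ∑ i, |ξ i|))
  exact mul_le_mul_of_nonneg_left (add_le_add (abs_sum_pow_mul_le h0 h1 ξ k)
    (abs_sum_pow_mul_le (P := fun i => 1 - P i) (fun i => sub_nonneg.2 (h1 i))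
      (fun i => sub_le_self _ (h0 i)) ξ k)) (pow_nonneg hq0 k)

/-- Expand `1/(1 - uP_i)` as a geometric series in `u`, interchange it with the finite sum, and
replace `u` by its largest value `q`, so that the bound is free of `u`. -/
theorem abs_sum_geometric_le {u q : ℝ} (hu : 0 ≤ u) (huq : u ≤ q) (hq1 : q < 1) {P : Fin N → ℝ}
    (h0 : ∀ i, 0 ≤ P i) (h1 : ∀ i, P i ≤ 1) (ξ : Fin N → ℝ) :
    |∑ i, (1 - u * P i)⁻¹ * ξ i| ≤ ∑' k : ℕ, q ^ k * |∑ i, P i ^ k * ξ i| := by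
  have hlt : ∀ i, u * P i < 1 := fun i =>
    ((mul_le_of_le_one_right hu (h1 i)).trans huq).trans_lt hq1
  have hs : HasSum (fun k : ℕ => u ^ k * ∑ i, P i ^ k * ξ i) (∑ i, (1 - u * P i)⁻¹ * ξ i) := by
    have : ∀ i, HasSum (fun k : ℕ => u ^ k * (P i ^ k * ξ i)) ((1 - u * P i)⁻¹ * ξ i) := by
      intro i
      have := (hasSum_geometric_of_lt_one (mul_nonneg hu (h0 i)) (hlt i)).mul_right (ξ i)
      refine this.congr_fun fun k => ?_
      rw [mul_pow]; ring
    simp_rw [Finset.mul_sum]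
    exact hasSum_sum fun i _ => this i
  have hsum : Summable fun k : ℕ => q ^ k * |∑ i, P i ^ k * ξ i| := by
    refine Summable.of_nonneg_of_le (fun k => ?_) (fun k => ?_)
      ((summable_geometric_of_lt_one (hu.trans huq) hq1).mul_right (∑ i, |ξ i|))
    · exact mul_nonneg (pow_nonneg (hu.trans huq) k) (abs_nonneg _)
    · exact mul_le_mul_of_nonneg_left (abs_sum_pow_mul_le h0 h1 ξ k)
        (pow_nonneg (hu.trans huq) k)
  rw [← hs.tsum_eq, ← Real.norm_eq_abs]
  refine tsum_of_norm_bounded hsum.hasSum fun k => ?_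
  rw [Real.norm_eq_abs, abs_mul, abs_of_nonneg (pow_nonneg hu k)]
  exact mul_le_mul_of_nonneg_right (pow_le_pow_left₀ hu huq k) (abs_nonneg _)

/-- Factor out the larger of `a` and `b`: if `b ≤ a`, the denominator is `a(1 - (1 - b/a)(1 - P_i))`
with `0 ≤ 1 - b/a ≤ 1 - κ²`; otherwise exchange the roles. The right side does not involve `a` and
`b`, hence bounds the weighted scores of all competing parameters at once. -/
theorem abs_sum_div_le_supStat {κ a b : ℝ} (hκ : 0 < κ) (ha : κ ≤ a) (ha' : a ≤ κ⁻¹)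
    (hb : κ ≤ b) (hb' : b ≤ κ⁻¹) {P : Fin N → ℝ} (h0 : ∀ i, 0 ≤ P i) (h1 : ∀ i, P i ≤ 1)
    (ξ : Fin N → ℝ) :
    |∑ i, (a * P i + b * (1 - P i))⁻¹ * ξ i| ≤ κ⁻¹ * supStat (1 - κ ^ 2) P ξ := by
  have ha0 := hκ.trans_le ha
  have hb0 := hκ.trans_le hb
  have hκ1 : κ ^ 2 ≤ 1 := by
    have := mul_le_mul_of_nonneg_left (ha.trans ha') hκ.le
    rw [mul_inv_cancel₀ hκ.ne'] at this
    nlinarith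
  have hq1 : 1 - κ ^ 2 < 1 := by nlinarith [pow_pos hκ 2]
  have hq0 : 0 ≤ 1 - κ ^ 2 := by linarith
  have hratio : ∀ x y : ℝ, κ ≤ x → 0 < y → y ≤ κ⁻¹ → κ ^ 2 ≤ x / y := by
    intro x y hx hy hy'
    rw [le_div_iff₀ hy]
    calc κ ^ 2 * y ≤ κ ^ 2 * κ⁻¹ := mul_le_mul_of_nonneg_left hy' (sq_nonneg κ)
      _ = κ := by field_simp
      _ ≤ x := hx
  have h0' : ∀ i, 0 ≤ 1 - P i := fun i => sub_nonneg.2 (h1 i)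
  have h1' : ∀ i, 1 - P i ≤ 1 := fun i => sub_le_self _ (h0 i)
  have hsm := summable_supStat hq0 hq1 h0 h1 ξ
  -- Common part of the two cases, with `c = max a b` and `R` equal to `1 - P` or `P`; `supStat`
  -- contains both kinds of powers.
  have hfac : ∀ (c u : ℝ) (R : Fin N → ℝ), κ ≤ c → 0 ≤ u → u ≤ 1 - κ ^ 2 → (∀ i, 0 ≤ R i) →
      (∀ i, R i ≤ 1) → (∀ k, |∑ i, R i ^ k * ξ i| ≤
        |∑ i, P i ^ k * ξ i| + |∑ i, (1 - P i) ^ k * ξ i|) →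
      (∀ i, a * P i + b * (1 - P i) = c * (1 - u * R i)) →
      |∑ i, (a * P i + b * (1 - P i))⁻¹ * ξ i| ≤ κ⁻¹ * supStat (1 - κ ^ 2) P ξ := by
    intro c u R hc hu huq hR0 hR1 hR hE
    have hc0 := hκ.trans_le hc
    have e : ∑ i, (a * P i + b * (1 - P i))⁻¹ * ξ i = c⁻¹ * ∑ i, (1 - u * R i)⁻¹ * ξ i := by
      rw [Finset.mul_sum]
      refine Finset.sum_congr rfl fun i _ => ?_
      rw [hE, mul_inv, mul_assoc]
    rw [e, abs_mul, abs_of_pos (inv_pos.2 hc0)]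
    have hle : ∀ k : ℕ, (1 - κ ^ 2) ^ k * |∑ i, R i ^ k * ξ i| ≤
        (1 - κ ^ 2) ^ k * (|∑ i, P i ^ k * ξ i| + |∑ i, (1 - P i) ^ k * ξ i|) := fun k =>
      mul_le_mul_of_nonneg_left (hR k) (pow_nonneg hq0 k)
    have hsR := Summable.of_nonneg_of_le (fun k : ℕ =>
      mul_nonneg (pow_nonneg hq0 k) (abs_nonneg (∑ i, R i ^ k * ξ i))) hle hsm
    exact mul_le_mul (inv_anti₀ hκ hc) ((abs_sum_geometric_le hu huq hq1 hR0 hR1 ξ).trans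
      (hsR.tsum_le_tsum hle hsm)) (abs_nonneg _) (inv_nonneg.2 hκ.le)
  rcases le_total b a with hab | hab
  · refine hfac a (1 - b / a) (fun i => 1 - P i) ha (sub_nonneg.2 ((div_le_one ha0).2 hab))
      (sub_le_sub_left (hratio b a hb ha0 ha') 1) h0' h1'
      (fun k => le_add_of_nonneg_left (abs_nonneg _)) fun i => ?_
    field_simp
    ring
  · refine hfac b (1 - a / b) P hb (sub_nonneg.2 ((div_le_one hb0).2 hab))
      (sub_le_sub_left (hratio a b ha hb0 hb') 1) h0 h1
      (fun k => le_add_of_nonneg_right (abs_nonneg _)) fun i => ?_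
    field_simp
    ring

/-- The share of the idiosyncratic noise in the variances in the eigenbasis. -/
def noiseShare (G : SimpleGraph (Fin N)) (s t : ℝ) (i : Fin N) : ℝ := s / cvar G s t i

theorem noiseShare_nonneg (G : SimpleGraph (Fin N)) {s t : ℝ} (hs : 0 < s) (ht : 0 < t)
    (i : Fin N) : 0 ≤ noiseShare G s t i := div_nonneg hs.le (cvar_pos G hs ht i).le

theorem noiseShare_le_one (G : SimpleGraph (Fin N)) {s t : ℝ} (hs : 0 < s) (ht : 0 < t)
    (i : Fin N) : noiseShare G s t i ≤ 1 := by
  rw [noiseShare, div_le_one (cvar_pos G hs ht i), cvar]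
  have := mul_nonneg ht.le (sq_nonneg (specVal G i))
  linarith

/-- The variance ratio in each eigendirection is a convex combination of the ratios of the two
variance components, so the competing parameter enters all coordinates through only two numbers. -/
theorem one_add_relVar_eq (G : SimpleGraph (Fin N)) {s t : ℝ} (hs : 0 < s) (ht : 0 < t)
    (ds dt : ℝ) (i : Fin N) :
    1 + relVar G s t ds dt i = (s + ds) / s * noiseShare G s t i +
      (t + dt) / t * (1 - noiseShare G s t i) := by
  have h := (cvar_pos G hs ht i).ne'
  rw [relVar, noiseShare]
  field_simp
  rw [cvar]
  ring

theorem relVar_block_bound (G : SimpleGraph (Fin N)) {κ s t ds dt : ℝ} (hκ : 0 < κ) (hκ1 : κ ≤ 1)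
    (hs : 0 < s) (ht : 0 < t) (h1 : κ ≤ (s + ds) / s) (h1' : (s + ds) / s ≤ κ⁻¹)
    (h2 : κ ≤ (t + dt) / t) (h2' : (t + dt) / t ≤ κ⁻¹) (w X : Fin N → ℝ) :
    gaussPart w X (relVar G s t ds dt) ≤
      -(κ ^ 3 / 4) * (∑ i, X i ^ 2 + 1 / 2 * ∑ i, relVar G s t ds dt i ^ 2) +
      |∑ i, ((s + ds) / s * noiseShare G s t i + (t + dt) / t * (1 - noiseShare G s t i))⁻¹ *
        scoreTerm w X (relVar G s t ds dt) i| := by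
  have hP0 := noiseShare_nonneg G hs ht
  have hP1 := noiseShare_le_one G hs ht
  have h := gaussPart_le hκ hκ1 w X (relVar G s t ds dt) (fun i => ?_) (fun i => ?_)
  · simp only [one_add_relVar_eq G hs ht] at h
    exact h.trans (add_le_add_right (le_abs_self _) _)
  · rw [one_add_relVar_eq G hs ht]
    nlinarith [mul_le_mul_of_nonneg_right h1 (hP0 i),
      mul_le_mul_of_nonneg_right h2 (sub_nonneg.2 (hP1 i))]
  · rw [one_add_relVar_eq G hs ht]
    nlinarith [mul_le_mul_of_nonneg_right h1' (hP0 i),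
      mul_le_mul_of_nonneg_right h2' (sub_nonneg.2 (hP1 i))]

/-! ### The exposure block -/

theorem convexOn_log_one_add_exp :
    ConvexOn ℝ Set.univ fun x : ℝ => Real.log (1 + Real.exp x) := by
  refine Monotone.convexOn_univ_of_deriv
    (fun x => (hasDerivAt_log_one_add_exp x).differentiableAt) ?_
  have : deriv (fun x : ℝ => Real.log (1 + Real.exp x)) = sig :=
    funext fun x => (hasDerivAt_log_one_add_exp x).deriv
  rw [this]
  exact monotone_of_deriv_nonneg (fun x => (hasDerivAt_sig x).differentiableAt)
    fun x => by rw [(hasDerivAt_sig x).deriv]; exact (bernVar_pos x).le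

/-- `bernPart` is concave in `η` and vanishes at `0`. A negative bound at a point of a segment from
`0` thus propagates outwards. -/
theorem bernPart_smul_ge (A θ η : Fin N → ℝ) {τ : ℝ} (h0 : 0 ≤ τ) (h1 : τ ≤ 1) :
    τ * bernPart A θ η ≤ bernPart A θ (τ • η) := by
  rw [bernPart, bernPart, Finset.mul_sum]
  refine Finset.sum_le_sum fun i _ => ?_
  have h := convexOn_log_one_add_exp.2 (Set.mem_univ (θ i)) (Set.mem_univ (θ i + η i))
    (sub_nonneg.2 h1) h0 (by ring)
  simp only [smul_eq_mul] at h
  have e : (1 - τ) * θ i + τ * (θ i + η i) = θ i + τ * η i := by ring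
  rw [e] at h
  simp only [Pi.smul_apply, smul_eq_mul]
  nlinarith

/-- Second-order Taylor formula for the exposure block. -/
theorem bernPart_taylor (A θ η : Fin N → ℝ) :
    ∃ ξ ∈ Set.Ioo (0 : ℝ) 1, bernPart A θ η =
      bernScore A θ η - 1 / 2 * bernInfo (θ + ξ • η) η := by
  set F : ℝ → ℝ := fun r => bernPart A θ (0 + r • η) - r * bernScore A θ η
  set F' : ℝ → ℝ := fun r => ∑ i, (A i - sig (θ i + (0 : Fin N → ℝ) i + r * η i)) * η i -
    bernScore A θ η
  have hF : ∀ r, HasDerivAt F (F' r) r := fun r =>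
    ((hasDerivAt_bernPart A θ 0 η r).sub
      ((hasDerivAt_id r).mul_const (bernScore A θ η))).congr_deriv (by simp [F'])
  have hF' : ∀ r, HasDerivAt F' (-∑ i, bernVar (θ i + (0 : Fin N → ℝ) i + r * η i) * η i ^ 2) r :=
    fun r => (hasDerivAt_bernScore A θ 0 η r).sub_const _
  have hG : ∀ r : ℝ, HasDerivAt (fun r : ℝ => r ^ 2) (2 * r) r := fun r => by
    simpa using hasDerivAt_pow 2 r
  -- Cauchy's mean value theorem against `r²` gives `F 1 = F' c / (2c)`, and an ordinary one gives
  -- `F' c = c F''(ξ)`; this yields exactly `F''(ξ)/2`.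
  obtain ⟨c, hc, hce⟩ := exists_ratio_hasDerivAt_eq_ratio_slope F F' zero_lt_one
    (fun r _ => (hF r).continuousAt.continuousWithinAt) (fun r _ => hF r)
    (fun r : ℝ => r ^ 2) (fun r => 2 * r)
    (fun r _ => (hG r).continuousAt.continuousWithinAt) (fun r _ => hG r)
  obtain ⟨ξ, hξ, hξe⟩ := exists_hasDerivAt_eq_slope F' _ hc.1
    (fun r _ => (hF' r).continuousAt.continuousWithinAt) (fun r _ => hF' r)
  have hF0 : F 0 = 0 := by simp [F, bernPart]
  have hF'0 : F' 0 = 0 := by simp [F', bernScore]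
  have hF1 : F 1 = bernPart A θ η - bernScore A θ η := by simp [F]
  refine ⟨ξ, ⟨hξ.1, hξ.2.trans hc.2⟩, ?_⟩
  have hI : ∑ i, bernVar (θ i + (0 : Fin N → ℝ) i + ξ * η i) * η i ^ 2 =
      bernInfo (θ + ξ • η) η := by simp [bernInfo]
  rw [hI, hF'0, sub_zero, sub_zero, eq_div_iff hc.1.ne'] at hξe
  simp only [hF0, hF1] at hce
  have hc0 := hc.1.ne'
  have : 2 * c * (bernPart A θ η - bernScore A θ η + 1 / 2 * bernInfo (θ + ξ • η) η) = 0 := by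
    nlinarith
  have h2 : bernPart A θ η - bernScore A θ η + 1 / 2 * bernInfo (θ + ξ • η) η = 0 := by
    rcases mul_eq_zero.1 this with h | h
    · exact absurd h (mul_ne_zero two_ne_zero hc0)
    · exact h
  linarith

end

section

variable {p N : ℕ}

/-! ## Stochastic boundedness of the normalised score -/

/-- The direction `B^{-1/2} e_j`. -/
def infoDir (B : Matrix (ParamIdx p) (ParamIdx p) ℝ) (j : ParamIdx p) : Param p :=
  WithLp.toLp 2 (misqrt B *ᵥ Pi.single j 1)

theorem infoDir_quad {B : Matrix (ParamIdx p) (ParamIdx p) ℝ} (hB : B.PosDef) (j : ParamIdx p) :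
    (infoDir B j).ofLp ⬝ᵥ (B *ᵥ (infoDir B j).ofLp) = 1 := by
  rw [← infoNorm_sq hB, infoDir, infoNorm_misqrt hB, norm_toLp_sq]
  simp

/-- Expand `b` in the vectors `B^{-1/2} e_j`: the coefficients are the entries of `B^{1/2} b`, each
at most its norm. Control of finitely many directions of information one gives control of all
directions. -/
theorem abs_linear_le {B : Matrix (ParamIdx p) (ParamIdx p) ℝ} (hB : B.PosDef)
    (L : Param p →ₗ[ℝ] ℝ) (b : Param p) :
    |L b| ≤ infoNorm B b.ofLp * ∑ j, |L (infoDir B j)| := by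
  set a := msqrt B *ᵥ b.ofLp with ha
  have hb : b = ∑ j, a j • infoDir B j := by
    have h1 : b.ofLp = misqrt B *ᵥ a := (misqrt_mulVec_msqrt hB _).symm
    have h2 : a = ∑ j, a j • (Pi.single j (1 : ℝ) : ParamIdx p → ℝ) := by
      conv_lhs => rw [← Finset.univ_sum_single a]
      refine Finset.sum_congr rfl fun j _ => ?_
      rw [← Pi.single_smul]; simp
    have h3 : misqrt B *ᵥ a = ∑ j, a j • (misqrt B *ᵥ Pi.single j 1) := by
      conv_lhs => rw [h2]
      rw [Matrix.mulVec_sum]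
      exact Finset.sum_congr rfl fun j _ => Matrix.mulVec_smul _ _ _
    rw [← WithLp.toLp_ofLp 2 b, h1, h3, WithLp.toLp_sum]
    rfl
  conv_lhs => rw [hb]
  rw [map_sum, Finset.mul_sum]
  refine (Finset.abs_sum_le_sum_abs _ _).trans (Finset.sum_le_sum fun j _ => ?_)
  rw [map_smul, smul_eq_mul, abs_mul]
  refine mul_le_mul_of_nonneg_right ?_ (abs_nonneg _)
  have := PiLp.norm_apply_le (p := 2) (WithLp.toLp 2 a) j
  simpa [infoNorm, ha] using this

/-- A weighted score of a Gaussian block as a linear function of the direction. -/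
def weightedScore (β w : Fin N → ℝ) (X y : Param p →ₗ[ℝ] (Fin N → ℝ)) : Param p →ₗ[ℝ] ℝ where
  toFun c := ∑ i, β i * scoreTerm w (X c) (y c) i
  map_add' c d := by
    rw [← Finset.sum_add_distrib]
    refine Finset.sum_congr rfl fun i _ => ?_
    simp only [scoreTerm, map_add, Pi.add_apply]
    ring
  map_smul' r c := by
    simp only [RingHom.id_apply, smul_eq_mul]
    rw [Finset.mul_sum]
    refine Finset.sum_congr rfl fun i _ => ?_
    simp only [scoreTerm, map_smul, Pi.smul_apply, smul_eq_mul]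
    ring

/-- The score of the exposure block as a linear function of the direction. -/
def bernScoreL (A θ : Fin N → ℝ) (η : Param p →ₗ[ℝ] (Fin N → ℝ)) : Param p →ₗ[ℝ] ℝ where
  toFun c := bernScore A θ (η c)
  map_add' c d := by
    simp only [bernScore]
    rw [← Finset.sum_add_distrib]
    refine Finset.sum_congr rfl fun i _ => ?_
    simp only [map_add, Pi.add_apply]
    ring
  map_smul' r c := by
    simp only [RingHom.id_apply, smul_eq_mul, bernScore]
    rw [Finset.mul_sum]
    refine Finset.sum_congr rfl fun i _ => ?_
    simp only [map_smul, Pi.smul_apply, smul_eq_mul]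
    ring

theorem supStat_nonneg {q : ℝ} (hq : 0 ≤ q) (P ξ : Fin N → ℝ) : 0 ≤ supStat q P ξ :=
  tsum_nonneg fun k => by positivity

theorem measurable_gaussScore {α : Type*} [MeasurableSpace α] {w X y : α → Fin N → ℝ}
    (hw : Measurable w) (hX : Measurable X) (hy : Measurable y) :
    Measurable fun x => gaussScore (w x) (X x) (y x) := by
  have h1 : ∀ i, Measurable fun x => X x i := fun i => (measurable_pi_apply i).comp hX
  have h2 : ∀ i, Measurable fun x => w x i := fun i => (measurable_pi_apply i).comp hw
  have h3 : ∀ i, Measurable fun x => y x i := fun i => (measurable_pi_apply i).comp hy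
  unfold gaussScore
  fun_prop

theorem measurable_sum_scoreTerm {α : Type*} [MeasurableSpace α] {w X : α → Fin N → ℝ}
    (hw : Measurable w) (hX : Measurable X) (y β : Fin N → ℝ) :
    Measurable fun x => ∑ i, β i * scoreTerm (w x) (X x) y i := by
  have h1 : ∀ i, Measurable fun x => X x i := fun i => (measurable_pi_apply i).comp hX
  have h2 : ∀ i, Measurable fun x => w x i := fun i => (measurable_pi_apply i).comp hw
  unfold scoreTerm
  fun_prop

theorem ofReal_supStat {q : ℝ} (hq0 : 0 ≤ q) (hq1 : q < 1) {P : Fin N → ℝ}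
    (h0 : ∀ i, 0 ≤ P i) (h1 : ∀ i, P i ≤ 1) (ξ : Fin N → ℝ) :
    ENNReal.ofReal (supStat q P ξ) = ∑' k : ℕ, ENNReal.ofReal (q ^ k) *
      (ENNReal.ofReal |∑ i, P i ^ k * ξ i| + ENNReal.ofReal |∑ i, (1 - P i) ^ k * ξ i|) := by
  rw [supStat, ENNReal.ofReal_tsum_of_nonneg (fun k => by positivity)
    (summable_supStat hq0 hq1 h0 h1 ξ)]
  refine tsum_congr fun k => ?_
  rw [ENNReal.ofReal_mul (pow_nonneg hq0 k), ENNReal.ofReal_add (abs_nonneg _) (abs_nonneg _)]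

/-- The series is moved to the extended nonnegative reals, where a countable sum of measurable
functions is measurable. -/
theorem measurable_supStat {α : Type*} [MeasurableSpace α] {w X : α → Fin N → ℝ}
    (hw : Measurable w) (hX : Measurable X) (y : Fin N → ℝ) {q : ℝ} (hq0 : 0 ≤ q) (hq1 : q < 1)
    {P : Fin N → ℝ} (h0 : ∀ i, 0 ≤ P i) (h1 : ∀ i, P i ≤ 1) :
    Measurable fun x => supStat q P (scoreTerm (w x) (X x) y) := by
  have h : (fun x => supStat q P (scoreTerm (w x) (X x) y)) =
      fun x => (ENNReal.ofReal (supStat q P (scoreTerm (w x) (X x) y))).toReal := by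
    funext x
    rw [ENNReal.toReal_ofReal (supStat_nonneg hq0 _ _)]
  rw [h]
  simp_rw [ofReal_supStat hq0 hq1 h0 h1]
  refine (Measurable.tsum fun k => ?_).ennreal_toReal
  have e1 := measurable_sum_scoreTerm hw hX y (fun i => P i ^ k)
  have e2 := measurable_sum_scoreTerm hw hX y (fun i => (1 - P i) ^ k)
  exact ((e1.abs.ennreal_ofReal).add (e2.abs.ennreal_ofReal)).const_mul _

theorem ofReal_abs_le_one_add_sq (z : ℝ) :
    ENNReal.ofReal |z| ≤ 1 + ENNReal.ofReal (z ^ 2) := by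
  rw [← ENNReal.ofReal_one, ← ENNReal.ofReal_add zero_le_one (sq_nonneg z)]
  refine ENNReal.ofReal_le_ofReal ?_
  rw [← sq_abs z]
  nlinarith [sq_nonneg (|z| - 1), abs_nonneg z]

/-- The weights are absorbed into `X` and `y`, and the noise is integrated out first, with `X`
fixed. Since `0 ≤ β ≤ 1`, the bound is independent of `β`, in particular of the power `k` when `β =
P ^ k`. -/
theorem lintegral_abs_gaussScore_le {α : Type*} [MeasurableSpace α] {μ : Measure α}
    [IsProbabilityMeasure μ] {X : α → Fin N → ℝ} (hX : Measurable X)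
    (hi : Integrable (fun x => ∑ i, X x i ^ 2) μ) (y : Fin N → ℝ) {β : Fin N → ℝ}
    (hβ0 : ∀ i, 0 ≤ β i) (hβ1 : ∀ i, β i ≤ 1) :
    ∫⁻ z, ENNReal.ofReal |∑ i, β i * scoreTerm z.2 (X z.1) y i| ∂(μ.prod (iidGaussian N 1)) ≤
      ENNReal.ofReal (1 + scoreConst * (∫ x, ∑ i, X x i ^ 2 ∂μ + 1 / 2 * ∑ i, y i ^ 2)) := by
  have hm : Measurable fun z : α × (Fin N → ℝ) => ∑ i, β i * scoreTerm z.2 (X z.1) y i :=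
    measurable_sum_scoreTerm measurable_snd (hX.comp measurable_fst) y β
  have hC : 0 ≤ scoreConst := by linarith [scoreConst_ge]
  have hI : 0 ≤ ∫ x, ∑ i, X x i ^ 2 ∂μ := integral_nonneg fun x =>
    Finset.sum_nonneg fun i _ => sq_nonneg _
  have hy : 0 ≤ ∑ i, y i ^ 2 := Finset.sum_nonneg fun i _ => sq_nonneg _
  have hi' : Integrable (fun x => ∑ i, X x i ^ 2 + 1 / 2 * ∑ i, y i ^ 2) μ :=
    hi.add (integrable_const _)
  calc _ ≤ ∫⁻ z, (1 + ENNReal.ofReal ((∑ i, β i * scoreTerm z.2 (X z.1) y i) ^ 2))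
        ∂(μ.prod (iidGaussian N 1)) := lintegral_mono fun z => ofReal_abs_le_one_add_sq _
    _ = 1 + ∫⁻ z, ENNReal.ofReal ((∑ i, β i * scoreTerm z.2 (X z.1) y i) ^ 2)
        ∂(μ.prod (iidGaussian N 1)) := by
        rw [lintegral_add_left measurable_const]; simp
    _ = 1 + ∫⁻ x, ∫⁻ w, ENNReal.ofReal ((∑ i, β i * scoreTerm w (X x) y i) ^ 2)
        ∂(iidGaussian N 1) ∂μ := by
        rw [lintegral_prod _ (hm.pow_const 2).ennreal_ofReal.aemeasurable]
    _ ≤ 1 + ∫⁻ x, ENNReal.ofReal (scoreConst * (∑ i, X x i ^ 2 + 1 / 2 * ∑ i, y i ^ 2)) ∂μ := by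
        refine add_le_add_right (lintegral_mono fun x => ?_) _
        simp_rw [sum_mul_scoreTerm]
        refine (lintegral_sq_gaussScore_le _ _).trans (ENNReal.ofReal_le_ofReal ?_)
        refine mul_le_mul_of_nonneg_left ?_ hC
        rw [Finset.mul_sum, ← Finset.sum_add_distrib]
        refine Finset.sum_le_sum fun i _ => ?_
        simp only [Pi.mul_apply, mul_pow]
        have h1 : β i ^ 2 ≤ 1 := pow_le_one₀ (hβ0 i) (hβ1 i)
        nlinarith [mul_le_mul_of_nonneg_right h1 (sq_nonneg (X x i)),
          mul_le_mul_of_nonneg_right h1 (sq_nonneg (y i))]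
    _ = _ := by
        rw [← ofReal_integral_eq_lintegral_ofReal
          (hi'.const_mul scoreConst)
          (ae_of_all _ fun x => ?_), integral_const_mul, integral_add hi (integrable_const _),
          ← ENNReal.ofReal_one, ← ENNReal.ofReal_add zero_le_one]
        · simp
        · refine mul_nonneg hC (add_nonneg hI ?_)
          simpa using hy
        · refine mul_nonneg hC (add_nonneg (Finset.sum_nonneg fun i _ => sq_nonneg _) ?_)
          linarith

/-- Each power contributes a uniformly bounded first moment, and the factors `q ^ k` sum to `1/(1 -
q)`. -/
theorem lintegral_supStat_le {α : Type*} [MeasurableSpace α] {μ : Measure α}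
    [IsProbabilityMeasure μ] {X : α → Fin N → ℝ} (hX : Measurable X)
    (hi : Integrable (fun x => ∑ i, X x i ^ 2) μ) (y : Fin N → ℝ) {q : ℝ} (hq0 : 0 ≤ q)
    (hq1 : q < 1) {P : Fin N → ℝ} (h0 : ∀ i, 0 ≤ P i) (h1 : ∀ i, P i ≤ 1)
    (hv : ∫ x, ∑ i, X x i ^ 2 ∂μ + 1 / 2 * ∑ i, y i ^ 2 ≤ 1) :
    ∫⁻ z, ENNReal.ofReal (supStat q P (scoreTerm z.2 (X z.1) y)) ∂(μ.prod (iidGaussian N 1)) ≤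
      ENNReal.ofReal ((1 - q)⁻¹ * (2 * (1 + scoreConst))) := by
  have hC : 0 ≤ scoreConst := by linarith [scoreConst_ge]
  set M := ENNReal.ofReal (1 + scoreConst) with hM
  have hb : ∀ β : Fin N → ℝ, (∀ i, 0 ≤ β i) → (∀ i, β i ≤ 1) →
      ∫⁻ z, ENNReal.ofReal |∑ i, β i * scoreTerm z.2 (X z.1) y i| ∂(μ.prod (iidGaussian N 1)) ≤ M :=
    fun β hβ0 hβ1 => (lintegral_abs_gaussScore_le hX hi y hβ0 hβ1).trans
      (ENNReal.ofReal_le_ofReal (by nlinarith))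
  have hm : ∀ β : Fin N → ℝ, Measurable fun z : α × (Fin N → ℝ) =>
      ENNReal.ofReal |∑ i, β i * scoreTerm z.2 (X z.1) y i| := fun β =>
    (measurable_sum_scoreTerm measurable_snd (hX.comp measurable_fst) y β).abs.ennreal_ofReal
  have hm2 : ∀ k : ℕ, Measurable fun z : α × (Fin N → ℝ) =>
      ENNReal.ofReal |∑ i, P i ^ k * scoreTerm z.2 (X z.1) y i| +
      ENNReal.ofReal |∑ i, (1 - P i) ^ k * scoreTerm z.2 (X z.1) y i| := fun k =>
    (hm fun i => P i ^ k).add (hm fun i => (1 - P i) ^ k)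
  have hm3 : ∀ k : ℕ, AEMeasurable (fun z : α × (Fin N → ℝ) => ENNReal.ofReal (q ^ k) *
      (ENNReal.ofReal |∑ i, P i ^ k * scoreTerm z.2 (X z.1) y i| +
      ENNReal.ofReal |∑ i, (1 - P i) ^ k * scoreTerm z.2 (X z.1) y i|))
      (μ.prod (iidGaussian N 1)) := fun k => ((hm2 k).const_mul _).aemeasurable
  simp_rw [ofReal_supStat hq0 hq1 h0 h1]
  rw [lintegral_tsum hm3]
  calc _ ≤ ∑' k : ℕ, ENNReal.ofReal (q ^ k) * (M + M) := by
        refine ENNReal.tsum_le_tsum fun k => ?_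
        rw [lintegral_const_mul _ (hm2 k),
          lintegral_add_left (hm fun i => P i ^ k)]
        refine mul_le_mul_right (add_le_add (hb _ (fun i => pow_nonneg (h0 i) k)
          fun i => pow_le_one₀ (h0 i) (h1 i)) (hb _ (fun i => pow_nonneg (sub_nonneg.2 (h1 i)) k)
          fun i => pow_le_one₀ (sub_nonneg.2 (h1 i)) (sub_le_self _ (h0 i)))) _
    _ = _ := by
        rw [ENNReal.tsum_mul_right, ← ENNReal.ofReal_tsum_of_nonneg (fun k => pow_nonneg hq0 k)
          (summable_geometric_of_lt_one hq0 hq1), tsum_geometric_of_lt_one hq0 hq1, hM,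
          ← ENNReal.ofReal_add (by linarith) (by linarith),
          ← ENNReal.ofReal_mul (inv_nonneg.2 (by linarith))]
        congr 1
        ring

/-- A statistic bounding the normalised weighted scores of all blocks. -/
def scoreBound (G : SimpleGraph (Fin N)) (φ : Param p) (B : Matrix (ParamIdx p) (ParamIdx p) ℝ)
    (κ : ℝ) (ω : Red p N) : ℝ :=
  ∑ j, (κ⁻¹ * supStat (1 - κ ^ 2) (noiseShare G (variances φ 0) (variances φ 1))
      (scoreTerm ω.2 (regY G φ ω.1 (infoDir B j)) (relY G φ (infoDir B j))) +
    κ⁻¹ * supStat (1 - κ ^ 2) (noiseShare G (variances φ 2) (variances φ 3))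
      (scoreTerm ω.1.2 (regM G φ ω.1.1 (infoDir B j)) (relM G φ (infoDir B j))) +
    |bernScore (expo φ ω.1.1) (linA ω.1.1.1 φ) (linA ω.1.1.1 (infoDir B j))|)

theorem measurable_bernScore (φ c : Param p) :
    Measurable fun x : Cov p N × (Fin N → unitInterval) =>
      bernScore (expo φ x) (linA x.1 φ) (linA x.1 c) := by
  have h1 : ∀ i, Measurable fun x : Cov p N × (Fin N → unitInterval) => expo φ x i := fun i =>
    (measurable_pi_apply i).comp (measurable_expo φ)
  have h2 : ∀ (b : Param p) i, Measurable fun x : Cov p N × (Fin N → unitInterval) =>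
      linA x.1 b i := fun b i =>
    (measurable_pi_apply i).comp ((measurable_linA b).comp measurable_fst)
  have h3 : ∀ i, Measurable fun x : Cov p N × (Fin N → unitInterval) => sig (linA x.1 φ i) :=
    fun i => measurable_sig.comp (h2 φ i)
  have h4 := h2 c
  unfold bernScore
  fun_prop

/-- Each direction `B^{-1/2} e_j` has total information one and the block informations are
nonnegative, so every block has information at most one. Hence the bound depends on `p` and `κ` but
not on the network, its size or the parameter. -/
theorem exists_scoreBound_const (p : ℕ) {κ : ℝ} (hκ : 0 < κ) (hκ1 : κ ≤ 1) :
    ∃ K : ℝ, ∀ (S : Model p) (N : ℕ) (φ : Param p), (∀ j, 0 < variances φ j) →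
      InfoIntegrable S N φ → (fisherInfo S N φ).PosDef →
      Measurable (scoreBound (S.graph N) φ (fisherInfo S N φ) κ) ∧
      ∫⁻ ω, ENNReal.ofReal (scoreBound (S.graph N) φ (fisherInfo S N φ) κ ω)
        ∂(redLaw (S.covLaw N)) ≤ ENNReal.ofReal K := by
  set a := κ⁻¹ * ((1 - (1 - κ ^ 2))⁻¹ * (2 * (1 + scoreConst))) with ha
  -- For each direction, `a` for either Gaussian block and `2` for the exposure block, from `|z| ≤ 1
  -- + z²`.
  refine ⟨Fintype.card (ParamIdx p) * (a + a + 2), fun S N φ hφ hi hB => ?_⟩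
  have := S.isProb N
  set G := S.graph N
  set B := fisherInfo S N φ
  have hC : 0 ≤ scoreConst := by linarith [scoreConst_ge]
  have hq1 : 1 - κ ^ 2 < 1 := by nlinarith [pow_pos hκ 2]
  have hq0 : 0 ≤ 1 - κ ^ 2 := by nlinarith
  have ha0 : 0 ≤ a := mul_nonneg (inv_nonneg.2 hκ.le)
    (mul_nonneg (inv_nonneg.2 (by linarith)) (by linarith))
  have hPY0 := noiseShare_nonneg G (hφ 0) (hφ 1)
  have hPY1 := noiseShare_le_one G (hφ 0) (hφ 1)
  have hPM0 := noiseShare_nonneg G (hφ 2) (hφ 3)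
  have hPM1 := noiseShare_le_one G (hφ 2) (hφ 3)
  have mY : ∀ j, Measurable fun ω : Red p N =>
      supStat (1 - κ ^ 2) (noiseShare G (variances φ 0) (variances φ 1))
      (scoreTerm ω.2 (regY G φ ω.1 (infoDir B j)) (relY G φ (infoDir B j))) := fun j =>
    measurable_supStat measurable_snd ((measurable_regY G φ _).comp measurable_fst) _ hq0 hq1
      hPY0 hPY1
  have mM' : ∀ j, Measurable fun x : (Cov p N × (Fin N → unitInterval)) × (Fin N → ℝ) =>
      supStat (1 - κ ^ 2) (noiseShare G (variances φ 2) (variances φ 3))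
      (scoreTerm x.2 (regM G φ x.1 (infoDir B j)) (relM G φ (infoDir B j))) := fun j =>
    measurable_supStat measurable_snd ((measurable_regM G φ _).comp measurable_fst) _ hq0 hq1
      hPM0 hPM1
  have mA' : ∀ j, Measurable fun x : Cov p N × (Fin N → unitInterval) =>
      |bernScore (expo φ x) (linA x.1 φ) (linA x.1 (infoDir B j))| := fun j =>
    (measurable_bernScore φ _).abs
  have mM : ∀ j, Measurable fun ω : Red p N =>
      supStat (1 - κ ^ 2) (noiseShare G (variances φ 2) (variances φ 3))
      (scoreTerm ω.1.2 (regM G φ ω.1.1 (infoDir B j)) (relM G φ (infoDir B j))) := fun j =>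
    (mM' j).comp measurable_fst
  have mA : ∀ j, Measurable fun ω : Red p N =>
      |bernScore (expo φ ω.1.1) (linA ω.1.1.1 φ) (linA ω.1.1.1 (infoDir B j))| := fun j =>
    (mA' j).comp (measurable_fst.comp measurable_fst)
  have mj := fun j => (((mY j).const_mul κ⁻¹).add ((mM j).const_mul κ⁻¹)).add (mA j)
  have hone : ∀ j, _ := fun j => (fisher_quad S N hφ hi (infoDir B j)).symm.trans
    (infoDir_quad hB j)
  have nY : ∀ j, 0 ≤ expY G (S.covLaw N) φ (infoDir B j) := fun j =>
    integral_nonneg fun x => Finset.sum_nonneg fun i _ => sq_nonneg _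
  have nM : ∀ j, 0 ≤ expM G (S.covLaw N) φ (infoDir B j) := fun j =>
    integral_nonneg fun x => Finset.sum_nonneg fun i _ => sq_nonneg _
  have nA : ∀ j, 0 ≤ expA (S.covLaw N) φ (infoDir B j) := fun j =>
    integral_nonneg fun x => Finset.sum_nonneg fun i _ =>
      mul_nonneg (bernVar_pos _).le (sq_nonneg _)
  have ny : ∀ j, 0 ≤ ∑ i, relY G φ (infoDir B j) i ^ 2 := fun j =>
    Finset.sum_nonneg fun i _ => sq_nonneg _
  have nm : ∀ j, 0 ≤ ∑ i, relM G φ (infoDir B j) i ^ 2 := fun j =>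
    Finset.sum_nonneg fun i _ => sq_nonneg _
  refine ⟨Finset.measurable_sum _ fun j _ => mj j, ?_⟩
  have hnn : ∀ (ω : Red p N) j, 0 ≤
      κ⁻¹ * supStat (1 - κ ^ 2) (noiseShare G (variances φ 0) (variances φ 1))
      (scoreTerm ω.2 (regY G φ ω.1 (infoDir B j)) (relY G φ (infoDir B j))) ∧ 0 ≤
      κ⁻¹ * supStat (1 - κ ^ 2) (noiseShare G (variances φ 2) (variances φ 3))
      (scoreTerm ω.1.2 (regM G φ ω.1.1 (infoDir B j)) (relM G φ (infoDir B j))) := fun ω j =>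
    ⟨mul_nonneg (inv_nonneg.2 hκ.le) (supStat_nonneg hq0 _ _),
      mul_nonneg (inv_nonneg.2 hκ.le) (supStat_nonneg hq0 _ _)⟩
  have hsum : ∀ ω, ENNReal.ofReal (scoreBound G φ B κ ω) = ∑ j, (ENNReal.ofReal (
      κ⁻¹ * supStat (1 - κ ^ 2) (noiseShare G (variances φ 0) (variances φ 1))
      (scoreTerm ω.2 (regY G φ ω.1 (infoDir B j)) (relY G φ (infoDir B j)))) + ENNReal.ofReal (
      κ⁻¹ * supStat (1 - κ ^ 2) (noiseShare G (variances φ 2) (variances φ 3))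
      (scoreTerm ω.1.2 (regM G φ ω.1.1 (infoDir B j)) (relM G φ (infoDir B j)))) + ENNReal.ofReal
      |bernScore (expo φ ω.1.1) (linA ω.1.1.1 φ) (linA ω.1.1.1 (infoDir B j))|) := by
    intro ω
    rw [scoreBound, ENNReal.ofReal_sum_of_nonneg fun j _ => add_nonneg (add_nonneg (hnn ω j).1
      (hnn ω j).2) (abs_nonneg _)]
    refine Finset.sum_congr rfl fun j _ => ?_
    rw [ENNReal.ofReal_add (add_nonneg (hnn ω j).1 (hnn ω j).2) (abs_nonneg _),
      ENNReal.ofReal_add (hnn ω j).1 (hnn ω j).2]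
  simp_rw [hsum]
  have eY := fun j => ((mY j).const_mul κ⁻¹).ennreal_ofReal
  have eM := fun j => ((mM j).const_mul κ⁻¹).ennreal_ofReal
  have eA := fun j => (mA j).ennreal_ofReal
  have eYM : ∀ j, Measurable fun ω : Red p N => ENNReal.ofReal (
      κ⁻¹ * supStat (1 - κ ^ 2) (noiseShare G (variances φ 0) (variances φ 1))
      (scoreTerm ω.2 (regY G φ ω.1 (infoDir B j)) (relY G φ (infoDir B j)))) + ENNReal.ofReal (
      κ⁻¹ * supStat (1 - κ ^ 2) (noiseShare G (variances φ 2) (variances φ 3))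
      (scoreTerm ω.1.2 (regM G φ ω.1.1 (infoDir B j)) (relM G φ (infoDir B j)))) :=
    fun j => (eY j).add (eM j)
  have eAll : ∀ j, Measurable fun ω : Red p N => ENNReal.ofReal (
      κ⁻¹ * supStat (1 - κ ^ 2) (noiseShare G (variances φ 0) (variances φ 1))
      (scoreTerm ω.2 (regY G φ ω.1 (infoDir B j)) (relY G φ (infoDir B j)))) + ENNReal.ofReal (
      κ⁻¹ * supStat (1 - κ ^ 2) (noiseShare G (variances φ 2) (variances φ 3))
      (scoreTerm ω.1.2 (regM G φ ω.1.1 (infoDir B j)) (relM G φ (infoDir B j)))) + ENNReal.ofReal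
      |bernScore (expo φ ω.1.1) (linA ω.1.1.1 φ) (linA ω.1.1.1 (infoDir B j))| :=
    fun j => (eYM j).add (eA j)
  rw [lintegral_finsetSum _ fun j _ => eAll j]
  refine (Finset.sum_le_card_nsmul _ _ (ENNReal.ofReal (a + a + 2)) fun j _ => ?_).trans
    (le_of_eq ?_)
  · rw [lintegral_add_left (eYM j), lintegral_add_left (eY j),
      ENNReal.ofReal_add (by linarith) (by norm_num), ENNReal.ofReal_add ha0 ha0]
    refine add_le_add (add_le_add ?_ ?_) ?_
    · simp_rw [ENNReal.ofReal_mul (inv_nonneg.2 hκ.le)]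
      rw [lintegral_const_mul _ (mY j).ennreal_ofReal, ha, ENNReal.ofReal_mul (inv_nonneg.2 hκ.le)]
      refine mul_le_mul_right ?_ _
      exact lintegral_supStat_le (measurable_regY G φ _) (integrable_sum_regY S N hφ hi _) _ hq0
        hq1 hPY0 hPY1 (by
          have := hone j
          have := nM j; have := nA j; have := nm j
          simp only [expY] at *
          linarith)
    · simp_rw [ENNReal.ofReal_mul (inv_nonneg.2 hκ.le)]
      rw [lintegral_const_mul _ (mM j).ennreal_ofReal, ha, ENNReal.ofReal_mul (inv_nonneg.2 hκ.le)]
      refine mul_le_mul_right ?_ _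
      refine le_trans (le_of_eq ?_) (lintegral_supStat_le (measurable_regM G φ (infoDir B j))
        (integrable_sum_regM S N hφ hi _) (relM G φ (infoDir B j)) hq0
        hq1 hPM0 hPM1 (by
          have := hone j
          have := nY j; have := nA j; have := ny j
          simp only [expM] at *
          linarith))
      exact (measurePreserving_fst (μ := medLaw (S.covLaw N)) (ν := iidGaussian N 1)).lintegral_comp
        (mM' j).ennreal_ofReal
    · have e1 := (measurePreserving_fst (μ := medLaw (S.covLaw N))
        (ν := iidGaussian N 1)).lintegral_comp ((mA' j).comp measurable_fst).ennreal_ofReal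
      have e2 := (measurePreserving_fst (μ := baseLaw (S.covLaw N))
        (ν := iidGaussian N 1)).lintegral_comp (mA' j).ennreal_ofReal
      refine le_trans (le_of_eq (e1.trans e2)) ?_
      have mS := ((measurable_bernScore (N := N) φ (infoDir B j)).pow_const 2).ennreal_ofReal
      calc _ ≤ ∫⁻ x, (1 + ENNReal.ofReal
            (bernScore (expo φ x) (linA x.1 φ) (linA x.1 (infoDir B j)) ^ 2))
            ∂(baseLaw (S.covLaw N)) := lintegral_mono fun x => ofReal_abs_le_one_add_sq _
        _ = 1 + ∫⁻ C, ENNReal.ofReal (bernInfo (linA C φ) (linA C (infoDir B j)))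
            ∂(S.covLaw N) := by
            rw [lintegral_add_left measurable_const, baseLaw, lintegral_prod _ mS.aemeasurable]
            simp_rw [lintegral_sq_bernScore]
            simp
        _ = 1 + ENNReal.ofReal (expA (S.covLaw N) φ (infoDir B j)) := by
            rw [expA, ofReal_integral_eq_lintegral_ofReal (integrable_bernInfo S N hφ hi _)
              (ae_of_all _ fun C => Finset.sum_nonneg fun i _ =>
                mul_nonneg (bernVar_pos _).le (sq_nonneg _))]
        _ ≤ ENNReal.ofReal 2 := by
            rw [← ENNReal.ofReal_one, ← ENNReal.ofReal_add zero_le_one (nA j)]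
            refine ENNReal.ofReal_le_ofReal ?_
            have := hone j
            have := nY j; have := nM j; have := ny j; have := nm j
            linarith
  · rw [nsmul_eq_mul, ENNReal.ofReal_mul (Nat.cast_nonneg _), ENNReal.ofReal_natCast]
    rfl

end

section

variable {p N : ℕ}

/-! ## Tightness of the maximum likelihood estimator: deterministic part -/

theorem expY_congr (G : SimpleGraph (Fin N)) (μC : Measure (Cov p N)) (φ : Param p) {b c : Param p}
    (h : beta b = beta c) : expY G μC φ b = expY G μC φ c := by
  simp only [expY, regY_congr G φ _ h]

theorem expM_congr (G : SimpleGraph (Fin N)) (μC : Measure (Cov p N)) (φ : Param p) {b c : Param p}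
    (h : gamma b = gamma c) : expM G μC φ b = expM G μC φ c := by
  simp only [expM, regM_congr G φ _ h]

theorem expA_congr (μC : Measure (Cov p N)) (φ : Param p) {b c : Param p}
    (h : alpha b = alpha c) : expA μC φ b = expA μC φ c := by
  simp only [expA, linA_congr _ h]

theorem expY_nonneg (G : SimpleGraph (Fin N)) (μC : Measure (Cov p N)) (φ b : Param p) :
    0 ≤ expY G μC φ b := integral_nonneg fun _ => Finset.sum_nonneg fun _ _ => sq_nonneg _

theorem expM_nonneg (G : SimpleGraph (Fin N)) (μC : Measure (Cov p N)) (φ b : Param p) :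
    0 ≤ expM G μC φ b := integral_nonneg fun _ => Finset.sum_nonneg fun _ _ => sq_nonneg _

theorem bernInfo_nonneg (θ η : Fin N → ℝ) : 0 ≤ bernInfo θ η :=
  Finset.sum_nonneg fun _ _ => mul_nonneg (bernVar_pos _).le (sq_nonneg _)

theorem expA_nonneg (μC : Measure (Cov p N)) (φ b : Param p) : 0 ≤ expA μC φ b :=
  integral_nonneg fun _ => bernInfo_nonneg _ _

theorem expY_eq_zero (G : SimpleGraph (Fin N)) (μC : Measure (Cov p N)) (φ : Param p) {b : Param p}
    (h : beta b = 0) : expY G μC φ b = 0 := by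
  simp [expY, regY_eq_zero G φ _ h]

theorem expM_eq_zero (G : SimpleGraph (Fin N)) (μC : Measure (Cov p N)) (φ : Param p) {b : Param p}
    (h : gamma b = 0) : expM G μC φ b = 0 := by
  simp [expM, regM_eq_zero G φ _ h]

theorem expA_eq_zero (μC : Measure (Cov p N)) (φ : Param p) {b : Param p}
    (h : alpha b = 0) : expA μC φ b = 0 := by
  simp [expA, linA_eq_zero _ h, bernInfo]

theorem infoNorm_add_le {n : Type*} [Fintype n] [DecidableEq n] (B : Matrix n n ℝ) (x y : n → ℝ) :
    infoNorm B (x + y) ≤ infoNorm B x + infoNorm B y := by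
  rw [infoNorm, Matrix.mulVec_add, WithLp.toLp_add]
  exact norm_add_le _ _

section

variable (S : Model p) (N : ℕ) {φ : Param p} (hφ : ∀ j, 0 < variances φ j)
  (hi : InfoIntegrable S N φ)

include hφ hi

theorem fisher_quad_keepBeta (c : Param p) :
    (keepBeta c).ofLp ⬝ᵥ (fisherInfo S N φ *ᵥ (keepBeta c).ofLp) =
      expY (S.graph N) (S.covLaw N) φ c := by
  rw [fisher_quad S N hφ hi, expY_congr _ _ φ (b := keepBeta c) (c := c) rfl,
    expM_eq_zero _ _ φ (b := keepBeta c) rfl, expA_eq_zero _ φ (b := keepBeta c) rfl,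
    relY_eq_zero _ φ (b := keepBeta c) rfl, relM_eq_zero _ φ (b := keepBeta c) rfl]
  simp

theorem fisher_quad_keepGamma (c : Param p) :
    (keepGamma c).ofLp ⬝ᵥ (fisherInfo S N φ *ᵥ (keepGamma c).ofLp) =
      expM (S.graph N) (S.covLaw N) φ c := by
  rw [fisher_quad S N hφ hi, expM_congr _ _ φ (b := keepGamma c) (c := c) rfl,
    expY_eq_zero _ _ φ (b := keepGamma c) rfl, expA_eq_zero _ φ (b := keepGamma c) rfl,
    relY_eq_zero _ φ (b := keepGamma c) rfl, relM_eq_zero _ φ (b := keepGamma c) rfl]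
  simp

theorem fisher_quad_keepAlpha (c : Param p) :
    (keepAlpha c).ofLp ⬝ᵥ (fisherInfo S N φ *ᵥ (keepAlpha c).ofLp) =
      expA (S.covLaw N) φ c := by
  rw [fisher_quad S N hφ hi, expA_congr _ φ (b := keepAlpha c) (c := c) rfl,
    expY_eq_zero _ _ φ (b := keepAlpha c) rfl, expM_eq_zero _ _ φ (b := keepAlpha c) rfl,
    relY_eq_zero _ φ (b := keepAlpha c) rfl, relM_eq_zero _ φ (b := keepAlpha c) rfl]
  simp

variable (hB : (fisherInfo S N φ).PosDef)

include hB

/-- A law of large numbers with relative error: the direction `keepBeta c` turns closeness of the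
whole information matrix into closeness for the outcome regressors alone. -/
theorem abs_sum_regY_sub_le {η : ℝ} {ω : Red p N}
    (h6 : frob (misqrt (fisherInfo S N φ) * obsInfo S N φ (redData (S.graph N) φ ω) *
      misqrt (fisherInfo S N φ) - 1) ≤ η) (c : Param p) :
    |∑ i, regY (S.graph N) φ ω.1 c i ^ 2 - expY (S.graph N) (S.covLaw N) φ c| ≤
      η * expY (S.graph N) (S.covLaw N) φ c := by
  have h := abs_quad_sub_le hB (obsInfo S N φ (redData (S.graph N) φ ω)) (keepBeta c).ofLp
  rw [quad_obsInfo_keepBeta S N hφ, fisher_quad_keepBeta S N hφ hi] at h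
  exact h.trans (mul_le_mul_of_nonneg_right h6 (expY_nonneg _ _ _ _))

theorem abs_sum_regM_sub_le {η : ℝ} {ω : Red p N}
    (h6 : frob (misqrt (fisherInfo S N φ) * obsInfo S N φ (redData (S.graph N) φ ω) *
      misqrt (fisherInfo S N φ) - 1) ≤ η) (c : Param p) :
    |∑ i, regM (S.graph N) φ ω.1.1 c i ^ 2 - expM (S.graph N) (S.covLaw N) φ c| ≤
      η * expM (S.graph N) (S.covLaw N) φ c := by
  have h := abs_quad_sub_le hB (obsInfo S N φ (redData (S.graph N) φ ω)) (keepGamma c).ofLp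
  rw [quad_obsInfo_keepGamma S N hφ, fisher_quad_keepGamma S N hφ hi] at h
  exact h.trans (mul_le_mul_of_nonneg_right h6 (expM_nonneg _ _ _ _))

/-- The observed information at `φ + b` is compared with that at `φ`, and the latter with its
expectation, all in the direction `keepAlpha c`. -/
theorem abs_bernInfo_sub_le {η₁ η₂ : ℝ} {ω : Red p N} {b : Param p}
    (hb : ∀ j, 0 < variances (φ + b) j)
    (h6 : frob (misqrt (fisherInfo S N φ) * obsInfo S N φ (redData (S.graph N) φ ω) *
      misqrt (fisherInfo S N φ) - 1) ≤ η₁)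
    (h7 : frob (misqrt (fisherInfo S N φ) * (obsInfo S N (φ + b) (redData (S.graph N) φ ω) -
      obsInfo S N φ (redData (S.graph N) φ ω)) * misqrt (fisherInfo S N φ)) ≤ η₂) (c : Param p) :
    |bernInfo (linA ω.1.1.1 φ + linA ω.1.1.1 b) (linA ω.1.1.1 c) - expA (S.covLaw N) φ c| ≤
      (η₁ + η₂) * expA (S.covLaw N) φ c := by
  have h := abs_quad_sub_le hB (obsInfo S N φ (redData (S.graph N) φ ω)) (keepAlpha c).ofLp
  have h' := abs_quad_le_of_frob hB (obsInfo S N (φ + b) (redData (S.graph N) φ ω) -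
      obsInfo S N φ (redData (S.graph N) φ ω)) (keepAlpha c).ofLp (keepAlpha c).ofLp
  rw [Matrix.sub_mulVec, dotProduct_sub, quad_obsInfo_alpha S N hφ hb,
    quad_obsInfo_keepAlpha S N hφ, ← sq, infoNorm_sq hB, fisher_quad_keepAlpha S N hφ hi] at h'
  rw [quad_obsInfo_keepAlpha S N hφ, fisher_quad_keepAlpha S N hφ hi] at h
  have e0 := expA_nonneg (S.covLaw N) φ c
  have e1 := h.trans (mul_le_mul_of_nonneg_right h6 e0)
  have e2 := h'.trans (mul_le_mul_of_nonneg_right h7 e0)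
  rw [add_mul]
  rw [abs_le] at *
  constructor <;> linarith [e1.1, e1.2, e2.1, e2.2]

set_option maxHeartbeats 1000000 in
/-- On an event where the normalised score is bounded and the observed information is close to
the expected one, a parameter with a larger likelihood than `φ` is close to `φ`. -/
theorem infoNorm_le_of_logLik_le {κ z R : ℝ} (hκ : 0 < κ) (hκ1 : κ ≤ 1) {ω : Red p N}
    {b : Param p} (hb : ∀ j, 0 < variances (φ + b) j)
    (hb1 : ∀ j, κ ≤ variances (φ + b) j / variances φ j)
    (hb2 : ∀ j, variances (φ + b) j / variances φ j ≤ κ⁻¹) (hz0 : 0 ≤ z)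
    (hz : scoreBound (S.graph N) φ (fisherInfo S N φ) κ ω ≤ z)
    (hR : 4 * z + 8 * z ^ 2 / κ ^ 3 + 4 ≤ R)
    (h6 : frob (misqrt (fisherInfo S N φ) * obsInfo S N φ (redData (S.graph N) φ ω) *
      misqrt (fisherInfo S N φ) - 1) ≤ 1 / 4)
    (h7 : ∀ b' : Param p, infoNorm (fisherInfo S N φ) b'.ofLp ≤ R →
      (∀ j, 0 < variances (φ + b') j) ∧
      frob (misqrt (fisherInfo S N φ) * (obsInfo S N (φ + b') (redData (S.graph N) φ ω) -
        obsInfo S N φ (redData (S.graph N) φ ω)) * misqrt (fisherInfo S N φ)) ≤ 1 / 4)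
    (hmax : logLik (S.graph N) (redData (S.graph N) φ ω) φ ≤
      logLik (S.graph N) (redData (S.graph N) φ ω) (φ + b)) :
    infoNorm (fisherInfo S N φ) b.ofLp ≤ 2 * R + 16 * z / κ ^ 3 := by
  set G := S.graph N with hG
  set B := fisherInfo S N φ with hBdef
  set A := expo φ ω.1.1
  set θ := linA ω.1.1.1 φ
  have hvar : ∀ j, variances (φ + b) j = variances φ j + variances b j := fun j => rfl
  have hκ3 : 0 < κ ^ 3 := pow_pos hκ 3
  -- split off the exposure coefficients
  set b₂ := keepAlpha b with hb₂
  set b₁ := b - b₂ with hb₁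
  have hbsum : b = b₁ + b₂ := by rw [hb₁]; abel
  have e_beta : beta b₁ = beta b := by
    funext j; simp [hb₁, hb₂, beta, keepAlpha]
  have e_gamma : gamma b₁ = gamma b := by
    funext j; simp [hb₁, hb₂, gamma, keepAlpha]
  have e_var : variances b₁ = variances b := by
    funext j; simp [hb₁, hb₂, variances, keepAlpha]
  have e_alpha : alpha b₁ = 0 := by
    funext j; simp [hb₁, hb₂, alpha, keepAlpha]
  set x := infoNorm B b₁.ofLp with hx
  set y := infoNorm B b₂.ofLp with hy
  have hx0 : 0 ≤ x := infoNorm_nonneg _ _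
  have hy0 : 0 ≤ y := infoNorm_nonneg _ _
  have hx2 : x ^ 2 = expY G (S.covLaw N) φ b + 1 / 2 * ∑ i, relY G φ b i ^ 2 +
      (expM G (S.covLaw N) φ b + 1 / 2 * ∑ i, relM G φ b i ^ 2) := by
    rw [hx, infoNorm_sq hB, fisher_quad S N hφ hi, expY_congr _ _ φ e_beta,
      expM_congr _ _ φ e_gamma, expA_eq_zero _ φ e_alpha, relY_congr _ φ e_var,
      relM_congr _ φ e_var, add_zero]
  have hy2 : y ^ 2 = expA (S.covLaw N) φ b := by
    rw [hy, infoNorm_sq hB, hb₂, fisher_quad_keepAlpha S N hφ hi]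
  -- the Gaussian blocks
  set TY : ParamIdx p → ℝ := fun j => κ⁻¹ * supStat (1 - κ ^ 2)
    (noiseShare G (variances φ 0) (variances φ 1))
    (scoreTerm ω.2 (regY G φ ω.1 (infoDir B j)) (relY G φ (infoDir B j))) with hTY
  set TM : ParamIdx p → ℝ := fun j => κ⁻¹ * supStat (1 - κ ^ 2)
    (noiseShare G (variances φ 2) (variances φ 3))
    (scoreTerm ω.1.2 (regM G φ ω.1.1 (infoDir B j)) (relM G φ (infoDir B j))) with hTM
  set TA : ParamIdx p → ℝ := fun j => |bernScore A θ (linA ω.1.1.1 (infoDir B j))| with hTA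
  have hq0 : 0 ≤ 1 - κ ^ 2 := by nlinarith
  have hTY0 : 0 ≤ ∑ j, TY j := Finset.sum_nonneg fun j _ =>
    mul_nonneg (inv_nonneg.2 hκ.le) (supStat_nonneg hq0 _ _)
  have hTM0 : 0 ≤ ∑ j, TM j := Finset.sum_nonneg fun j _ =>
    mul_nonneg (inv_nonneg.2 hκ.le) (supStat_nonneg hq0 _ _)
  have hTA0 : 0 ≤ ∑ j, TA j := Finset.sum_nonneg fun j _ => abs_nonneg _
  have hZ : ∑ j, TY j + ∑ j, TM j + ∑ j, TA j ≤ z := by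
    rw [← Finset.sum_add_distrib, ← Finset.sum_add_distrib]
    exact hz
  -- The weights are those of the actual `b` and stay fixed while the score is treated as linear in
  -- the direction; the statistic bounding it does not depend on them.
  have hYlin : |∑ i, (variances (φ + b) 0 / variances φ 0 *
      noiseShare G (variances φ 0) (variances φ 1) i + variances (φ + b) 1 / variances φ 1 *
      (1 - noiseShare G (variances φ 0) (variances φ 1) i))⁻¹ *
      scoreTerm ω.2 (regY G φ ω.1 b) (relY G φ b) i| ≤ x * ∑ j, TY j := by
    rw [← regY_congr G φ ω.1 e_beta, ← relY_congr G φ e_var]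
    refine (abs_linear_le hB (weightedScore _ ω.2 (regY G φ ω.1) (relY G φ)) b₁).trans
      (mul_le_mul_of_nonneg_left (Finset.sum_le_sum fun j _ => ?_) hx0)
    exact abs_sum_div_le_supStat hκ (hb1 0) (hb2 0) (hb1 1) (hb2 1)
      (noiseShare_nonneg G (hφ 0) (hφ 1)) (noiseShare_le_one G (hφ 0) (hφ 1)) _
  have hMlin : |∑ i, (variances (φ + b) 2 / variances φ 2 *
      noiseShare G (variances φ 2) (variances φ 3) i + variances (φ + b) 3 / variances φ 3 *
      (1 - noiseShare G (variances φ 2) (variances φ 3) i))⁻¹ *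
      scoreTerm ω.1.2 (regM G φ ω.1.1 b) (relM G φ b) i| ≤ x * ∑ j, TM j := by
    rw [← regM_congr G φ ω.1.1 e_gamma, ← relM_congr G φ e_var]
    refine (abs_linear_le hB (weightedScore _ ω.1.2 (regM G φ ω.1.1) (relM G φ)) b₁).trans
      (mul_le_mul_of_nonneg_left (Finset.sum_le_sum fun j _ => ?_) hx0)
    exact abs_sum_div_le_supStat hκ (hb1 2) (hb2 2) (hb1 3) (hb2 3)
      (noiseShare_nonneg G (hφ 2) (hφ 3)) (noiseShare_le_one G (hφ 2) (hφ 3)) _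
  have hgY := relVar_block_bound G hκ hκ1 (hφ 0) (hφ 1) (ds := variances b 0) (dt := variances b 1)
    (hvar 0 ▸ hb1 0) (hvar 0 ▸ hb2 0) (hvar 1 ▸ hb1 1) (hvar 1 ▸ hb2 1) ω.2 (regY G φ ω.1 b)
  have hgM := relVar_block_bound G hκ hκ1 (hφ 2) (hφ 3) (ds := variances b 2) (dt := variances b 3)
    (hvar 2 ▸ hb1 2) (hvar 2 ▸ hb2 2) (hvar 3 ▸ hb1 3) (hvar 3 ▸ hb2 3) ω.1.2 (regM G φ ω.1.1 b)
  change gaussPart ω.2 (regY G φ ω.1 b) (relY G φ b) ≤ -(κ ^ 3 / 4) *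
    (∑ i, regY G φ ω.1 b i ^ 2 + 1 / 2 * ∑ i, relY G φ b i ^ 2) + _ at hgY
  change gaussPart ω.1.2 (regM G φ ω.1.1 b) (relM G φ b) ≤ -(κ ^ 3 / 4) *
    (∑ i, regM G φ ω.1.1 b i ^ 2 + 1 / 2 * ∑ i, relM G φ b i ^ 2) + _ at hgM
  have hgY' := hgY.trans (add_le_add_right hYlin _)
  have hgM' := hgM.trans (add_le_add_right hMlin _)
  have hnY := abs_le.1 (abs_sum_regY_sub_le S N hφ hi hB h6 b)
  have hnM := abs_le.1 (abs_sum_regM_sub_le S N hφ hi hB h6 b)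
  have eY0 := expY_nonneg G (S.covLaw N) φ b
  have eM0 := expM_nonneg G (S.covLaw N) φ b
  have rY0 : 0 ≤ ∑ i, relY G φ b i ^ 2 := Finset.sum_nonneg fun _ _ => sq_nonneg _
  have rM0 : 0 ≤ ∑ i, relM G φ b i ^ 2 := Finset.sum_nonneg fun _ _ => sq_nonneg _
  have hgauss : gaussPart ω.2 (regY G φ ω.1 b) (relY G φ b) +
      gaussPart ω.1.2 (regM G φ ω.1.1 b) (relM G φ b) ≤ -(κ ^ 3 / 8) * x ^ 2 + z * x := by
    have h1 : 1 / 2 * x ^ 2 ≤ ∑ i, regY G φ ω.1 b i ^ 2 + 1 / 2 * ∑ i, relY G φ b i ^ 2 +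
        (∑ i, regM G φ ω.1.1 b i ^ 2 + 1 / 2 * ∑ i, relM G φ b i ^ 2) := by
      rw [hx2]; linarith [hnY.1, hnM.1]
    have h2 : x * ∑ j, TY j + x * ∑ j, TM j ≤ z * x := by
      rw [← mul_add, mul_comm z]
      exact mul_le_mul_of_nonneg_left (by linarith) hx0
    have h3 := mul_le_mul_of_nonneg_left h1 (by positivity : 0 ≤ κ ^ 3 / 4)
    linarith
  -- the exposure block
  have hscore : ∀ τ : ℝ, 0 ≤ τ → bernScore A θ (linA ω.1.1.1 (τ • b₂)) ≤ τ * y * z := by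
    intro τ hτ
    have h := abs_linear_le hB (bernScoreL A θ (linA ω.1.1.1)) (τ • b₂)
    have h2 : infoNorm B (τ • b₂).ofLp = τ * y := by
      rw [WithLp.ofLp_smul, infoNorm_smul, abs_of_nonneg hτ]
    rw [h2] at h
    refine ((le_abs_self _).trans h).trans (mul_le_mul_of_nonneg_left ?_ (mul_nonneg hτ hy0))
    change ∑ j, TA j ≤ z
    linarith
  -- Inside the ball of radius `R` the two errors `1/4` leave at least half of the expected
  -- curvature, and the Taylor factor `1/2` makes it `1/4`.
  have hloc : ∀ τ : ℝ, 0 ≤ τ → τ * y ≤ R →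
      bernPart A θ (linA ω.1.1.1 (τ • b₂)) ≤ τ * y * z - 1 / 4 * (τ * y) ^ 2 := by
    intro τ hτ hτR
    obtain ⟨ξ, hξ, hT⟩ := bernPart_taylor A θ (linA ω.1.1.1 (τ • b₂))
    have hn : infoNorm B (ξ • (τ • b₂)).ofLp ≤ R := by
      rw [WithLp.ofLp_smul, WithLp.ofLp_smul, infoNorm_smul, infoNorm_smul, abs_of_nonneg hτ,
        abs_of_pos hξ.1]
      have : 0 ≤ τ * y := mul_nonneg hτ hy0
      change ξ * (τ * y) ≤ R
      nlinarith [hξ.2]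
    have h := abs_le.1 (abs_bernInfo_sub_le S N hφ hi hB (h7 _ hn).1 h6 (h7 _ hn).2 (τ • b))
    have e1 : linA ω.1.1.1 (τ • b) = linA ω.1.1.1 (τ • b₂) := by
      rw [map_smul, map_smul, linA_congr ω.1.1.1 (b := b₂) (c := b) rfl]
    have e2 : expA (S.covLaw N) φ (τ • b) = (τ * y) ^ 2 := by
      rw [mul_pow, hy2, expA, expA, ← integral_const_mul]
      congr 1
      funext C
      rw [map_smul, bernInfo, bernInfo, Finset.mul_sum]
      refine Finset.sum_congr rfl fun i _ => ?_
      simp only [Pi.smul_apply, smul_eq_mul]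
      ring
    rw [e1, e2, map_smul] at h
    rw [hT]
    linarith [h.1, hscore τ hτ]
  have hAeq : linA ω.1.1.1 b = linA ω.1.1.1 ((1 : ℝ) • b₂) := by
    rw [one_smul]; exact (linA_congr ω.1.1.1 rfl)
  have hLR := logLik_sub G hφ hb ω
  have hpos : 0 ≤ redLR G φ ω b := by rw [← hLR]; linarith
  rw [redLR] at hpos
  have hR4 : 4 ≤ R := by
    have : 0 ≤ 8 * z ^ 2 / κ ^ 3 := by positivity
    linarith
  -- The maximum of the parabola bounds what the Gaussian blocks can gain, whatever `x` is.
  have hquad : -(κ ^ 3 / 8) * x ^ 2 + z * x ≤ 2 * z ^ 2 / κ ^ 3 := by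
    rw [le_div_iff₀ hκ3]
    nlinarith [sq_nonneg (κ ^ 3 * x - 4 * z)]
  -- If `y > R`, scale back to the sphere of radius `R`: the local bound there and concavity make
  -- the exposure part at most `y(z - R/4)`. By the choice of `R` this outweighs the largest
  -- Gaussian gain, contradicting the larger likelihood.
  have hyR : y ≤ R := by
    by_contra hcon
    push Not at hcon
    have hyp : 0 < y := by linarith
    have hτ0 : 0 ≤ R / y := div_nonneg (by linarith) hy0
    have hτ1 : R / y ≤ 1 := (div_le_one hyp).2 hcon.le
    have hτy : R / y * y = R := div_mul_cancel₀ _ hyp.ne'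
    have h1 := hloc (R / y) hτ0 hτy.le
    rw [hτy] at h1
    have h2 := bernPart_smul_ge A θ (linA ω.1.1.1 b₂) hτ0 hτ1
    rw [← map_smul] at h2
    have h3 : bernPart A θ (linA ω.1.1.1 b₂) ≤ y * (z - R / 4) := by
      have h4 : R / y * bernPart A θ (linA ω.1.1.1 b₂) ≤ R / y * (y * (z - R / 4)) := by
        rw [← mul_assoc, hτy]
        have := h2.trans h1
        linarith
      exact le_of_mul_le_mul_left h4 (div_pos (by linarith) hyp)
    have h5 : z - R / 4 ≤ -(2 * z ^ 2 / κ ^ 3 + 1) := by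
      have : 8 * z ^ 2 / κ ^ 3 = 4 * (2 * z ^ 2 / κ ^ 3) := by ring
      linarith
    have h6' : y * (z - R / 4) ≤ -(2 * z ^ 2 / κ ^ 3 + 1) := by
      have h7' : 0 ≤ 2 * z ^ 2 / κ ^ 3 := by positivity
      nlinarith
    rw [hAeq, one_smul] at hpos
    linarith
  have hbern : bernPart A θ (linA ω.1.1.1 b) ≤ R * z := by
    rw [hAeq]
    have h1 := hloc 1 zero_le_one (by rwa [one_mul])
    rw [one_mul] at h1
    nlinarith [sq_nonneg y, mul_le_mul_of_nonneg_right hyR hz0]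
  have hfin : 0 ≤ -(κ ^ 3 / 8) * x ^ 2 + z * x + R * z := by linarith
  -- The exposure part now gains at most `Rz`. If `x > R`, then `Rz ≤ xz`, and the inequality
  -- reduces to `κ³x/8 ≤ 2z`.
  have hxb : x ≤ R + 16 * z / κ ^ 3 := by
    by_contra hcon
    push Not at hcon
    have h1 : 0 ≤ 16 * z / κ ^ 3 := by positivity
    have h2 : R * z ≤ x * z := mul_le_mul_of_nonneg_right (by linarith) hz0
    have h3 : 0 ≤ x * (2 * z - κ ^ 3 / 8 * x) := by nlinarith
    have hxpos : 0 < x := by linarith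
    have h4 : 0 ≤ 2 * z - κ ^ 3 / 8 * x := nonneg_of_mul_nonneg_right h3 hxpos
    have h5 : x ≤ 16 * z / κ ^ 3 := by
      rw [le_div_iff₀ hκ3]; linarith
    linarith
  calc infoNorm B b.ofLp = infoNorm B (b₁.ofLp + b₂.ofLp) := by
        rw [← WithLp.ofLp_add, ← hbsum]
    _ ≤ x + y := infoNorm_add_le _ _ _
    _ ≤ _ := by linarith

end

end

section

/-! ## Characteristic functions from moment generating functions -/

theorem summable_of_abs_mul_pow_le {a : ℕ → ℝ} {M R r : ℝ} (hR : 0 < R)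
    (ha : ∀ k, |a k| * R ^ k ≤ M) (hr0 : 0 ≤ r) (hrR : r < R) :
    (∀ k, |a k| * r ^ k ≤ M * (r / R) ^ k) ∧ Summable fun k => M * (r / R) ^ k := by
  refine ⟨fun k => ?_, ?_⟩
  · have h := mul_le_mul_of_nonneg_right (ha k) (pow_nonneg (div_nonneg hr0 hR.le) k)
    rwa [mul_assoc, ← mul_pow, mul_div_cancel₀ _ hR.ne'] at h
  · exact (summable_geometric_of_lt_one (div_nonneg hr0 hR.le) ((div_lt_one hR).2 hrR)).mul_left M

/-- Induction on `k`: at a small fixed `r`, subtract the lower terms, which tend to `0`, and divide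
by `r ^ k`. The tail is then of order `r` uniformly in `n`, because the coefficients obey a common
geometric bound. -/
theorem tendsto_coeff_zero {a : ℕ → ℕ → ℝ} {M R : ℝ} (hR : 0 < R)
    (ha : ∀ n k, |a n k| * R ^ k ≤ M)
    (h : ∀ r ∈ Set.Ioo 0 R, Tendsto (fun n => ∑' k, a n k * r ^ k) atTop (𝓝 0)) (k : ℕ) :
    Tendsto (fun n => a n k) atTop (𝓝 0) := by
  induction k using Nat.strong_induction_on with
  | _ k ih =>
    have hM : 0 ≤ M := (mul_nonneg (abs_nonneg _) (pow_nonneg hR.le 0)).trans (ha 0 0)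
    rw [Metric.tendsto_atTop]
    intro ε hε
    -- The tail after division by `r ^ k` is at most `2M r / R^(k+1)`; the requirement `r ≤ R/2`
    -- bounds its geometric series by the factor `2`.
    obtain ⟨r, hr0, hrR, hrε⟩ : ∃ r, 0 < r ∧ r ≤ R / 2 ∧ 2 * M / R ^ (k + 1) * r < ε / 2 := by
      have hc : 0 ≤ 2 * M / R ^ (k + 1) := by positivity
      refine ⟨min (R / 2) (ε / 2 / (2 * M / R ^ (k + 1) + 1)), by positivity,
        min_le_left _ _, ?_⟩
      calc _ ≤ 2 * M / R ^ (k + 1) * (ε / 2 / (2 * M / R ^ (k + 1) + 1)) :=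
            mul_le_mul_of_nonneg_left (min_le_right _ _) hc
        _ < (2 * M / R ^ (k + 1) + 1) * (ε / 2 / (2 * M / R ^ (k + 1) + 1)) :=
            mul_lt_mul_of_pos_right (by linarith) (by positivity)
        _ = ε / 2 := by field_simp
    have hrR' : r < R := by linarith
    have hG : Tendsto (fun n => (r ^ k)⁻¹ * (|∑' j, a n j * r ^ j| +
        ∑ j ∈ Finset.range k, |a n j| * r ^ j)) atTop (𝓝 0) := by
      have h1 := (h r ⟨hr0, hrR'⟩).abs
      have h2 : Tendsto (fun n => ∑ j ∈ Finset.range k, |a n j| * r ^ j) atTop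
          (𝓝 (∑ j ∈ Finset.range k, |(0 : ℝ)| * r ^ j)) :=
        tendsto_finsetSum _ fun j hj => ((ih j (Finset.mem_range.1 hj)).abs).mul_const _
      simpa using (h1.add h2).const_mul (r ^ k)⁻¹
    obtain ⟨n₀, hn₀⟩ := (Metric.tendsto_atTop.1 hG) (ε / 2) (by linarith)
    refine ⟨n₀, fun n hn => ?_⟩
    have h3 := hn₀ n hn
    rw [Real.dist_eq, sub_zero] at h3 ⊢
    have h3' := (le_abs_self _).trans_lt h3
    obtain ⟨hb, hs⟩ := summable_of_abs_mul_pow_le hR (ha n) hr0.le hrR'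
    have hsa : Summable fun j => a n j * r ^ j :=
      Summable.of_norm_bounded hs fun j => by
        rw [Real.norm_eq_abs, abs_mul, abs_of_pos (pow_pos hr0 j)]; exact hb j
    have hsplit := hsa.sum_add_tsum_nat_add (k + 1)
    rw [Finset.sum_range_succ] at hsplit
    have hq0 : 0 ≤ r / R := by positivity
    have hq1 : r / R < 1 := (div_lt_one hR).2 hrR'
    have htail : |∑' j, a n (j + (k + 1)) * r ^ (j + (k + 1))| ≤
        M * (r / R) ^ (k + 1) * 2 := by
      have hg : HasSum (fun j => M * (r / R) ^ (k + 1) * (r / R) ^ j)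
          (M * (r / R) ^ (k + 1) * (1 - r / R)⁻¹) :=
        (hasSum_geometric_of_lt_one hq0 hq1).mul_left _
      have hle : ‖∑' j, a n (j + (k + 1)) * r ^ (j + (k + 1))‖ ≤
          M * (r / R) ^ (k + 1) * (1 - r / R)⁻¹ := by
        refine tsum_of_norm_bounded hg fun j => ?_
        rw [Real.norm_eq_abs, abs_mul, abs_of_pos (pow_pos hr0 _), mul_assoc, ← pow_add,
          add_comm (k + 1) j]
        exact hb _
      refine hle.trans (mul_le_mul_of_nonneg_left ?_ (by positivity))
      rw [inv_le_comm₀ (by linarith) (by norm_num)]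
      have : r / R ≤ 1 / 2 := by rw [div_le_iff₀ hR]; linarith
      linarith
    have hsum : |∑ j ∈ Finset.range k, a n j * r ^ j| ≤ ∑ j ∈ Finset.range k, |a n j| * r ^ j := by
      refine (Finset.abs_sum_le_sum_abs _ _).trans (le_of_eq (Finset.sum_congr rfl fun j _ => ?_))
      rw [abs_mul, abs_of_pos (pow_pos hr0 j)]
    have hk : |a n k| * r ^ k ≤ |∑' j, a n j * r ^ j| +
        ∑ j ∈ Finset.range k, |a n j| * r ^ j + M * (r / R) ^ (k + 1) * 2 := by
      rw [show |a n k| * r ^ k = |a n k * r ^ k| by rw [abs_mul, abs_of_pos (pow_pos hr0 k)]]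
      have : a n k * r ^ k = ∑' j, a n j * r ^ j - ∑ j ∈ Finset.range k, a n j * r ^ j -
          ∑' j, a n (j + (k + 1)) * r ^ (j + (k + 1)) := by linarith
      rw [this]
      refine (abs_sub _ _).trans (add_le_add ((abs_sub _ _).trans (add_le_add le_rfl hsum)) htail)
    have hk2 : |a n k| ≤ (r ^ k)⁻¹ * (|∑' j, a n j * r ^ j| +
        ∑ j ∈ Finset.range k, |a n j| * r ^ j) + 2 * M / R ^ (k + 1) * r := by
      rw [← le_div_iff₀ (pow_pos hr0 k)] at hk
      refine hk.trans (le_of_eq ?_)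
      rw [div_pow]
      field_simp
      ring
    linarith

/-- The Taylor coefficients of the moment generating function. -/
def momentCoeff (μ : Measure ℝ) (k : ℕ) : ℝ := ∫ x, x ^ k / k.factorial ∂μ

section

variable {μ : Measure ℝ} {R : ℝ} (hR : 0 ≤ R) (h1 : Integrable (fun x => Real.exp (R * x)) μ)
  (h2 : Integrable (fun x => Real.exp (-R * x)) μ)

-- Pointwise, `(R|x|)^k / k! ≤ exp(R|x|) ≤ exp(Rx) + exp(-Rx)`.
include hR h1 h2 in
theorem abs_momentCoeff_mul_pow_le (k : ℕ) :
    |momentCoeff μ k| * R ^ k ≤ ∫ x, Real.exp (R * x) ∂μ + ∫ x, Real.exp (-R * x) ∂μ := by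
  have hint := integrable_exp_mul_abs h1 h2
  calc |momentCoeff μ k| * R ^ k = |∫ x, x ^ k / k.factorial * R ^ k ∂μ| := by
        rw [integral_mul_const, abs_mul, abs_of_nonneg (pow_nonneg hR k), momentCoeff]
    _ ≤ ∫ x, Real.exp (R * |x|) ∂μ := by
        refine abs_integral_le_integral_abs.trans
          (integral_mono_of_nonneg (Eventually.of_forall fun _ => abs_nonneg _) hint
          (Eventually.of_forall fun x => ?_))
        have h := Real.pow_div_factorial_le_exp (R * |x|) (by positivity) k
        refine le_trans (le_of_eq ?_) h
        simp only [abs_mul, abs_div, abs_pow, abs_of_nonneg hR, Nat.abs_cast, mul_pow]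
        ring
    _ ≤ ∫ x, (Real.exp (R * x) + Real.exp (-R * x)) ∂μ := by
        refine integral_mono hint (h1.add h2) fun x => ?_
        rcases abs_cases x with ⟨h, _⟩ | ⟨h, _⟩
        · simp only [h]; linarith [Real.exp_pos (-R * x)]
        · have : R * -x = -R * x := by ring
          simp only [h, this]; linarith [Real.exp_pos (R * x)]
    _ = _ := integral_add h1 h2

-- The exponential series is integrated termwise under the dominating function `exp(R|x|)`. Real `z`
-- gives the moment generating function and imaginary `z` the characteristic function, so both have
-- the same coefficients.
include h1 h2 in
theorem hasSum_momentCoeff {z : ℂ} (hz : ‖z‖ ≤ R) :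
    HasSum (fun k => (momentCoeff μ k : ℂ) * z ^ k) (∫ x : ℝ, Complex.exp (z * x) ∂μ) := by
  have hint := integrable_exp_mul_abs h1 h2
  have hcoef : ∀ k, (momentCoeff μ k : ℂ) * z ^ k =
      ∫ x : ℝ, (z * x) ^ k / (k.factorial : ℂ) ∂μ := by
    intro k
    rw [momentCoeff, ← integral_complex_ofReal, ← integral_mul_const]
    congr 1
    funext x
    push_cast
    ring
  simp_rw [hcoef]
  have hexp : ∀ y : ℝ, HasSum (fun k : ℕ => y ^ k / (k.factorial : ℝ)) (Real.exp y) := fun y => by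
    rw [Real.exp_eq_exp_ℝ]; exact NormedSpace.expSeries_div_hasSum_exp y
  refine hasSum_integral_of_dominated_convergence
    (fun k x => (R * |x|) ^ k / (k.factorial : ℝ)) (fun k => ?_) (fun k => ?_) ?_ ?_ ?_
  · exact Measurable.aestronglyMeasurable (by fun_prop)
  · refine Eventually.of_forall fun x => ?_
    rw [norm_div, norm_pow, norm_mul, Complex.norm_real, Complex.norm_natCast, Real.norm_eq_abs]
    gcongr
  · exact Eventually.of_forall fun x => (hexp _).summable
  · simp_rw [fun x : ℝ => (hexp (R * |x|)).tsum_eq]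
    exact hint
  · refine Eventually.of_forall fun x => ?_
    rw [Complex.exp_eq_exp_ℂ]
    exact NormedSpace.expSeries_div_hasSum_exp (z * (x : ℂ))

include h1 h2 in
theorem hasSum_momentCoeff_real {r : ℝ} (hr : |r| ≤ R) :
    HasSum (fun k => momentCoeff μ k * r ^ k) (∫ x : ℝ, Real.exp (r * x) ∂μ) := by
  have h := hasSum_momentCoeff h1 h2 (z := (r : ℂ))
    (by rwa [Complex.norm_real, Real.norm_eq_abs])
  have e : ∫ x : ℝ, Complex.exp ((r : ℂ) * x) ∂μ = ((∫ x : ℝ, Real.exp (r * x) ∂μ : ℝ) : ℂ) := by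
    rw [← integral_complex_ofReal]
    congr 1; funext x; push_cast; rfl
  rw [e] at h
  rw [← Complex.hasSum_ofReal]
  convert! h using 2
  push_cast; rfl

end

/-- A law whose moment generating function is close to that of a centred Gaussian law of variance
at most `1` on a long interval has its characteristic function close to the Gaussian one. -/
theorem exists_charFun_close (t : ℝ) {ε : ℝ} (hε : 0 < ε) :
    ∃ R > 0, ∃ η > 0, ∀ (μ : Measure ℝ) [IsProbabilityMeasure μ] (v : ℝ), 0 ≤ v → v ≤ 1 →
      (∀ r, |r| ≤ R → Integrable (fun x => Real.exp (r * x)) μ ∧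
        |∫ x, Real.exp (r * x) ∂μ - Real.exp (r ^ 2 * v / 2)| ≤ η) →
      ‖charFun μ t - Complex.exp (-((t ^ 2 * v / 2 : ℝ) : ℂ))‖ ≤ ε := by
  -- The point `it` must lie strictly inside the disc where the coefficients are controlled.
  set R := |t| + 1 with hRdef
  have hR : 0 < R := by positivity
  refine ⟨R, hR, ?_⟩
  -- A compactness argument: counterexamples with error `1/(n+1)` give a sequence of laws whose
  -- coefficient differences from the Gaussian ones tend to `0`. Dominated convergence of the series
  -- at `it` contradicts the gap `ε`.
  by_contra hcon
  push Not at hcon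
  choose μ hμ v hv0 hv1 hμv hε' using fun n : ℕ => hcon (1 / ((n : ℝ) + 1)) (by positivity)
  set γ : ℕ → Measure ℝ := fun n => gaussianReal 0 (v n).toNNReal with hγ
  have hvc : ∀ n, ((v n).toNNReal : ℝ) = v n := fun n => Real.coe_toNNReal _ (hv0 n)
  have gint : ∀ n r, Integrable (fun x => Real.exp (r * x)) (γ n) := fun n r =>
    integrable_exp_mul_gaussianReal r
  have gmgf : ∀ n r, ∫ x, Real.exp (r * x) ∂(γ n) = Real.exp (r ^ 2 * v n / 2) := by
    intro n r
    have := mgf_gaussianReal (p := γ n) (X := id) (μ := 0) (v := (v n).toNNReal)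
      (by rw [Measure.map_id]) r
    rw [mgf] at this
    simp only [id] at this
    rw [this, hvc]; congr 1; ring
  have habsR : |R| ≤ R := (abs_of_pos hR).le
  have habsR' : |-R| ≤ R := by rw [abs_neg]; exact habsR
  set M := 4 * Real.exp (R ^ 2 / 2) + 2 with hM
  set a : ℕ → ℕ → ℝ := fun n k => momentCoeff (μ n) k - momentCoeff (γ n) k with ha
  have hbound : ∀ n k, |a n k| * R ^ k ≤ M := by
    intro n k
    have b1 := abs_momentCoeff_mul_pow_le hR.le (hμv n R habsR).1 (hμv n (-R) habsR').1 k
    have b2 := abs_momentCoeff_mul_pow_le hR.le (gint n R) (gint n (-R)) k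
    have c1 := abs_le.1 (hμv n R habsR).2
    have c2 := abs_le.1 (hμv n (-R) habsR').2
    rw [gmgf, gmgf] at b2
    rw [neg_sq] at b2 c2
    have hle : Real.exp (R ^ 2 * v n / 2) ≤ Real.exp (R ^ 2 / 2) := by
      apply Real.exp_le_exp.2
      have := mul_le_mul_of_nonneg_left (hv1 n) (sq_nonneg R)
      linarith
    have hn : 1 / ((n : ℝ) + 1) ≤ 1 := by
      rw [div_le_one (by positivity)]; linarith [Nat.cast_nonneg (α := ℝ) n]
    have := mul_le_mul_of_nonneg_right (abs_sub (momentCoeff (μ n) k) (momentCoeff (γ n) k))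
      (pow_nonneg hR.le k)
    rw [add_mul] at this
    linarith [c1.2, c2.2]
  have hzero : ∀ r ∈ Set.Ioo 0 R, Tendsto (fun n => ∑' k, a n k * r ^ k) atTop (𝓝 0) := by
    intro r hr
    have hrR : |r| ≤ R := by rw [abs_of_pos hr.1]; exact hr.2.le
    refine squeeze_zero_norm (fun n => ?_) (tendsto_one_div_add_atTop_nhds_zero_nat (𝕜 := ℝ))
    have s1 := hasSum_momentCoeff_real (hμv n R habsR).1 (hμv n (-R) habsR').1 hrR
    have s2 := hasSum_momentCoeff_real (gint n R) (gint n (-R)) hrR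
    have s3 := s1.sub s2
    simp_rw [← sub_mul] at s3
    rw [s3.tsum_eq, gmgf, Real.norm_eq_abs]
    exact (hμv n r hrR).2
  have hcoeff := tendsto_coeff_zero hR hbound hzero
  have ht : ‖(t : ℂ) * Complex.I‖ = |t| := by simp
  have htR : |t| < R := by linarith
  have hlim : Tendsto (fun n => ∑' k, (a n k : ℂ) * ((t : ℂ) * Complex.I) ^ k) atTop (𝓝 0) := by
    have hs := (summable_of_abs_mul_pow_le hR (hbound 0) (abs_nonneg t) htR).2
    have := tendsto_tsum_of_dominated_convergence (𝓕 := atTop)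
      (f := fun n k => (a n k : ℂ) * ((t : ℂ) * Complex.I) ^ k) (g := fun _ => 0) hs
      (fun k => by
        have h := (Complex.continuous_ofReal.tendsto 0).comp (hcoeff k)
        simpa [Function.comp_def] using h.mul_const (((t : ℂ) * Complex.I) ^ k))
      (Eventually.of_forall fun n k => by
        rw [norm_mul, norm_pow, ht, Complex.norm_real, Real.norm_eq_abs]
        exact (summable_of_abs_mul_pow_le hR (hbound n) (abs_nonneg t) htR).1 k)
    simpa using this
  obtain ⟨n, hn⟩ := (Metric.tendsto_atTop.1 hlim) ε hε
  have hn := hn n le_rfl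
  rw [dist_zero_right] at hn
  have s1 := hasSum_momentCoeff (hμv n R habsR).1 (hμv n (-R) habsR').1
    (ht.le.trans htR.le)
  have s2 := hasSum_momentCoeff (gint n R) (gint n (-R)) (ht.le.trans htR.le)
  have s3 := s1.sub s2
  simp_rw [← sub_mul, ← Complex.ofReal_sub] at s3
  rw [s3.tsum_eq] at hn
  have ecf : ∀ ν : Measure ℝ, ∫ x : ℝ, Complex.exp ((t : ℂ) * Complex.I * x) ∂ν =
      charFun ν t := fun ν => by
    rw [charFun_apply_real]; congr 1; funext x; congr 1; ring
  rw [ecf, ecf, hγ, charFun_gaussianReal, hvc] at hn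
  refine absurd hn (not_lt.2 ((hε' n).le.trans (le_of_eq ?_)))
  congr 2
  push_cast
  congr 1
  ring

end

section

variable {p N : ℕ}

/-! ## Characteristic functions of the score blocks -/

/-- A complex Gaussian integral with quadratic coefficient `-u/2`, `u = 1 - ity`. The result is
written as one exponential so that products over coordinates become sums of logarithms. -/
theorem integral_cexp_gaussScore_summand (t x y : ℝ) :
    ∫ w : ℝ, Complex.exp (((t * (x * w + 1 / 2 * y * (w ^ 2 - 1)) : ℝ) : ℂ) * Complex.I)
      ∂(gaussianReal 0 1) =
    Complex.exp (-(1 / 2) * Complex.log (1 + (-(t * y : ℝ) * Complex.I)) -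
      (t * y : ℝ) * Complex.I / 2 - (t * x : ℝ) ^ 2 / (2 * (1 + (-(t * y : ℝ) * Complex.I)))) := by
  set u : ℂ := 1 + (-(t * y : ℝ) * Complex.I) with hu
  have hure : u.re = 1 := by simp [hu]
  have hu0 : u ≠ 0 := fun h => by rw [h] at hure; simp at hure
  have hb : (-u / 2).re < 0 := by
    rw [show -u / 2 = -(u / 2) by ring, Complex.neg_re, Complex.div_ofNat_re, hure]; norm_num
  rw [integral_gaussianReal_eq_integral_smul (by norm_num)]
  have h1 : ∀ w : ℝ, gaussianPDFReal 0 1 w •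
      Complex.exp (((t * (x * w + 1 / 2 * y * (w ^ 2 - 1)) : ℝ) : ℂ) * Complex.I) =
      ((Real.sqrt (2 * Real.pi))⁻¹ : ℝ) * Complex.exp (-u / 2 * (w : ℂ) ^ 2 +
        ((t * x : ℝ) * Complex.I) * (w : ℂ) + -((t * y : ℝ) * Complex.I / 2)) := by
    intro w
    rw [gaussianPDFReal_def, Complex.real_smul]
    push_cast
    rw [mul_assoc, ← Complex.exp_add]
    congr 2
    · simp
    · rw [hu]; push_cast; ring
  simp_rw [h1]
  rw [integral_const_mul, integral_cexp_quadratic hb]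
  have hsq : ((Real.sqrt (2 * Real.pi))⁻¹ : ℝ) = Real.exp (-(1 / 2) * Real.log (2 * Real.pi)) := by
    rw [neg_mul, Real.exp_neg, mul_comm (1 / 2 : ℝ),
      ← Real.rpow_def_of_pos (by positivity : (0 : ℝ) < 2 * Real.pi), Real.sqrt_eq_rpow]
  -- Since `u` has real part one, its argument is not `π`, so `log u⁻¹ = -log u` for the principal
  -- branch.
  have hcp : (Real.pi / -(-u / 2) : ℂ) ^ (1 / 2 : ℂ) =
      Complex.exp ((1 / 2) * (Real.log (2 * Real.pi) : ℂ) - 1 / 2 * Complex.log u) := by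
    have e : (Real.pi / -(-u / 2) : ℂ) = ((2 * Real.pi : ℝ) : ℂ) * u⁻¹ := by
      push_cast; field_simp
    rw [e, Complex.cpow_def_of_ne_zero (by
      refine mul_ne_zero ?_ (inv_ne_zero hu0)
      exact_mod_cast (by positivity : (2 * Real.pi : ℝ) ≠ 0)),
      Complex.log_ofReal_mul (by positivity) (inv_ne_zero hu0), Complex.log_inv]
    · congr 1; ring
    · intro h
      rw [Complex.arg_eq_pi_iff, hure] at h
      linarith [h.1]
  rw [hsq, hcp, Complex.ofReal_exp, ← Complex.exp_add, ← Complex.exp_add]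
  congr 1
  field_simp
  push_cast
  ring_nf
  rw [Complex.I_sq]
  ring

/-- Second-order Taylor expansion of the logarithm at `-iy`; its linear term cancels with `iy/2`,
the contribution of the centring in `w² - 1`. -/
theorem norm_log_add_le {y : ℝ} (hy : |y| ≤ 1 / 2) :
    ‖-(1 / 2) * Complex.log (1 + (-(y : ℝ) * Complex.I)) - (y : ℝ) * Complex.I / 2 +
      (y : ℂ) ^ 2 / 4‖ ≤ |y| ^ 3 := by
  set z : ℂ := -(y : ℝ) * Complex.I with hz
  have hzn : ‖z‖ = |y| := by simp [hz]
  have h := Complex.norm_log_sub_logTaylor_le 2 (z := z) (by rw [hzn]; linarith)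
  have e : Complex.logTaylor 3 z = z - z ^ 2 / 2 := by
    simp [Complex.logTaylor_succ, Complex.logTaylor_zero]
    ring
  rw [e, hzn] at h
  have e2 : -(1 / 2) * Complex.log (1 + z) - (y : ℝ) * Complex.I / 2 + (y : ℂ) ^ 2 / 4 =
      -(1 / 2) * (Complex.log (1 + z) - (z - z ^ 2 / 2)) := by
    have : z ^ 2 = -(y : ℂ) ^ 2 := by
      rw [hz, mul_pow, Complex.I_sq]; ring
    rw [this]
    simp only [hz]
    ring
  rw [e2, norm_mul]
  have h2 : (1 - |y|)⁻¹ ≤ 2 := by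
    rw [inv_le_comm₀ (by linarith) (by norm_num)]; linarith
  have h3 : |y| ^ 3 * (1 - |y|)⁻¹ ≤ |y| ^ 3 * 2 :=
    mul_le_mul_of_nonneg_left h2 (by positivity)
  have h4 : ‖(-(1 / 2) : ℂ)‖ = 1 / 2 := by norm_num
  rw [h4]
  have h5 : 0 ≤ |y| ^ 3 := by positivity
  norm_num at h
  linarith

theorem norm_div_sub_le (x y : ℝ) :
    ‖(x : ℂ) ^ 2 / (2 * (1 + (-(y : ℝ) * Complex.I))) - (x : ℂ) ^ 2 / 2‖ ≤ x ^ 2 * |y| := by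
  set u : ℂ := 1 + (-(y : ℝ) * Complex.I) with hu
  have hure : u.re = 1 := by simp [hu]
  have hu0 : u ≠ 0 := fun h => by rw [h] at hure; simp at hure
  have hun : 1 ≤ ‖u‖ := by
    have := Complex.abs_re_le_norm u; rw [hure] at this; simpa using this
  have e : (x : ℂ) ^ 2 / (2 * u) - (x : ℂ) ^ 2 / 2 =
      ((x ^ 2 * (1 / 2) : ℝ) : ℂ) * ((y : ℂ) * Complex.I / u) := by
    field_simp
    rw [hu]
    push_cast
    ring
  rw [e, norm_mul, norm_div, norm_mul, Complex.norm_I, mul_one, Complex.norm_real,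
    Complex.norm_real, Real.norm_eq_abs, Real.norm_eq_abs, abs_of_nonneg (by positivity)]
  have : |y| / ‖u‖ ≤ |y| := div_le_self (abs_nonneg _) hun
  nlinarith [sq_nonneg x, abs_nonneg y, mul_le_mul_of_nonneg_left this (sq_nonneg x)]

/-- The characteristic function of the score of a Gaussian block is close to that of a Gaussian
law if all relative variances are small. -/
theorem norm_integral_gaussScore_sub_le (t m : ℝ) (X y : Fin N → ℝ) (hy : ∀ i, |y i| ≤ m)
    (hm : |t| * m ≤ 1 / 2)
    (hV : |t| ^ 3 * m * (∑ i, X i ^ 2 + 1 / 2 * ∑ i, y i ^ 2) * 2 ≤ 1) :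
    ‖∫ w, Complex.exp (((t * gaussScore w X y : ℝ) : ℂ) * Complex.I) ∂(iidGaussian N 1) -
      Complex.exp (-((t ^ 2 * (∑ i, X i ^ 2 + 1 / 2 * ∑ i, y i ^ 2) / 2 : ℝ) : ℂ))‖ ≤
      4 * (|t| ^ 3 * m * (∑ i, X i ^ 2 + 1 / 2 * ∑ i, y i ^ 2)) := by
  set V := ∑ i, X i ^ 2 + 1 / 2 * ∑ i, y i ^ 2 with hVdef
  have hm0 : ∀ i, |t * y i| ≤ |t| * m := fun i => by
    rw [abs_mul]; exact mul_le_mul_of_nonneg_left (hy i) (abs_nonneg t)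
  have hprod : ∀ w : Fin N → ℝ, Complex.exp (((t * gaussScore w X y : ℝ) : ℂ) * Complex.I) =
      ∏ i, Complex.exp (((t * (X i * w i + 1 / 2 * y i * (w i ^ 2 - 1)) : ℝ) : ℂ) *
        Complex.I) := fun w => by
    rw [← Complex.exp_sum, gaussScore, Finset.mul_sum, Complex.ofReal_sum, Finset.sum_mul]
  simp_rw [hprod]
  rw [toNNReal_one_gaussian, integral_fintype_prod_eq_prod
    (f := fun i (w : ℝ) => Complex.exp (((t * (X i * w + 1 / 2 * y i * (w ^ 2 - 1)) : ℝ) : ℂ) *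
        Complex.I))]
  simp_rw [integral_cexp_gaussScore_summand]
  rw [← Complex.exp_sum]
  set a : Fin N → ℂ := fun i => -(1 / 2) * Complex.log (1 + (-(t * y i : ℝ) * Complex.I)) -
      (t * y i : ℝ) * Complex.I / 2 -
      (t * X i : ℝ) ^ 2 / (2 * (1 + (-(t * y i : ℝ) * Complex.I))) with ha
  have hV' : (-((t ^ 2 * V / 2 : ℝ) : ℂ)) =
      ∑ i, (-((t * y i : ℝ) : ℂ) ^ 2 / 4 - ((t * X i : ℝ) : ℂ) ^ 2 / 2) := by
    rw [hVdef]
    push_cast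
    rw [Finset.sum_sub_distrib, ← Finset.sum_div, ← Finset.sum_div, mul_add, add_div]
    simp_rw [mul_pow, Finset.sum_neg_distrib, ← Finset.mul_sum]
    ring
  -- The error carries the factor `|y i| ≤ m` on both `X i ^ 2` and `y i ^ 2`. No single `X i` need
  -- be small, because the part linear in the noise is exactly Gaussian.
  have hterm : ∀ i, ‖a i - (-((t * y i : ℝ) : ℂ) ^ 2 / 4 - ((t * X i : ℝ) : ℂ) ^ 2 / 2)‖ ≤
      |t| ^ 3 * m * (X i ^ 2 + y i ^ 2) := by
    intro i
    have h1 := norm_log_add_le ((hm0 i).trans hm)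
    have h2 := norm_div_sub_le (t * X i) (t * y i)
    have e : a i - (-((t * y i : ℝ) : ℂ) ^ 2 / 4 - ((t * X i : ℝ) : ℂ) ^ 2 / 2) =
        (-(1 / 2) * Complex.log (1 + (-(t * y i : ℝ) * Complex.I)) -
          (t * y i : ℝ) * Complex.I / 2 + ((t * y i : ℝ) : ℂ) ^ 2 / 4) -
        (((t * X i : ℝ) : ℂ) ^ 2 / (2 * (1 + (-(t * y i : ℝ) * Complex.I))) -
          ((t * X i : ℝ) : ℂ) ^ 2 / 2) := by
      simp only [ha]; ring
    rw [e]
    refine (norm_sub_le _ _).trans ((add_le_add h1 h2).trans ?_)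
    have e2 : |t * y i| ^ 3 + (t * X i) ^ 2 * |t * y i| =
        |t| ^ 3 * |y i| * (X i ^ 2 + y i ^ 2) := by
      rw [mul_pow, ← sq_abs t, ← sq_abs (y i), abs_mul]; ring
    rw [e2]
    refine mul_le_mul_of_nonneg_right ?_ (by positivity)
    exact mul_le_mul_of_nonneg_left (hy i) (by positivity)
  -- With no coordinates the bound on `y` says nothing about the sign of `m`, but then `V = 0`.
  have hV0 : 0 ≤ |t| ^ 3 * m * V := by
    rcases Nat.eq_zero_or_pos N with h | h
    · subst h; simp [hVdef]
    · have : 0 ≤ m := (abs_nonneg _).trans (hy ⟨0, h⟩)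
      have : 0 ≤ V := by positivity
      positivity
  have hd : ‖∑ i, a i - -((t ^ 2 * V / 2 : ℝ) : ℂ)‖ ≤ 2 * (|t| ^ 3 * m * V) := by
    rw [hV', ← Finset.sum_sub_distrib]
    refine (norm_sum_le _ _).trans ((Finset.sum_le_sum fun i _ => hterm i).trans ?_)
    rw [← Finset.mul_sum, Finset.sum_add_distrib]
    rcases Nat.eq_zero_or_pos N with h | h
    · subst h; simp [hVdef]
    · have hm' : 0 ≤ m := (abs_nonneg _).trans (hy ⟨0, h⟩)
      have hk : 0 ≤ |t| ^ 3 * m := by positivity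
      have hx0 : 0 ≤ ∑ i, X i ^ 2 := by positivity
      have := mul_nonneg hk hx0
      rw [hVdef]
      linarith [mul_add (|t| ^ 3 * m) (∑ i, X i ^ 2) (∑ i, y i ^ 2),
        mul_add (|t| ^ 3 * m) (∑ i, X i ^ 2) (1 / 2 * ∑ i, y i ^ 2)]
  have hfin : Complex.exp (∑ i, a i) - Complex.exp (-((t ^ 2 * V / 2 : ℝ) : ℂ)) =
      Complex.exp (-((t ^ 2 * V / 2 : ℝ) : ℂ)) *
        (Complex.exp (∑ i, a i - -((t ^ 2 * V / 2 : ℝ) : ℂ)) - 1) := by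
    rw [mul_sub, ← Complex.exp_add]; congr 2 <;> ring
  rw [hfin, norm_mul]
  have h1 : ‖Complex.exp (-((t ^ 2 * V / 2 : ℝ) : ℂ))‖ ≤ 1 := by
    rw [Complex.norm_exp, Complex.neg_re, Complex.ofReal_re, Real.exp_le_one_iff, neg_nonpos]
    positivity
  have h2 := Complex.norm_exp_sub_one_le (hd.trans (by linarith))
  calc _ ≤ 1 * (2 * (2 * (|t| ^ 3 * m * V))) :=
        mul_le_mul h1 (h2.trans (mul_le_mul_of_nonneg_left hd zero_le_two)) (norm_nonneg _)
          zero_le_one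
    _ = _ := by ring

/-- The log moment generating function of a centred Bernoulli variable is the Taylor remainder of
`log(1 + exp)` at its logit. The Lagrange form thus gives a Gaussian moment generating function with
the variance taken at an intermediate predictor. -/
theorem integral_exp_bernScore (φ c : Param p) (C : Cov p N) (r : ℝ) :
    Integrable (fun U => Real.exp (r * bernScore (expo φ (C, U)) (linA C φ) (linA C c)))
      (Measure.pi fun _ => (volume : Measure unitInterval)) ∧
    ∃ ξ : ℝ, |ξ| ≤ |r| ∧
    ∫ U, Real.exp (r * bernScore (expo φ (C, U)) (linA C φ) (linA C c))
      ∂(Measure.pi fun _ => (volume : Measure unitInterval)) =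
      Real.exp (r ^ 2 * bernInfo (linA C φ + ξ • linA C c) (linA C c) / 2) := by
  set θ := linA C φ
  set η := linA C c
  set F : Fin N → ℝ → ℝ := fun i a => Real.exp (r * ((a - sig (θ i)) * η i)) with hF
  have hB : ∀ i, _ := fun i => integral_bernoulli (sig_pos (θ i)).le (sig_lt_one (θ i)).le (F i)
  have hexp : (fun U : Fin N → unitInterval => Real.exp (r * bernScore (expo φ (C, U)) θ η)) =
      fun U => ∏ i, F i (if (U i : ℝ) ≤ sig (θ i) then 1 else 0) := by
    funext U
    rw [bernScore, Finset.mul_sum, Real.exp_sum]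
    rfl
  rw [hexp]
  refine ⟨Integrable.fintype_prod_dep fun i => (hB i).1, ?_⟩
  -- The difference of `bernPart` and `bernScore` does not depend on the exposures, so they are set
  -- to `0`.
  obtain ⟨ξ, hξ, hT⟩ := bernPart_taylor 0 θ (r • η)
  refine ⟨ξ * r, ?_, ?_⟩
  · rw [abs_mul, abs_of_pos hξ.1]
    exact mul_le_of_le_one_left (abs_nonneg r) hξ.2.le
  rw [integral_fintype_prod_eq_prod
    (f := fun i (u : unitInterval) => F i (if (u : ℝ) ≤ sig (θ i) then 1 else 0))]
  simp_rw [fun i => (hB i).2]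
  have hterm : ∀ i, sig (θ i) * F i 1 + (1 - sig (θ i)) * F i 0 =
      Real.exp (-((0 : Fin N → ℝ) i * (r • η) i - Real.log (1 + Real.exp (θ i + (r • η) i)) +
        Real.log (1 + Real.exp (θ i))) + ((0 : Fin N → ℝ) i - sig (θ i)) * (r • η) i) := by
    intro i
    have p1 : 0 < 1 + Real.exp (θ i) := by positivity
    have p2 : 0 < 1 + Real.exp (θ i + r * η i) := by positivity
    simp only [hF, Pi.zero_apply, Pi.smul_apply, smul_eq_mul, zero_mul, zero_sub]
    have e1 : Real.exp (r * ((1 - sig (θ i)) * η i)) =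
        Real.exp (r * η i) * Real.exp (-sig (θ i) * (r * η i)) := by
      rw [← Real.exp_add]; congr 1; ring
    have e2 : r * (-sig (θ i) * η i) = -sig (θ i) * (r * η i) := by ring
    rw [e1, e2, one_sub_sig, Real.exp_add, neg_add, neg_neg, Real.exp_add, Real.exp_log p2, Real.exp_neg,
      Real.exp_log p1]
    rw [show sig (θ i) * (Real.exp (r * η i) * Real.exp (-sig (θ i) * (r * η i))) =
      (Real.exp (θ i) * Real.exp (r * η i)) / (1 + Real.exp (θ i)) *
        Real.exp (-sig (θ i) * (r * η i)) by rw [show sig (θ i) = _ from rfl, sig]; ring,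
      ← Real.exp_add]
    field_simp
    ring
  simp_rw [hterm]
  rw [← Real.exp_sum, Finset.sum_add_distrib, Finset.sum_neg_distrib]
  change Real.exp (-bernPart 0 θ (r • η) + bernScore 0 θ (r • η)) = _
  rw [hT, smul_smul]
  congr 1
  rw [bernInfo, bernInfo, Finset.mul_sum, Finset.mul_sum, Finset.sum_div, neg_sub, sub_add_cancel]
  refine Finset.sum_congr rfl fun i _ => ?_
  simp only [Pi.smul_apply, smul_eq_mul]
  ring

/-- The characteristic function of the score of the exposure block is close to that of a Gaussian
law if the information is locally nearly constant. -/
theorem exists_bernScore_close (p : ℕ) (t : ℝ) {ε : ℝ} (hε : 0 < ε) :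
    ∃ R > 0, ∃ η > 0, ∀ (N : ℕ) (φ c : Param p) (C : Cov p N) (v : ℝ), 0 ≤ v → v ≤ 1 →
      (∀ ξ : ℝ, |ξ| ≤ R → |bernInfo (linA C φ + ξ • linA C c) (linA C c) - v| ≤ η) →
      ‖∫ U, Complex.exp (((t * bernScore (expo φ (C, U)) (linA C φ) (linA C c) : ℝ) : ℂ) *
          Complex.I) ∂(Measure.pi fun _ => (volume : Measure unitInterval)) -
        Complex.exp (-((t ^ 2 * v / 2 : ℝ) : ℂ))‖ ≤ ε := by
  obtain ⟨R, hR, η, hη, h⟩ := exists_charFun_close t hε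
  set K := Real.exp (R ^ 2 / 2) * R ^ 2 with hK
  have hK0 : 0 < K := by positivity
  -- The first threshold keeps the exponent difference below one, where `|exp x - 1| ≤ 2|x|`; the
  -- second makes the resulting bound at most `η`.
  refine ⟨R, hR, min (2 / R ^ 2) (η / K), by positivity, ?_⟩
  intro N φ c C v hv0 hv1 hq
  set T : (Fin N → unitInterval) → ℝ := fun U =>
    bernScore (expo φ (C, U)) (linA C φ) (linA C c) with hT
  have hTm : Measurable T := (measurable_bernScore φ c).comp measurable_prodMk_left
  set P : Measure (Fin N → unitInterval) := Measure.pi fun _ => volume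
  have : IsProbabilityMeasure (P.map T) := Measure.isProbabilityMeasure_map hTm.aemeasurable
  have hcf := h (P.map T) v hv0 hv1 fun r hr => ?_
  · rw [charFun_apply_real, integral_map hTm.aemeasurable
      (Measurable.aestronglyMeasurable (by fun_prop))] at hcf
    simp_rw [← Complex.ofReal_mul] at hcf
    exact hcf
  · obtain ⟨hi, ξ, hξ, he⟩ := integral_exp_bernScore φ c C r
    have hme : Measurable fun x : ℝ => Real.exp (r * x) := by fun_prop
    rw [integrable_map_measure hme.aestronglyMeasurable hTm.aemeasurable,
      integral_map hTm.aemeasurable hme.aestronglyMeasurable]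
    refine ⟨hi, ?_⟩
    rw [he]
    set q := bernInfo (linA C φ + ξ • linA C c) (linA C c)
    have hqv := hq ξ (hξ.trans hr)
    have hr2 : r ^ 2 ≤ R ^ 2 := by rw [← sq_abs r]; exact pow_le_pow_left₀ (abs_nonneg r) hr 2
    have hx : |r ^ 2 * (q - v) / 2| ≤ R ^ 2 * |q - v| / 2 := by
      rw [abs_div, abs_mul, abs_of_nonneg (sq_nonneg r), abs_two]
      gcongr
    have hx1 : R ^ 2 * |q - v| / 2 ≤ 1 := by
      have := mul_le_mul_of_nonneg_left (hqv.trans (min_le_left _ _)) (sq_nonneg R)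
      rw [mul_div_cancel₀ _ (by positivity)] at this
      linarith
    have e : Real.exp (r ^ 2 * q / 2) - Real.exp (r ^ 2 * v / 2) =
        Real.exp (r ^ 2 * v / 2) * (Real.exp (r ^ 2 * (q - v) / 2) - 1) := by
      rw [mul_sub, ← Real.exp_add]; congr 2 <;> ring
    rw [e, abs_mul, abs_of_pos (Real.exp_pos _)]
    have h1 := (Real.abs_exp_sub_one_le (hx.trans hx1)).trans
      (mul_le_mul_of_nonneg_left hx zero_le_two)
    have h2 : Real.exp (r ^ 2 * v / 2) ≤ Real.exp (R ^ 2 / 2) := by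
      apply Real.exp_le_exp.2
      have := mul_le_mul hr2 hv1 hv0 (sq_nonneg R)
      linarith
    calc _ ≤ Real.exp (R ^ 2 / 2) * (2 * (R ^ 2 * |q - v| / 2)) :=
          mul_le_mul h2 h1 (abs_nonneg _) (Real.exp_pos _).le
      _ = K * |q - v| := by rw [hK]; ring
      _ ≤ K * (η / K) := mul_le_mul_of_nonneg_left (hqv.trans (min_le_right _ _)) hK0.le
      _ = η := mul_div_cancel₀ _ hK0.ne'

/-- If the conditional expectation of `g` given the first coordinate is nearly the constant `c`
with high probability, then `g` is nearly uncorrelated with functions of the first coordinate. -/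
theorem norm_integral_prod_sub_le {α β : Type*} [MeasurableSpace α] [MeasurableSpace β]
    {μ : Measure α} {ν : Measure β} [IsProbabilityMeasure μ] [IsProbabilityMeasure ν]
    {f : α → ℂ} (hf : Measurable f) (hf1 : ∀ x, ‖f x‖ ≤ 1) {g : α × β → ℂ} (hg : Measurable g)
    (hg1 : ∀ z, ‖g z‖ ≤ 1) {c : ℂ} (hc : ‖c‖ ≤ 1) {ε : ℝ} (hε : 0 ≤ ε) {bad : Set α}
    (hbad : μ bad ≤ ENNReal.ofReal ε)
    (hgood : ∀ x, x ∉ bad → ‖∫ y, g (x, y) ∂ν - c‖ ≤ ε) :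
    ‖∫ z, f z.1 * g z ∂(μ.prod ν) - c * ∫ x, f x ∂μ‖ ≤ 3 * ε := by
  have hfi : Integrable f μ := Integrable.of_bound hf.aestronglyMeasurable 1
    (Eventually.of_forall hf1)
  have hgi : Integrable (fun z : α × β => f z.1 * g z) (μ.prod ν) :=
    Integrable.of_bound ((hf.comp measurable_fst).mul hg).aestronglyMeasurable 1
      (Eventually.of_forall fun z => by
        rw [norm_mul]; exact mul_le_one₀ (hf1 _) (norm_nonneg _) (hg1 _))
  rw [integral_prod _ hgi]
  simp_rw [integral_const_mul]
  have hGi : Integrable (fun x => f x * ∫ y, g (x, y) ∂ν) μ := by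
    have := hgi.integral_prod_left
    simpa only [integral_const_mul] using this
  rw [← integral_const_mul, ← integral_sub hGi (hfi.const_mul c)]
  -- The exceptional set is not assumed measurable, so it is enlarged to a measurable set of the
  -- same measure.
  set s := toMeasurable μ bad
  have hs : MeasurableSet s := measurableSet_toMeasurable _ _
  have hμs : μ.real s ≤ ε := by
    rw [Measure.real, measure_toMeasurable]
    exact ENNReal.toReal_le_of_le_ofReal hε hbad
  have hG1 : ∀ x, ‖∫ y, g (x, y) ∂ν‖ ≤ 1 := fun x => by
    have := norm_integral_le_of_norm_le_const (μ := ν) (f := fun y => g (x, y)) (C := 1)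
      (Eventually.of_forall fun y => hg1 _)
    simpa using this
  have hpt : ∀ x, ‖f x * ∫ y, g (x, y) ∂ν - c * f x‖ ≤ ε + s.indicator (fun _ => (2 : ℝ)) x := by
    intro x
    rw [mul_comm c, ← mul_sub, norm_mul]
    refine (mul_le_of_le_one_left (norm_nonneg _) (hf1 x)).trans ?_
    by_cases hx : x ∈ s
    · rw [Set.indicator_of_mem hx]
      have := (norm_sub_le (∫ y, g (x, y) ∂ν) c).trans (add_le_add (hG1 x) hc)
      linarith
    · rw [Set.indicator_of_notMem hx, add_zero]
      exact hgood x fun h => hx (subset_toMeasurable _ _ h)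
  have hi2 : Integrable (s.indicator fun _ => (2 : ℝ)) μ := (integrable_const _).indicator hs
  have hi3 : Integrable (fun x => ε + s.indicator (fun _ => (2 : ℝ)) x) μ :=
    (integrable_const ε).add hi2
  refine (norm_integral_le_of_norm_le hi3 (Eventually.of_forall hpt)).trans ?_
  rw [integral_add (integrable_const ε) hi2, integral_indicator_const _ hs]
  simp only [integral_const, probReal_univ, smul_eq_mul, one_mul]
  linarith

end

section

variable {p N : ℕ}

/-! ## Regular events -/

/-- The observed information is within `η` of the expected one, and it is constant up to `η` on the
part of `Θ` at distance at most `R` from `φ`. -/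
def IsRegular (S : Model p) (N : ℕ) (Θ : Set (Param p)) (φ : Param p) (R η : ℝ) (ω : Red p N) :
    Prop :=
  frob (misqrt (fisherInfo S N φ) * obsInfo S N φ (redData (S.graph N) φ ω) *
    misqrt (fisherInfo S N φ) - 1) ≤ η ∧
  ∀ Φ : ParamIdx p → Param p, (∀ k, Φ k ∈ Θ) →
    (∀ k, infoNorm (fisherInfo S N φ) (Φ k - φ).ofLp ≤ R) →
    frob (misqrt (fisherInfo S N φ) * (mosaicInfo S N Φ (redData (S.graph N) φ ω) -
      obsInfo S N φ (redData (S.graph N) φ ω)) * misqrt (fisherInfo S N φ)) ≤ η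

/-- An inequality that holds for arbitrary sets; the exceptional set in the continuity assumption is
a union over a continuum of parameters and is not known to be measurable. -/
theorem redLaw_preimage_le (S : Model p) (N : ℕ) {φ : Param p} (hφ : ∀ j, 0 < variances φ j)
    (s : Set (Data p N)) :
    redLaw (S.covLaw N) (redData (S.graph N) φ ⁻¹' s) ≤ dataLaw S N φ s := by
  rw [dataLaw_eq_map S N hφ]
  exact Measure.le_map_apply (measurable_redData _ _).aemeasurable s

theorem aemeasurable_frob_sq (S : Model p) (N : ℕ) (φ : Param p) (hi : InfoIntegrable S N φ)
    (P : Matrix (ParamIdx p) (ParamIdx p) ℝ) :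
    AEMeasurable (fun d => ENNReal.ofReal (frob (P * obsInfo S N φ d * P - 1) ^ 2))
      (dataLaw S N φ) := by
  refine AEMeasurable.ennreal_ofReal ?_
  simp_rw [frob_sq, Matrix.sub_apply, Matrix.mul_apply]
  have := fun k l => (hi k l).aestronglyMeasurable.aemeasurable
  fun_prop

theorem eventually_regular {S : Model p} {Θ : Set (Param p)} (hΘpos : ∀ φ ∈ Θ, ∀ j, 0 < variances φ j)
    (h5 : InfoGrowth S Θ) (h6 : InfoStability S Θ) (h7 : InfoContinuity S Θ) {φ : Param p}
    (hφ : φ ∈ Θ) {R η ε : ℝ} (hR : 0 < R) (hη : 0 < η) (hε : 0 < ε) :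
    ∀ᶠ N in atTop, redLaw (S.covLaw N) {ω | ¬IsRegular S N Θ φ R η ω} ≤ ENNReal.ofReal ε := by
  have e2 := (ENNReal.tendsto_nhds_zero.1 (h7.observed R hR η hη φ hφ)) (ENNReal.ofReal (ε / 2))
    (by simpa using hε)
  have e1 := h6 (η ^ 2 * (ε / 2)) (by positivity)
  filter_upwards [e1, e2, h5.integrable] with N h1 h2 hi
  set B := fisherInfo S N φ
  set s₁ : Set (Data p N) := {d | ENNReal.ofReal (η ^ 2) ≤
    ENNReal.ofReal (frob (misqrt B * obsInfo S N φ d * misqrt B - 1) ^ 2)}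
  set s₂ : Set (Data p N) := {d | ∃ Φ : ParamIdx p → Param p, (∀ k, Φ k ∈ Θ) ∧
      (∀ k, ‖WithLp.toLp 2 (msqrt (fisherInfo S N φ) *ᵥ (φ - Φ k).ofLp)‖ ≤ R) ∧
      η < frob (misqrt (fisherInfo S N φ) * (mosaicInfo S N Φ d - obsInfo S N φ d) *
        misqrt (fisherInfo S N φ))}
  -- Markov's inequality for the squared Frobenius distance; the bound `η²ε/2` on its mean leaves
  -- probability `ε/2`.
  have hs1 : dataLaw S N φ s₁ ≤ ENNReal.ofReal (ε / 2) := by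
    have hm := mul_meas_ge_le_lintegral₀ (aemeasurable_frob_sq S N φ (hi φ hφ) (misqrt B))
      (ENNReal.ofReal (η ^ 2))
    have hle := hm.trans (h1 φ hφ)
    rw [ENNReal.ofReal_mul (by positivity)] at hle
    exact (ENNReal.mul_le_mul_iff_right (by simpa using hη.ne') ENNReal.ofReal_ne_top).1 hle
  have hsub : {ω | ¬IsRegular S N Θ φ R η ω} ⊆ redData (S.graph N) φ ⁻¹' s₁ ∪
      redData (S.graph N) φ ⁻¹' s₂ := by
    intro ω hω
    by_contra hcon
    rw [Set.mem_union, not_or] at hcon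
    refine hω ⟨?_, fun Φ hΦ hΦR => ?_⟩
    · by_contra hlt
      push Not at hlt
      exact hcon.1 (ENNReal.ofReal_le_ofReal (pow_le_pow_left₀ hη.le hlt.le 2))
    · by_contra hlt
      push Not at hlt
      refine hcon.2 ⟨Φ, hΦ, fun k => ?_, hlt⟩
      have := hΦR k
      rwa [← neg_sub, WithLp.ofLp_neg, infoNorm_neg] at this
  calc _ ≤ redLaw (S.covLaw N) (redData (S.graph N) φ ⁻¹' s₁) +
        redLaw (S.covLaw N) (redData (S.graph N) φ ⁻¹' s₂) :=
        (measure_mono hsub).trans (measure_union_le _ _)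
    _ ≤ ENNReal.ofReal (ε / 2) + ENNReal.ofReal (ε / 2) :=
        add_le_add ((redLaw_preimage_le S N (hΘpos φ hφ) _).trans hs1)
          ((redLaw_preimage_le S N (hΘpos φ hφ) _).trans h2)
    _ = ENNReal.ofReal ε := by
        rw [← ENNReal.ofReal_add (by positivity) (by positivity), add_halves]

theorem eventually_norm_lt {S : Model p} {Θ : Set (Param p)} (h5 : InfoGrowth S Θ) {φ : Param p}
    (hφ : φ ∈ Θ) {R ρ : ℝ} (hR : 0 < R) (hρ : 0 < ρ) :
    ∀ᶠ N in atTop, ∀ b : Param p, infoNorm (fisherInfo S N φ) b.ofLp ≤ R → ‖b‖ < ρ := by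
  filter_upwards [h5.inv_tendsto (ρ ^ 2 / (4 * R ^ 2)) (by positivity), h5.posDef] with N h1 hB b hb
  have h := norm_sq_le_infoNorm (hB φ hφ) b.ofLp
  have h2 : ‖b‖ ^ 2 ≤ ρ ^ 2 / (4 * R ^ 2) * R ^ 2 :=
    h.trans (mul_le_mul (h1 φ hφ) (pow_le_pow_left₀ (infoNorm_nonneg _ _) hb 2) (sq_nonneg _)
      (by positivity))
  have h3 : ρ ^ 2 / (4 * R ^ 2) * R ^ 2 = (ρ / 2) ^ 2 := by field_simp; norm_num
  rw [h3] at h2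
  have := (sq_le_sq₀ (norm_nonneg _) (by positivity)).1 h2
  linarith

/-! ## The central limit theorem for the score -/

theorem abs_variances_le (b : Param p) (j : Fin 4) : |variances b j| ≤ ‖b‖ := by
  rw [← Real.norm_eq_abs]; exact PiLp.norm_apply_le b _

/-- Since `s + tλ²` dominates both `s` and `tλ²`, the bound is free of the eigenvalue `λ`; no
condition on the spectrum or the degrees of the network is required. -/
theorem abs_relVar_le (G : SimpleGraph (Fin N)) {s t : ℝ} (hs : 0 < s) (ht : 0 < t) {ds dt m : ℝ}
    (h1 : |ds| ≤ m) (h2 : |dt| ≤ m) (i : Fin N) :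
    |relVar G s t ds dt i| ≤ m * (s⁻¹ + t⁻¹) := by
  have hc := cvar_pos G hs ht i
  rw [relVar, abs_div, abs_of_pos hc, div_le_iff₀ hc]
  have h0 : 0 ≤ specVal G i ^ 2 := sq_nonneg _
  have hm : 0 ≤ m := (abs_nonneg _).trans h1
  calc |ds + dt * specVal G i ^ 2| ≤ m + m * specVal G i ^ 2 := by
        refine (abs_add_le _ _).trans (add_le_add h1 ?_)
        rw [abs_mul, abs_of_nonneg h0]
        exact mul_le_mul_of_nonneg_right h2 h0
    _ ≤ m * (s⁻¹ + t⁻¹) * cvar G s t i := by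
        have e : m * (s⁻¹ + t⁻¹) * cvar G s t i = m + m * specVal G i ^ 2 +
            m * (s⁻¹ * t * specVal G i ^ 2 + t⁻¹ * s) := by
          rw [cvar]; field_simp; ring
        rw [e]
        have : 0 ≤ m * (s⁻¹ * t * specVal G i ^ 2 + t⁻¹ * s) := by positivity
        linarith

theorem norm_integral_gaussScore_sub_expected_le {t m δ e : ℝ} {X y : Fin N → ℝ}
    (hy : ∀ i, |y i| ≤ m) (hδ : δ ≤ 1 / 8) (h1 : |t| * m ≤ δ) (h3 : |t| ^ 3 * m ≤ δ)
    (he : 0 ≤ e) (hv : e + 1 / 2 * ∑ i, y i ^ 2 ≤ 1)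
    (hX : |∑ i, X i ^ 2 - e| ≤ 1) (hX' : t ^ 2 * |∑ i, X i ^ 2 - e| ≤ δ) (hδ0 : 0 ≤ δ) :
    ‖∫ w, Complex.exp (((t * gaussScore w X y : ℝ) : ℂ) * Complex.I) ∂(iidGaussian N 1) -
      Complex.exp (-((t ^ 2 * (e + 1 / 2 * ∑ i, y i ^ 2) / 2 : ℝ) : ℂ))‖ ≤ 9 * δ := by
  set V := ∑ i, X i ^ 2 + 1 / 2 * ∑ i, y i ^ 2 with hV
  have hV0 : 0 ≤ V := by positivity
  have hV2 : V ≤ 2 := by linarith [(abs_le.1 hX).2]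
  -- Of the final `9δ`, `8δ` is the distance to the Gaussian law with the random variance `V ≤ 2`,
  -- and `δ` is the cost of replacing `V` by its expectation.
  have hb : |t| ^ 3 * m * V ≤ δ * 2 := mul_le_mul h3 hV2 hV0 hδ0
  have hmain := norm_integral_gaussScore_sub_le t m X y hy (by linarith)
    (by rw [← hV]; linarith)
  rw [← hV] at hmain
  have hexp : ‖Complex.exp (-((t ^ 2 * V / 2 : ℝ) : ℂ)) -
      Complex.exp (-((t ^ 2 * (e + 1 / 2 * ∑ i, y i ^ 2) / 2 : ℝ) : ℂ))‖ ≤ δ := by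
    set v := e + 1 / 2 * ∑ i, y i ^ 2 with hvdef
    have hv0 : 0 ≤ v := by positivity
    rw [← Complex.ofReal_neg, ← Complex.ofReal_neg, ← Complex.ofReal_exp, ← Complex.ofReal_exp,
      ← Complex.ofReal_sub, Complex.norm_real, Real.norm_eq_abs]
    have e1 : Real.exp (-(t ^ 2 * V / 2)) - Real.exp (-(t ^ 2 * v / 2)) =
        Real.exp (-(t ^ 2 * v / 2)) * (Real.exp (-(t ^ 2 * (∑ i, X i ^ 2 - e) / 2)) - 1) := by
      rw [mul_sub, ← Real.exp_add, hV, hvdef]; congr 2 <;> ring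
    have hx : |-(t ^ 2 * (∑ i, X i ^ 2 - e) / 2)| ≤ δ / 2 := by
      rw [abs_neg, abs_div, abs_mul, abs_of_nonneg (sq_nonneg t), abs_two]
      linarith
    rw [e1, abs_mul, abs_of_pos (Real.exp_pos _)]
    have h4 := Real.abs_exp_sub_one_le (hx.trans (by linarith))
    have h5 : Real.exp (-(t ^ 2 * v / 2)) ≤ 1 := by
      rw [Real.exp_le_one_iff, neg_nonpos]; positivity
    calc _ ≤ 1 * (2 * (δ / 2)) :=
          mul_le_mul h5 (h4.trans (by linarith)) (abs_nonneg _) zero_le_one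
      _ = δ := by ring
  have := norm_sub_le_norm_sub_add_norm_sub
    (∫ w, Complex.exp (((t * gaussScore w X y : ℝ) : ℂ) * Complex.I) ∂(iidGaussian N 1))
    (Complex.exp (-((t ^ 2 * V / 2 : ℝ) : ℂ)))
    (Complex.exp (-((t ^ 2 * (e + 1 / 2 * ∑ i, y i ^ 2) / 2 : ℝ) : ℂ)))
  linarith

theorem prod_preimage_fst {α β : Type*} [MeasurableSpace α] [MeasurableSpace β] (μ : Measure α)
    (ν : Measure β) [IsProbabilityMeasure ν] [SFinite μ] (s : Set α) :
    (μ.prod ν) (Prod.fst ⁻¹' s) = μ s := by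
  rw [← Set.prod_univ, Measure.prod_prod, measure_univ, mul_one]

theorem norm_exp_ofReal_mul_I_le (x : ℝ) : ‖Complex.exp ((x : ℂ) * Complex.I)‖ ≤ 1 :=
  (Complex.norm_exp_ofReal_mul_I x).le

theorem norm_exp_neg_ofReal_le {x : ℝ} (hx : 0 ≤ x) : ‖Complex.exp (-(x : ℂ))‖ ≤ 1 := by
  rw [Complex.norm_exp, Complex.neg_re, Complex.ofReal_re, Real.exp_le_one_iff]; linarith

-- Outcome noise, mediator noise and exposure noise are integrated out in this order. Each time the
-- conditional characteristic function is nearly the constant `exp(-t²v/2)`, with `v` the expected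
-- information of the layer, outside an event of small probability. The three values of `v` add up
-- to one.
set_option maxHeartbeats 1000000 in
theorem tendsto_integral_redScore {S : Model p} {Θ : Set (Param p)}
    (hΘpos : ∀ φ ∈ Θ, ∀ j, 0 < variances φ j)
    (h5 : InfoGrowth S Θ) (h6 : InfoStability S Θ) (h7 : InfoContinuity S Θ) {φ : Param p}
    (hφ : φ ∈ interior Θ) {c : ℕ → Param p}
    (hc : ∀ᶠ N in atTop, infoNorm (fisherInfo S N φ) (c N).ofLp = 1) (t : ℝ) :
    Tendsto (fun N => ∫ ω, Complex.exp (((t * redScore (S.graph N) φ ω (c N) : ℝ) : ℂ) *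
      Complex.I) ∂(redLaw (S.covLaw N))) atTop (𝓝 (Complex.exp (-((t ^ 2 / 2 : ℝ) : ℂ)))) := by
  have hφΘ := interior_subset hφ
  have hpos := hΘpos φ hφΘ
  rw [Metric.tendsto_nhds]
  intro ε hε
  set δ := min (1 / 8) (ε / 100) with hδdef
  have hδ : 0 < δ := by positivity
  have hδ8 : δ ≤ 1 / 8 := min_le_left _ _
  have hδε : δ ≤ ε / 100 := min_le_right _ _
  obtain ⟨R, hR, ηA, hηA, hbern⟩ := exists_bernScore_close p t (ε := 9 * δ) (by positivity)
  -- The three demands: the empirical sums stay within distance one of their means, the two errors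
  -- for the exposure block total at most `ηA`, and the variance errors move the exponent by at most
  -- `δ`.
  set η := min 1 (min (ηA / 2) (δ / (t ^ 2 + 1))) with hηdef
  have hη : 0 < η := by positivity
  have hη1 : η ≤ 1 := min_le_left _ _
  have hη2 : η ≤ ηA / 2 := (min_le_right _ _).trans (min_le_left _ _)
  have hη3 : t ^ 2 * η ≤ δ := by
    have h : η ≤ δ / (t ^ 2 + 1) := (min_le_right _ _).trans (min_le_right _ _)
    rw [le_div_iff₀ (by positivity)] at h
    nlinarith
  set W := ∑ j, (variances φ j)⁻¹ with hW
  have hWj : ∀ j, 0 < (variances φ j)⁻¹ := fun j => inv_pos.2 (hpos j)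
  have hWpos : 0 < W := Finset.sum_pos (fun j _ => hWj j) ⟨0, Finset.mem_univ _⟩
  have hW4 : W = (variances φ 0)⁻¹ + (variances φ 1)⁻¹ + (variances φ 2)⁻¹ +
    (variances φ 3)⁻¹ := Fin.sum_univ_four _
  -- Makes both `|t| m` and `|t|³ m` at most `δ`. A direction of Euclidean norm below `m / W` has
  -- all relative variance changes at most `m`.
  set m := δ / (1 + |t|) ^ 3 with hm
  have hm0 : 0 < m := by positivity
  have htm : ∀ x : ℝ, x ≤ (1 + |t|) ^ 3 → x * m ≤ δ := fun x hx => by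
    have := mul_le_mul_of_nonneg_right hx hm0.le
    rwa [hm, mul_div_cancel₀ _ (by positivity)] at this
  have htm1 : |t| * m ≤ δ := htm _ (by nlinarith [abs_nonneg t, sq_nonneg |t|, pow_nonneg (abs_nonneg t) 3])
  have htm3 : |t| ^ 3 * m ≤ δ := htm _ (pow_le_pow_left₀ (abs_nonneg t) (by linarith) 3)
  clear_value m W η δ
  obtain ⟨ρ, hρ, hball⟩ := Metric.isOpen_iff.1 isOpen_interior φ hφ
  filter_upwards [hc, h5.integrable, h5.posDef,
    eventually_regular hΘpos h5 h6 h7 hφΘ hR hη (ε := δ) hδ,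
    eventually_norm_lt h5 hφΘ hR hρ,
    eventually_norm_lt h5 hφΘ one_pos (ρ := m / W) (by positivity)] with N hcN hi hB hreg hRΘ hsmall
  have hi : InfoIntegrable S N φ := hi φ hφΘ
  have hB := hB φ hφΘ
  have := S.isProb N
  set G := S.graph N
  set μC := S.covLaw N with hμC
  set b := c N
  have hbm := hsmall b hcN.le
  have hvb : ∀ j, |variances b j| ≤ m / W := fun j => (abs_variances_le b j).trans hbm.le
  have hrelY : ∀ i, |relY G φ b i| ≤ m := fun i => by
    refine (abs_relVar_le G (hpos 0) (hpos 1) (hvb 0) (hvb 1) i).trans ?_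
    rw [div_mul_eq_mul_div, div_le_iff₀ hWpos]
    exact mul_le_mul_of_nonneg_left (by rw [hW4]; linarith [hWj 2, hWj 3]) hm0.le
  have hrelM : ∀ i, |relM G φ b i| ≤ m := fun i => by
    refine (abs_relVar_le G (hpos 2) (hpos 3) (hvb 2) (hvb 3) i).trans ?_
    rw [div_mul_eq_mul_div, div_le_iff₀ hWpos]
    exact mul_le_mul_of_nonneg_left (by rw [hW4]; linarith [hWj 0, hWj 1]) hm0.le
  have hsum := fisher_quad S N hpos hi b
  rw [← infoNorm_sq hB, hcN, one_pow] at hsum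
  set vY := expY G μC φ b with hvY
  set vM := expM G μC φ b with hvM
  set vA := expA μC φ b with hvA
  have vY0 : 0 ≤ vY := expY_nonneg _ _ _ _
  have vM0 : 0 ≤ vM := expM_nonneg _ _ _ _
  have vA0 : 0 ≤ vA := expA_nonneg _ _ _
  have sY0 : 0 ≤ ∑ i, relY G φ b i ^ 2 := by positivity
  have sM0 : 0 ≤ ∑ i, relM G φ b i ^ 2 := by positivity
  set eT : ℝ → ℂ := fun x => Complex.exp (((t * x : ℝ) : ℂ) * Complex.I) with heT
  have heTm : Measurable eT := by fun_prop
  have heT1 : ∀ x, ‖eT x‖ ≤ 1 := fun x => norm_exp_ofReal_mul_I_le _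
  have heTadd : ∀ x y, eT (x + y) = eT x * eT y := fun x y => by
    simp only [heT]; rw [← Complex.exp_add]; congr 1; push_cast; ring
  -- the three score blocks
  set gY : Red p N → ℂ := fun ω => eT (gaussScore ω.2 (regY G φ ω.1 b) (relY G φ b)) with hgY
  set gM : (Cov p N × (Fin N → unitInterval)) × (Fin N → ℝ) → ℂ :=
    fun x => eT (gaussScore x.2 (regM G φ x.1 b) (relM G φ b)) with hgM
  set gA : Cov p N × (Fin N → unitInterval) → ℂ :=
    fun x => eT (bernScore (expo φ x) (linA x.1 φ) (linA x.1 b)) with hgA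
  have mY : Measurable gY := heTm.comp (measurable_gaussScore measurable_snd
    ((measurable_regY G φ b).comp measurable_fst) measurable_const)
  have mM : Measurable gM := heTm.comp (measurable_gaussScore measurable_snd
    ((measurable_regM G φ b).comp measurable_fst) measurable_const)
  have mA : Measurable gA := heTm.comp (measurable_bernScore φ b)
  set aY : ℂ := Complex.exp (-((t ^ 2 * (vY + 1 / 2 * ∑ i, relY G φ b i ^ 2) / 2 : ℝ) : ℂ)) with haY
  set aM : ℂ := Complex.exp (-((t ^ 2 * (vM + 1 / 2 * ∑ i, relM G φ b i ^ 2) / 2 : ℝ) : ℂ)) with haM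
  set aA : ℂ := Complex.exp (-((t ^ 2 * vA / 2 : ℝ) : ℂ)) with haA
  have naY : ‖aY‖ ≤ 1 := norm_exp_neg_ofReal_le (by positivity)
  have naM : ‖aM‖ ≤ 1 := norm_exp_neg_ofReal_le (by positivity)
  have naA : ‖aA‖ ≤ 1 := norm_exp_neg_ofReal_le (by positivity)
  have hδ9 : ENNReal.ofReal δ ≤ ENNReal.ofReal (9 * δ) := ENNReal.ofReal_le_ofReal (by linarith)
  have step1 : ‖∫ ω, (gA ω.1.1 * gM ω.1) * gY ω ∂(redLaw μC) -
      aY * ∫ x, gA x.1 * gM x ∂(medLaw μC)‖ ≤ 3 * (9 * δ) := by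
    refine norm_integral_prod_sub_le (μ := medLaw μC) (ν := iidGaussian N 1)
      (f := fun x => gA x.1 * gM x) ((mA.comp measurable_fst).mul mM)
      (fun x => by rw [norm_mul]; exact mul_le_one₀ (heT1 _) (norm_nonneg _) (heT1 _)) mY
      (fun z => heT1 _) naY (by positivity)
      (bad := {x | ¬|∑ i, regY G φ x b i ^ 2 - vY| ≤ η * vY}) ?_ fun x hx => ?_
    -- The exceptional set of the conditioning variables is pulled back to the full space, where it
    -- lies in the complement of the regular event.
    · rw [← prod_preimage_fst (medLaw μC) (iidGaussian N 1)]
      refine (measure_mono fun ω hω => ?_).trans (hreg.trans hδ9)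
      exact fun h => hω (abs_sum_regY_sub_le S N hpos hi hB h.1 b)
    · have hx' : |∑ i, regY G φ x b i ^ 2 - vY| ≤ η :=
        (not_not.1 hx).trans (mul_le_of_le_one_right hη.le (by linarith))
      have hcf := norm_integral_gaussScore_sub_expected_le (t := t) (m := m) (δ := δ) (e := vY)
        (X := regY G φ x b) (y := relY G φ b) hrelY hδ8 htm1 htm3 vY0 (by linarith)
        (hx'.trans hη1) ((mul_le_mul_of_nonneg_left hx' (sq_nonneg t)).trans hη3) hδ.le
      exact hcf
  have step2 : ‖∫ x, gA x.1 * gM x ∂(medLaw μC) - aM * ∫ x, gA x ∂(baseLaw μC)‖ ≤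
      3 * (9 * δ) := by
    refine norm_integral_prod_sub_le (μ := baseLaw μC) (ν := iidGaussian N 1)
      (f := gA) mA (fun x => heT1 _) mM
      (fun z => heT1 _) naM (by positivity)
      (bad := {x | ¬|∑ i, regM G φ x b i ^ 2 - vM| ≤ η * vM}) ?_ fun x hx => ?_
    · rw [← prod_preimage_fst (baseLaw μC) (iidGaussian N 1),
        ← prod_preimage_fst ((baseLaw μC).prod (iidGaussian N 1)) (iidGaussian N 1)]
      refine (measure_mono fun ω hω => ?_).trans (hreg.trans hδ9)
      exact fun h => hω (abs_sum_regM_sub_le S N hpos hi hB h.1 b)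
    · have hx' : |∑ i, regM G φ x b i ^ 2 - vM| ≤ η :=
        (not_not.1 hx).trans (mul_le_of_le_one_right hη.le (by linarith))
      have hcf := norm_integral_gaussScore_sub_expected_le (t := t) (m := m) (δ := δ) (e := vM)
        (X := regM G φ x b) (y := relM G φ b) hrelM hδ8 htm1 htm3 vM0 (by linarith)
        (hx'.trans hη1) ((mul_le_mul_of_nonneg_left hx' (sq_nonneg t)).trans hη3) hδ.le
      exact hcf
  have step3 : ‖∫ x, gA x ∂(baseLaw μC) - aA‖ ≤ 3 * (9 * δ) := by
    have h := norm_integral_prod_sub_le (μ := μC)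
      (ν := Measure.pi fun _ : Fin N => (volume : Measure unitInterval))
      (f := fun _ => 1) measurable_const (fun x => by simp) mA
      (fun z => heT1 _) naA (ε := 9 * δ) (by positivity)
      (bad := {C | ¬∀ ξ : ℝ, |ξ| ≤ R → |bernInfo (linA C φ + ξ • linA C b) (linA C b) - vA| ≤ ηA})
      ?_ fun C hC => ?_
    · simp only [one_mul, integral_const, probReal_univ, one_smul, mul_one] at h
      exact h
    · rw [← prod_preimage_fst μC (Measure.pi fun _ : Fin N => (volume : Measure unitInterval)),
        ← prod_preimage_fst (μC.prod (Measure.pi fun _ => (volume : Measure unitInterval)))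
          (iidGaussian N 1), ← prod_preimage_fst ((μC.prod (Measure.pi fun _ =>
          (volume : Measure unitInterval))).prod (iidGaussian N 1)) (iidGaussian N 1)]
      refine (measure_mono fun ω hω => ?_).trans (hreg.trans hδ9)
      refine fun h => hω fun ξ hξ => ?_
      have hn : infoNorm (fisherInfo S N φ) (ξ • b).ofLp ≤ R := by
        rw [WithLp.ofLp_smul, infoNorm_smul, hcN, mul_one]; exact hξ
      have hmem : φ + ξ • b ∈ Θ := interior_subset (hball (by
        rw [Metric.mem_ball, dist_eq_norm, add_sub_cancel_left]; exact hRΘ _ hn))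
      have := abs_bernInfo_sub_le S N hpos hi hB (hΘpos _ hmem) h.1
        (h.2 (fun _ => φ + ξ • b) (fun _ => hmem)
          (fun _ => by rw [add_sub_cancel_left]; exact hn)) b
      rw [map_smul] at this
      refine this.trans ?_
      have h1 : (η + η) * vA ≤ (η + η) * 1 :=
        mul_le_mul_of_nonneg_left (by linarith) (by positivity)
      linarith
    · exact hbern N φ b C vA vA0 (by linarith) (not_not.1 hC)
  -- The block variances sum to the information of the direction, which is one.
  have hprod : aY * (aM * aA) = Complex.exp (-((t ^ 2 / 2 : ℝ) : ℂ)) := by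
    rw [haY, haM, haA, ← Complex.exp_add, ← Complex.exp_add, ← Complex.ofReal_neg,
      ← Complex.ofReal_neg, ← Complex.ofReal_neg, ← Complex.ofReal_neg, ← Complex.ofReal_add,
      ← Complex.ofReal_add]
    congr 2
    linear_combination (t ^ 2 / 2) * hsum
  have hint : ∫ ω, Complex.exp (((t * redScore G φ ω b : ℝ) : ℂ) * Complex.I) ∂(redLaw μC) =
      ∫ ω, (gA ω.1.1 * gM ω.1) * gY ω ∂(redLaw μC) := by
    congr 1
    funext ω
    change eT (redScore G φ ω b) = _
    rw [redScore, heTadd, heTadd]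
    ring
  rw [hint, dist_eq_norm, ← hprod]
  set I₁ := ∫ ω, (gA ω.1.1 * gM ω.1) * gY ω ∂(redLaw μC)
  set I₂ := ∫ x, gA x.1 * gM x ∂(medLaw μC)
  set I₃ := ∫ x, gA x ∂(baseLaw μC)
  have hdec : I₁ - aY * (aM * aA) = (I₁ - aY * I₂) + aY * ((I₂ - aM * I₃) + aM * (I₃ - aA)) := by
    ring
  rw [hdec]
  have n3 : ‖aM * (I₃ - aA)‖ ≤ 3 * (9 * δ) := by
    rw [norm_mul]; exact (mul_le_of_le_one_left (norm_nonneg _) naM).trans step3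
  have n2 : ‖aY * ((I₂ - aM * I₃) + aM * (I₃ - aA))‖ ≤ 3 * (9 * δ) + 3 * (9 * δ) := by
    rw [norm_mul]
    exact (mul_le_of_le_one_left (norm_nonneg _) naY).trans
      ((norm_add_le _ _).trans (add_le_add step2 n3))
  have := (norm_add_le (I₁ - aY * I₂) (aY * ((I₂ - aM * I₃) + aM * (I₃ - aA)))).trans
    (add_le_add step1 n2)
  linarith

end

section

variable {p N : ℕ}

/-! ## Tightness and expansion of the maximum likelihood estimator -/

/-- Compactness bounds the continuous function `∑ (q_j + 1/q_j)` of the variance ratios on `Θ`,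
which keeps them away from `0` and `∞` together. -/
theorem exists_variance_ratio_bound {Θ : Set (Param p)} (hΘ : IsCompact Θ)
    (hΘpos : ∀ φ ∈ Θ, ∀ j, 0 < variances φ j) {φ : Param p} (hφ : φ ∈ Θ) :
    ∃ κ : ℝ, 0 < κ ∧ κ ≤ 1 ∧ ∀ φ' ∈ Θ, ∀ j, κ ≤ variances φ' j / variances φ j ∧
      variances φ' j / variances φ j ≤ κ⁻¹ := by
  set q : Param p → Fin 4 → ℝ := fun φ' j => variances φ' j / variances φ j with hq
  have hqpos : ∀ φ' ∈ Θ, ∀ j, 0 < q φ' j := fun φ' h j => div_pos (hΘpos φ' h j) (hΘpos φ hφ j)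
  have hcont : ∀ j, Continuous fun φ' : Param p => q φ' j := fun j => by
    simp only [hq, variances]; fun_prop
  obtain ⟨K, hK⟩ := hΘ.exists_bound_of_continuousOn (f := fun φ' => ∑ j, (q φ' j + (q φ' j)⁻¹))
    (continuousOn_finsetSum _ fun j _ => (hcont j).continuousOn.add
      ((hcont j).continuousOn.inv₀ fun φ' h => (hqpos φ' h j).ne'))
  have hKj : ∀ φ' ∈ Θ, ∀ j, q φ' j + (q φ' j)⁻¹ ≤ max K 1 := fun φ' h j => by
    refine le_trans ?_ (((le_abs_self _).trans (hK φ' h)).trans (le_max_left _ _))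
    exact Finset.single_le_sum (f := fun j => q φ' j + (q φ' j)⁻¹) (fun i _ =>
      (add_pos (hqpos φ' h i) (inv_pos.2 (hqpos φ' h i))).le) (Finset.mem_univ j)
  have hM : 0 < max K 1 := lt_max_of_lt_right one_pos
  refine ⟨(max K 1)⁻¹, inv_pos.2 hM, inv_le_one_of_one_le₀ (le_max_right _ _),
    fun φ' h j => ⟨?_, ?_⟩⟩
  · have h1 := hqpos φ' h j
    rw [inv_le_comm₀ hM h1]
    linarith [hKj φ' h j]
  · have h1 := inv_pos.2 (hqpos φ' h j)
    rw [inv_inv]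
    linarith [hKj φ' h j]

theorem redScore_eq_sum (G : SimpleGraph (Fin N)) {φ : Param p} (hφ : ∀ j, 0 < variances φ j)
    (ω : Red p N) (c : Param p) :
    redScore G φ ω c = ∑ k, c k * fderiv ℝ (logLik G (redData G φ ω)) φ
      (EuclideanSpace.single k 1) := by
  rw [← fderiv_logLik G hφ]
  conv_lhs => rw [eq_sum_single c]
  rw [map_sum]
  simp

/-- On a regular event where the normalised score is bounded, a maximiser of the likelihood is
close to the true parameter, and it is nearly the solution of the linearised score equation. -/
theorem IsRegular.expansion {S : Model p} {Θ : Set (Param p)} {φ : Param p} {κ z η R ρ : ℝ}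
    {ω : Red p N} (hΘpos : ∀ φ ∈ Θ, ∀ j, 0 < variances φ j) (hφ : φ ∈ Θ)
    (hball : Metric.ball φ ρ ⊆ Θ) (hi : InfoIntegrable S N φ) (hB : (fisherInfo S N φ).PosDef)
    (hκ : 0 < κ) (hκ1 : κ ≤ 1)
    (hratio : ∀ φ' ∈ Θ, ∀ j, κ ≤ variances φ' j / variances φ j ∧
      variances φ' j / variances φ j ≤ κ⁻¹)
    (hz0 : 0 ≤ z) (hR : 2 * (4 * z + 8 * z ^ 2 / κ ^ 3 + 4) + 16 * z / κ ^ 3 ≤ R)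
    (hnorm : ∀ b : Param p, infoNorm (fisherInfo S N φ) b.ofLp ≤ R → ‖b‖ < ρ)
    (hη : η ≤ 1 / 4) (hω : IsRegular S N Θ φ R η ω)
    (hz : scoreBound (S.graph N) φ (fisherInfo S N φ) κ ω ≤ z) {φ' : Param p} (hφ' : φ' ∈ Θ)
    (hmax : IsMaxOn (logLik (S.graph N) (redData (S.graph N) φ ω)) Θ φ') :
    infoNorm (fisherInfo S N φ) (φ' - φ).ofLp ≤ R ∧
    ∀ c : Param p, |c.ofLp ⬝ᵥ (fisherInfo S N φ *ᵥ (φ' - φ).ofLp) -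
      redScore (S.graph N) φ ω c| ≤ 2 * η * (infoNorm (fisherInfo S N φ) c.ofLp * R) := by
  set B := fisherInfo S N φ with hBdef
  set b := φ' - φ with hb
  have hφb : φ + b = φ' := by rw [hb]; abel
  have hmem : ∀ b' : Param p, infoNorm B b'.ofLp ≤ R → φ + b' ∈ Θ := fun b' h => hball (by
    rw [Metric.mem_ball, dist_eq_norm, add_sub_cancel_left]; exact hnorm _ h)
  have hη0 : 0 ≤ η := (frob_nonneg _).trans hω.1
  set R₀ := 4 * z + 8 * z ^ 2 / κ ^ 3 + 4 with hR₀
  have hR₀0 : 0 ≤ R₀ := by positivity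
  have hzκ : 0 ≤ 16 * z / κ ^ 3 := by positivity
  have hR0 : R₀ ≤ R := by linarith
  have hbR : infoNorm B b.ofLp ≤ R := by
    refine le_trans (infoNorm_le_of_logLik_le S N (hΘpos φ hφ) hi hB hκ hκ1
      (by rw [hφb]; exact hΘpos φ' hφ') (by rw [hφb]; exact fun j => (hratio φ' hφ' j).1)
      (by rw [hφb]; exact fun j => (hratio φ' hφ' j).2) hz0 hz le_rfl (hω.1.trans hη) ?_ ?_) hR
    · intro b' hb'
      have hm := hmem b' (hb'.trans hR0)
      refine ⟨hΘpos _ hm, (hω.2 (fun _ => φ + b') (fun _ => hm) fun _ => ?_).trans hη⟩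
      rw [add_sub_cancel_left]; exact hb'.trans hR0
    · rw [hφb]; exact hmax hφ
  refine ⟨hbR, fun c => ?_⟩
  have hseg : ∀ r ∈ Set.Icc (0 : ℝ) 1, infoNorm B (r • b).ofLp ≤ R := fun r hr => by
    rw [WithLp.ofLp_smul, infoNorm_smul, abs_of_nonneg hr.1]
    exact (mul_le_of_le_one_left (infoNorm_nonneg _ _) hr.2).trans hbR
  set l := logLik (S.graph N) (redData (S.graph N) φ ω) with hl
  -- The information ball lies in a Euclidean ball contained in `Θ`, so the maximiser is an interior
  -- local maximum.
  have hzero : fderiv ℝ l (φ + b) = 0 := by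
    rw [hφb]
    refine IsLocalMax.fderiv_eq_zero (hmax.isLocalMax ?_)
    refine mem_of_superset (Metric.isOpen_ball.mem_nhds ?_) hball
    rw [Metric.mem_ball, dist_eq_norm]; exact hnorm _ hbR
  choose r hr hre using fun k => exists_mosaic (f := l) φ b
    (fun r hr => contDiffAt_logLik (S.graph N) (hΘpos φ hφ) (hΘpos _ (hmem _ (hseg r hr))) ω) k
  set Φ : ParamIdx p → Param p := fun k => φ + r k • b
  have hrI : ∀ k, r k ∈ Set.Icc (0 : ℝ) 1 := fun k => Set.Ioo_subset_Icc_self (hr k)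
  have hreg := hω.2 Φ (fun k => hmem _ (hseg _ (hrI k)))
    (fun k => by simp only [Φ]; rw [add_sub_cancel_left]; exact hseg _ (hrI k))
  set d := redData (S.graph N) φ ω
  -- Each component of the gradient has its own intermediate point on the segment, which is why the
  -- mosaic matrix appears.
  have hscore : redScore (S.graph N) φ ω c = c.ofLp ⬝ᵥ (mosaicInfo S N Φ d *ᵥ b.ofLp) := by
    rw [redScore_eq_sum _ (hΘpos φ hφ), dotProduct]
    refine Finset.sum_congr rfl fun k _ => ?_
    have h := hre k
    rw [hzero] at h
    have e : (mosaicInfo S N Φ d *ᵥ b.ofLp) k = -(hessian l (φ + r k • b) *ᵥ b.ofLp) k := by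
      simp only [Matrix.mulVec, dotProduct, mosaicInfo, obsInfo, Matrix.of_apply, Matrix.neg_apply,
        neg_mul, Finset.sum_neg_distrib]
      rfl
    rw [e, ← h]
    change _ = c k * -(0 - fderiv ℝ l φ (EuclideanSpace.single k 1))
    rw [zero_sub, neg_neg]
  have h1 := abs_quad_le_of_frob hB (mosaicInfo S N Φ d - obsInfo S N φ d) c.ofLp b.ofLp
  have h2 := abs_quad_le_of_frob hB (obsInfo S N φ d - B) c.ofLp b.ofLp
  rw [misqrt_conj_sub hB] at h2
  rw [Matrix.sub_mulVec, dotProduct_sub] at h1 h2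
  rw [hscore]
  set x := infoNorm B c.ofLp
  set y := infoNorm B b.ofLp
  have hxy0 : 0 ≤ x * y := mul_nonneg (infoNorm_nonneg _ _) (infoNorm_nonneg _ _)
  have hxy : x * y ≤ x * R := mul_le_mul_of_nonneg_left hbR (infoNorm_nonneg _ _)
  have h1' := abs_le.1 (h1.trans (mul_le_mul hreg hxy hxy0 hη0))
  have h2' := abs_le.1 (h2.trans (mul_le_mul hω.1 hxy hxy0 hη0))
  rw [abs_le]
  constructor <;> linarith [h1'.1, h1'.2, h2'.1, h2'.2]

/-- The radius depends only on the probability `ε`, through Markov's inequality for the score bound,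
while the linearisation error `η` is then arbitrary. Discarded are the non-regular event, a large
score bound, and the null set where the estimator is not a maximiser in `Θ`. -/
theorem exists_eventually_expansion {S : Model p} {Θ : Set (Param p)} (hΘ : IsCompact Θ)
    (hΘpos : ∀ φ ∈ Θ, ∀ j, 0 < variances φ j)
    (h5 : InfoGrowth S Θ) (h6 : InfoStability S Θ) (h7 : InfoContinuity S Θ) {φ : Param p}
    (hφ : φ ∈ interior Θ) {φhat : ∀ N : ℕ, Data p N → Param p} (hMLE : IsMLE S Θ φ φhat)
    {ε : ℝ} (hε : 0 < ε) :
    ∃ R > 0, ∀ η > 0, ∀ᶠ N in atTop, redLaw (S.covLaw N) {ω |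
      ¬(infoNorm (fisherInfo S N φ) (φhat N (redData (S.graph N) φ ω) - φ).ofLp ≤ R ∧
        ∀ c : Param p, |c.ofLp ⬝ᵥ (fisherInfo S N φ *ᵥ
          (φhat N (redData (S.graph N) φ ω) - φ).ofLp) - redScore (S.graph N) φ ω c| ≤
          η * infoNorm (fisherInfo S N φ) c.ofLp)} ≤ ENNReal.ofReal ε := by
  have hφΘ := interior_subset hφ
  have hpos := hΘpos φ hφΘ
  obtain ⟨κ, hκ, hκ1, hratio⟩ := exists_variance_ratio_bound hΘ hΘpos hφΘ
  obtain ⟨K, hK⟩ := exists_scoreBound_const p hκ hκ1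
  -- Markov's inequality at level `z` leaves probability at most `K/z ≤ ε/2`.
  set z := 2 * (|K| + 1) / ε with hz
  have hz0 : 0 < z := by positivity
  set R := 2 * (4 * z + 8 * z ^ 2 / κ ^ 3 + 4) + 16 * z / κ ^ 3 with hR
  have hR0 : 0 < R := by positivity
  obtain ⟨ρ, hρ, hball⟩ := Metric.isOpen_iff.1 isOpen_interior φ hφ
  refine ⟨R, hR0, fun η hη => ?_⟩
  set η' := min (1 / 4) (η / (2 * R)) with hη'
  have hη'0 : 0 < η' := by positivity
  filter_upwards [h5.integrable, h5.posDef,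
    eventually_regular hΘpos h5 h6 h7 hφΘ hR0 hη'0 (ε := ε / 2) (by positivity),
    eventually_norm_lt h5 hφΘ hR0 hρ] with N hi hB hreg hnorm
  have hi : InfoIntegrable S N φ := hi φ hφΘ
  have hB := hB φ hφΘ
  obtain ⟨hsm, hsb⟩ := hK S N φ hpos hi hB
  set sb := scoreBound (S.graph N) φ (fisherInfo S N φ) κ
  have hmarkov : redLaw (S.covLaw N) {ω | ENNReal.ofReal z ≤ ENNReal.ofReal (sb ω)} ≤
      ENNReal.ofReal (ε / 2) := by
    have h1 := (mul_meas_ge_le_lintegral₀ (hsm.ennreal_ofReal).aemeasurable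
      (ENNReal.ofReal z)).trans hsb
    have h2 : ENNReal.ofReal K ≤ ENNReal.ofReal z * ENNReal.ofReal (ε / 2) := by
      rw [← ENNReal.ofReal_mul hz0.le]
      refine ENNReal.ofReal_le_ofReal ?_
      have : z * (ε / 2) = |K| + 1 := by rw [hz]; field_simp
      rw [this]; linarith [le_abs_self K]
    exact (ENNReal.mul_le_mul_iff_right (by simpa using hz0) ENNReal.ofReal_ne_top).1
      (h1.trans h2)
  set s₃ : Set (Data p N) := {d | ¬(φhat N d ∈ Θ ∧ IsMaxOn (logLik (S.graph N) d) Θ (φhat N d))}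
  have hnull : redLaw (S.covLaw N) (redData (S.graph N) φ ⁻¹' s₃) = 0 := by
    refine le_antisymm ((redLaw_preimage_le S N hpos _).trans (le_of_eq ?_)) zero_le
    exact ae_iff.1 ((hMLE.mem N).and (hMLE.isMax N))
  have hsub : {ω | ¬(infoNorm (fisherInfo S N φ) (φhat N (redData (S.graph N) φ ω) - φ).ofLp ≤ R ∧
        ∀ c : Param p, |c.ofLp ⬝ᵥ (fisherInfo S N φ *ᵥ
          (φhat N (redData (S.graph N) φ ω) - φ).ofLp) - redScore (S.graph N) φ ω c| ≤
          η * infoNorm (fisherInfo S N φ) c.ofLp)} ⊆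
      {ω | ¬IsRegular S N Θ φ R η' ω} ∪ ({ω | ENNReal.ofReal z ≤ ENNReal.ofReal (sb ω)} ∪
        redData (S.graph N) φ ⁻¹' s₃) := by
    intro ω hω
    by_contra hcon
    simp only [Set.mem_union, not_or] at hcon
    obtain ⟨c1, c2, c3⟩ := hcon
    have hsbz : sb ω ≤ z := by
      by_contra hlt
      push Not at hlt
      exact c2 (ENNReal.ofReal_le_ofReal hlt.le)
    obtain ⟨m1, m2⟩ := not_not.1 c3
    have hexp := IsRegular.expansion hΘpos hφΘ (hball.trans interior_subset) hi hB hκ hκ1 hratio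
      hz0.le hR.symm.le hnorm (min_le_left _ _) (not_not.1 c1) hsbz m1 m2
    refine hω ⟨hexp.1, fun c => (hexp.2 c).trans ?_⟩
    have h1 : 2 * η' * R ≤ η := by
      have := mul_le_mul_of_nonneg_right (min_le_right (1 / 4) (η / (2 * R)))
        (by positivity : 0 ≤ 2 * R)
      rw [div_mul_cancel₀ _ (by positivity)] at this
      linarith
    calc _ = 2 * η' * R * infoNorm (fisherInfo S N φ) c.ofLp := by ring
      _ ≤ _ := mul_le_mul_of_nonneg_right h1 (infoNorm_nonneg _ _)
  refine (measure_mono hsub).trans ((measure_union_le _ _).trans ?_)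
  calc _ ≤ ENNReal.ofReal (ε / 2) + (ENNReal.ofReal (ε / 2) + 0) :=
        add_le_add hreg ((measure_union_le _ _).trans (add_le_add hmarkov hnull.le))
    _ = ENNReal.ofReal ε := by
        rw [add_zero, ← ENNReal.ofReal_add (by positivity) (by positivity), add_halves]

end

section

variable {p N : ℕ}

/-! ## The delta method -/

/-- All eigenvalues of `B⁻¹` are `O(N^{-δ₁})`, while the leading ones are of exactly this order and
carry a non-vanishing part of the gradient, so `Q` is at least of this order. Hence squared
distances on information balls are `O(Q)`. -/
theorem variance_rate {S : Model p} {Θ : Set (Param p)} {φ : Param p} (hφ : φ ∈ Θ)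
    (h5 : InfoGrowth S Θ) {g : ℕ → Param p → ℝ} {lam : ℕ → Fin (numParam p) → ℝ}
    {v : ℕ → OrthonormalBasis (Fin (numParam p)) ℝ (Param p)} {δ : Fin (numParam p) → ℝ} {r : ℕ}
    (h8 : GradientEigenstructure S Θ φ g lam v δ r) :
    ∃ D : ℝ, 0 < D ∧ ∀ᶠ N in atTop, 0 < sandwich S φ g N ∧
      ∀ b : Param p, ‖b‖ ^ 2 ≤ D * sandwich S φ g N * infoNorm (fisherInfo S N φ) b.ofLp ^ 2 := by
  have hcard : 0 < numParam p := lt_of_lt_of_le h8.one_le_r h8.r_le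
  set k₀ : Fin (numParam p) := ⟨0, hcard⟩ with hk₀
  have hk₀r : (k₀ : ℕ) < r := h8.one_le_r
  choose U hU using fun k => (h8.eigen_upper k).exists_pos
  choose L hL using fun k : {k : Fin (numParam p) // (k : ℕ) < r} =>
    (h8.eigen_lower k.1 k.2).exists_pos
  obtain ⟨c, hc, hlead⟩ := h8.leading
  set U' := ∑ k, U k with hU'
  set L' := ∑ k, L k + 1 with hL'
  have hU0 : 0 < U' := Finset.sum_pos (fun k _ => (hU k).1) ⟨k₀, Finset.mem_univ _⟩
  have hL0 : 0 < L' := by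
    have : 0 ≤ ∑ k, L k := Finset.sum_nonneg fun k _ => (hL k).1.le
    linarith
  -- With `q = N^{-δ₁}`: every eigenvalue is at most `U' q`, and `c q ≤ L' Q`.
  refine ⟨U' * L' / c, by positivity, ?_⟩
  have hUall := eventually_all.2 fun k => (hU k).2.bound
  have hLall := eventually_all.2 fun k => (hL k).2.bound
  filter_upwards [h5.posDef, h8.eigen, hlead, hUall, hLall, eventually_ge_atTop 1]
    with N hB heig hlead hup hlow hN
  have hB := hB φ hφ
  set B := fisherInfo S N φ with hBdef
  have hN1 : (1 : ℝ) ≤ N := by exact_mod_cast hN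
  set q := (N : ℝ) ^ (-δ k₀) with hq
  have hq0 : 0 < q := Real.rpow_pos_of_pos (by linarith) _
  have hpw : ∀ k, 0 < (N : ℝ) ^ (-δ k) := fun k => Real.rpow_pos_of_pos (by linarith) _
  have hlam0 : ∀ k, 0 < lam N k := by
    intro k
    have h1 := hB.inv.dotProduct_mulVec_pos (x := (v N k).ofLp) (fun h => by
      have h2 : v N k = 0 := by ext i; exact congrFun h i
      have h3 := (v N).orthonormal.1 k
      rw [h2, norm_zero] at h3
      exact zero_ne_one h3)
    rw [heig k, dotProduct_smul] at h1
    have h4 : star (v N k).ofLp ⬝ᵥ (v N k).ofLp = 1 := by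
      rw [star_trivial, ← norm_toLp_sq]
      change ‖v N k‖ ^ 2 = 1
      rw [(v N).orthonormal.1 k, one_pow]
    rw [h4, smul_eq_mul, mul_one] at h1
    exact h1
  have hupper : ∀ k, lam N k ≤ U' * q := by
    intro k
    have h1 := hup k
    rw [Real.norm_of_nonneg (hlam0 k).le, Real.norm_of_nonneg (hpw k).le] at h1
    have h2 : (N : ℝ) ^ (-δ k) ≤ q := Real.rpow_le_rpow_of_exponent_le hN1
      (neg_le_neg (h8.rate_monotone (Nat.zero_le _ : k₀ ≤ k)))
    have h3 : U k ≤ U' := Finset.single_le_sum (fun i _ => (hU i).1.le) (Finset.mem_univ k)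
    exact h1.trans (mul_le_mul h3 h2 (hpw k).le hU0.le)
  have hlower : ∀ k : Fin (numParam p), (k : ℕ) < r → q ≤ L' * lam N k := by
    intro k hk
    have h1 := hlow ⟨k, hk⟩
    rw [Real.norm_of_nonneg (hlam0 k).le, Real.norm_of_nonneg (hpw k).le,
      h8.rate_eq k k₀ hk hk₀r] at h1
    have h3 : L ⟨k, hk⟩ ≤ ∑ k, L k :=
      Finset.single_le_sum (fun i _ => (hL i).1.le) (Finset.mem_univ (⟨k, hk⟩ : {k : Fin (numParam p) // (k : ℕ) < r}))
    exact h1.trans (mul_le_mul_of_nonneg_right (by linarith) (hlam0 k).le)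
  have hQ : sandwich S φ g N = ∑ k, lam N k * gradCoeff φ g v N k ^ 2 :=
    quadForm_eq_sum_eigen _ (v N) (lam N) heig _
  have hQlow : c * q ≤ L' * sandwich S φ g N := by
    rw [hQ, Finset.mul_sum]
    refine (mul_le_mul_of_nonneg_right hlead hq0.le).trans ?_
    rw [Finset.sum_mul]
    refine Finset.sum_le_sum fun k _ => ?_
    split_ifs with hk
    · have := mul_le_mul_of_nonneg_right (hlower k hk) (sq_nonneg (gradCoeff φ g v N k))
      linarith
    · rw [zero_mul]
      exact mul_nonneg hL0.le (mul_nonneg (hlam0 k).le (sq_nonneg _))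
  have hQ0 : 0 < sandwich S φ g N := by
    have h1 : 0 < L' * sandwich S φ g N := (mul_pos hc hq0).trans_le hQlow
    exact (mul_pos_iff_of_pos_left hL0).1 h1
  refine ⟨hQ0, fun b => ?_⟩
  set a : Param p := WithLp.toLp 2 (msqrt B *ᵥ b.ofLp) with ha
  have h1 : ‖b‖ ^ 2 = a.ofLp ⬝ᵥ (B⁻¹ *ᵥ a.ofLp) := by
    rw [← norm_misqrt_mulVec_sq hB, ha]
    simp only
    rw [misqrt_mulVec_msqrt hB]
  have h2 : infoNorm B b.ofLp ^ 2 = ∑ k, inner ℝ (v N k) a ^ 2 := by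
    have := (v N).sum_sq_norm_inner_right a
    simp only [Real.norm_eq_abs, sq_abs] at this
    rw [this]; rfl
  rw [h1, quadForm_eq_sum_eigen _ (v N) (lam N) heig a, h2]
  have h3 : U' * q ≤ U' * L' / c * sandwich S φ g N := by
    rw [div_mul_eq_mul_div, le_div_iff₀ hc, mul_assoc, mul_assoc, mul_comm q]
    exact mul_le_mul_of_nonneg_left hQlow hU0.le
  rw [Finset.mul_sum]
  exact Finset.sum_le_sum fun k _ =>
    mul_le_mul_of_nonneg_right ((hupper k).trans h3) (sq_nonneg _)

theorem sandwich_le {S : Model p} {φ : Param p} {g : ℕ → Param p → ℝ} (N : ℕ) :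
    sandwich S φ g N ≤ frob ((fisherInfo S N φ)⁻¹) * ‖gradient (g N) φ‖ ^ 2 := by
  rw [sq]
  exact (le_abs_self _).trans (abs_dotProduct_mulVec_le _ _ _)

theorem fderiv_eq_dotProduct_gradient (f : Param p → ℝ) (φ b : Param p) :
    fderiv ℝ f φ b = (gradient f φ).ofLp ⬝ᵥ b.ofLp := by
  have h : inner ℝ (gradient f φ) b = fderiv ℝ f φ b := InnerProductSpace.toDual_symm_apply
  rw [← h, EuclideanSpace.inner_eq_star_dotProduct, star_trivial, dotProduct_comm]

/-- The direction of the score that governs `g_N(φhat)`. -/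
def deltaDir (S : Model p) (φ : Param p) (g : ℕ → Param p → ℝ) (N : ℕ) : Param p :=
  (Real.sqrt (sandwich S φ g N))⁻¹ • WithLp.toLp 2
    ((fisherInfo S N φ)⁻¹ *ᵥ (gradient (g N) φ).ofLp)

/-- This direction is chosen so that the linearised score equation reads off the normalised
first-order change of `g_N`. -/
theorem deltaDir_dotProduct {S : Model p} {φ : Param p} {g : ℕ → Param p → ℝ} {N : ℕ}
    (hB : (fisherInfo S N φ).PosDef) (b : Param p) :
    (deltaDir S φ g N).ofLp ⬝ᵥ (fisherInfo S N φ *ᵥ b.ofLp) =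
      (Real.sqrt (sandwich S φ g N))⁻¹ * fderiv ℝ (g N) φ b := by
  have hu : IsUnit (fisherInfo S N φ).det := hB.det_pos.ne'.isUnit
  have hsymm : (fisherInfo S N φ)ᵀ = fisherInfo S N φ := by
    have := hB.isHermitian
    rwa [Matrix.IsHermitian, Matrix.conjTranspose_eq_transpose_of_trivial] at this
  rw [fderiv_eq_dotProduct_gradient, deltaDir, WithLp.ofLp_smul, smul_dotProduct, smul_eq_mul]
  congr 1
  rw [Matrix.dotProduct_mulVec, ← Matrix.mulVec_transpose, hsymm, Matrix.mulVec_mulVec,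
    Matrix.mul_nonsing_inv _ hu, Matrix.one_mulVec]

theorem infoNorm_deltaDir {S : Model p} {φ : Param p} {g : ℕ → Param p → ℝ} {N : ℕ}
    (hB : (fisherInfo S N φ).PosDef) (hQ : 0 < sandwich S φ g N) :
    infoNorm (fisherInfo S N φ) (deltaDir S φ g N).ofLp = 1 := by
  have h : infoNorm (fisherInfo S N φ) (deltaDir S φ g N).ofLp ^ 2 = 1 := by
    rw [infoNorm_sq hB, deltaDir_dotProduct hB, fderiv_eq_dotProduct_gradient, deltaDir,
      WithLp.ofLp_smul, dotProduct_smul, smul_eq_mul]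
    change (Real.sqrt (sandwich S φ g N))⁻¹ * ((Real.sqrt (sandwich S φ g N))⁻¹ *
      sandwich S φ g N) = 1
    rw [← mul_assoc, ← mul_inv, Real.mul_self_sqrt hQ.le, inv_mul_cancel₀ hQ.ne']
  rwa [pow_eq_one_iff_of_nonneg (infoNorm_nonneg _ _) two_ne_zero] at h

/-- Regularity of `f` is known only on `Θ`; extending it by `0` outside changes the composition only
on a null set. -/
theorem aemeasurable_comp_mle {S : Model p} {Θ : Set (Param p)} (hΘ : IsCompact Θ) {φ : Param p}
    {φhat : ∀ N : ℕ, Data p N → Param p} (hMLE : IsMLE S Θ φ φhat) {f : Param p → ℝ}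
    (hf : ContinuousOn f Θ) (N : ℕ) :
    AEMeasurable (fun d => f (φhat N d)) (dataLaw S N φ) := by
  classical
  have hm : Measurable (Θ.piecewise f fun _ => 0) :=
    ContinuousOn.measurable_piecewise hf continuousOn_const hΘ.measurableSet
  refine (hm.comp_aemeasurable (hMLE.aemeasurable N)).congr ?_
  filter_upwards [hMLE.mem N] with d hd
  simp [Function.comp, Set.piecewise_eq_of_mem _ _ _ hd]

/-! ### Consistency and asymptotic normality of the plug-in estimator. -/

section

variable {S : Model p} {Θ : Set (Param p)} (hΘ : IsCompact Θ)
  (hΘpos : ∀ φ ∈ Θ, ∀ j, 0 < variances φ j) {φ : Param p} (hφ : φ ∈ interior Θ)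
  {φhat : ∀ N : ℕ, Data p N → Param p} (hMLE : IsMLE S Θ φ φhat)
  (h5 : InfoGrowth S Θ) (h6 : InfoStability S Θ) (h7 : InfoContinuity S Θ)
  {g : ℕ → Param p → ℝ} (hg : ∀ N, AnalyticOn ℝ (g N) Θ)
  {lam : ℕ → Fin (numParam p) → ℝ}
  {v : ℕ → OrthonormalBasis (Fin (numParam p)) ℝ (Param p)}
  {δ : Fin (numParam p) → ℝ} {r : ℕ} (h8 : GradientEigenstructure S Θ φ g lam v δ r)

include hφ h5 hg h8 in
/-- First-order expansion of `g_N` on the scale of the estimator. -/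
theorem exists_taylor_bound {R : ℝ} (hR : 0 < R) :
    ∃ C : ℝ, 0 ≤ C ∧ ∀ᶠ N in atTop, ∀ b : Param p, infoNorm (fisherInfo S N φ) b.ofLp ≤ R →
      |g N (φ + b) - g N φ - fderiv ℝ (g N) φ b| ≤ C * ‖b‖ ^ 2 := by
  obtain ⟨ε, hε, C, hC⟩ := h8.hess_bounded
  obtain ⟨ρ, hρ, hball⟩ := Metric.isOpen_iff.1 isOpen_interior φ hφ
  refine ⟨max C 0, le_max_right _ _, ?_⟩
  filter_upwards [hC, eventually_norm_lt h5 (interior_subset hφ) hR (lt_min hε hρ)]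
    with N hC hnorm b hb
  have hmem : ∀ s ∈ Set.Icc (0 : ℝ) 1, φ + s • b ∈ Metric.ball φ (min ε ρ) := fun s hs => by
    rw [Metric.mem_ball, dist_eq_norm, add_sub_cancel_left, norm_smul, Real.norm_of_nonneg hs.1]
    exact (mul_le_of_le_one_left (norm_nonneg _) hs.2).trans_lt (hnorm b hb)
  have hint : ∀ s ∈ Set.Icc (0 : ℝ) 1, φ + s • b ∈ interior Θ := fun s hs =>
    hball (Metric.ball_subset_ball (min_le_right _ _) (hmem s hs))
  refine abs_taylor_le φ b (fun s hs => ?_) fun s hs => ?_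
  · exact ((hg N).analyticAt (mem_interior_iff_mem_nhds.1 (hint s hs))).contDiffAt
  · exact (hC _ ⟨Metric.ball_subset_ball (min_le_left _ _) (hmem s hs),
      interior_subset (hint s hs)⟩).trans (le_max_left _ _)

-- Two errors of size `η/2`: the linearisation of the score equation, and the Taylor remainder,
-- which is at most `QK` and hence at most `√Q K` after normalisation.
include hΘ hΘpos hφ hMLE h5 h6 h7 hg h8 in
theorem eventually_delta_close {ε η : ℝ} (hε : 0 < ε) (hη : 0 < η) :
    ∀ᶠ N in atTop, redLaw (S.covLaw N) {ω | η <
      |(Real.sqrt (sandwich S φ g N))⁻¹ * (g N (φhat N (redData (S.graph N) φ ω)) - g N φ) -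
        redScore (S.graph N) φ ω (deltaDir S φ g N)|} ≤ ENNReal.ofReal ε := by
  have hφΘ := interior_subset hφ
  obtain ⟨R, hR, hexp⟩ := exists_eventually_expansion hΘ hΘpos h5 h6 h7 hφ hMLE hε
  obtain ⟨C, hC0, hC⟩ := exists_taylor_bound hφ h5 hg h8 hR
  obtain ⟨D, hD, hrate⟩ := variance_rate hφΘ h5 h8
  obtain ⟨C₁, hC₁⟩ := h8.grad_bounded
  set K := C * (D * R ^ 2) + 1 with hK
  have hK0 : 0 < K := by positivity
  set q := (η / (2 * K)) ^ 2 with hq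
  have hq0 : 0 < q := by positivity
  filter_upwards [hexp (η / 2) (by positivity), hC, hrate, hC₁, h5.posDef,
    h5.inv_tendsto (q / (C₁ ^ 2 + 1)) (by positivity)] with N hexp hC hrate hC₁ hB hinv
  have hB := hB φ hφΘ
  obtain ⟨hQ0, hrate⟩ := hrate
  set Q := sandwich S φ g N with hQ
  have hQq : Q ≤ q := by
    have h1 : ‖gradient (g N) φ‖ ^ 2 ≤ C₁ ^ 2 + 1 := by
      have := pow_le_pow_left₀ (norm_nonneg _) hC₁ 2
      linarith
    refine (sandwich_le N).trans ((mul_le_mul (hinv φ hφΘ) h1 (sq_nonneg _) (by positivity)).trans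
      (le_of_eq ?_))
    rw [div_mul_cancel₀ _ (by positivity)]
  have hsQ : Real.sqrt Q ≤ η / (2 * K) := by
    rw [Real.sqrt_le_left (by positivity)]; exact hQq
  have hsQ0 : 0 < Real.sqrt Q := Real.sqrt_pos.2 hQ0
  refine (measure_mono fun ω hω => ?_).trans hexp
  refine fun hgood => (not_lt.2 ?_ : ¬η < _) hω
  obtain ⟨g1, g2⟩ := hgood
  set b := φhat N (redData (S.graph N) φ ω) - φ with hb
  have hφb : φhat N (redData (S.graph N) φ ω) = φ + b := by rw [hb]; abel
  have t1 := g2 (deltaDir S φ g N)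
  rw [deltaDir_dotProduct hB, infoNorm_deltaDir hB hQ0, mul_one] at t1
  have t2 := hC b g1
  have t3 : C * ‖b‖ ^ 2 ≤ Q * K := by
    have h1 := mul_le_mul_of_nonneg_left (hrate b) hC0
    have h2 : infoNorm (fisherInfo S N φ) b.ofLp ^ 2 ≤ R ^ 2 :=
      pow_le_pow_left₀ (infoNorm_nonneg _ _) g1 2
    have h3 := mul_le_mul_of_nonneg_left h2 (by positivity : 0 ≤ C * (D * Q))
    rw [hK]
    linarith
  have t4 : |(Real.sqrt Q)⁻¹ * (g N (φ + b) - g N φ) - (Real.sqrt Q)⁻¹ * fderiv ℝ (g N) φ b| ≤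
      η / 2 := by
    rw [← mul_sub, abs_mul, abs_of_pos (inv_pos.2 hsQ0), inv_mul_le_iff₀ hsQ0]
    refine t2.trans (t3.trans ?_)
    have h1 : Q * K = Real.sqrt Q * (Real.sqrt Q * K) := by
      rw [← mul_assoc, Real.mul_self_sqrt hQ0.le]
    rw [h1]
    refine mul_le_mul_of_nonneg_left ?_ hsQ0.le
    calc Real.sqrt Q * K ≤ η / (2 * K) * K := mul_le_mul_of_nonneg_right hsQ hK0.le
      _ = η / 2 := by field_simp
  rw [hφb]
  have := abs_sub_le ((Real.sqrt Q)⁻¹ * (g N (φ + b) - g N φ))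
    ((Real.sqrt Q)⁻¹ * fderiv ℝ (g N) φ b) (redScore (S.graph N) φ ω (deltaDir S φ g N))
  linarith

include hΘ hΘpos hφ hMLE h5 h6 h7 hg h8 in
theorem tendsto_measure_mle {ε : ℝ} (hε : 0 < ε) :
    Tendsto (fun N => dataLaw S N φ {d | ε ≤ |g N (φhat N d) - g N φ|}) atTop (𝓝 0) := by
  have hφΘ := interior_subset hφ
  rw [ENNReal.tendsto_nhds_zero]
  intro ε' hε'
  obtain ⟨ε₁, hε₁, hε₁'⟩ : ∃ ε₁ : ℝ, 0 < ε₁ ∧ ENNReal.ofReal ε₁ ≤ ε' := by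
    obtain ⟨x, hx0, hx⟩ := ENNReal.lt_iff_exists_nnreal_btwn.1 hε'
    exact ⟨x, by simpa using hx0, by simpa using hx.le⟩
  obtain ⟨R, hR, hexp⟩ := exists_eventually_expansion hΘ hΘpos h5 h6 h7 hφ hMLE hε₁
  obtain ⟨C, hC0, hC⟩ := exists_taylor_bound hφ h5 hg h8 hR
  obtain ⟨C₁, hC₁⟩ := h8.grad_bounded
  -- The bound by `1` lets the quadratic remainder be absorbed into a linear one.
  set ρ := min 1 (ε / (2 * (|C₁| + C + 1))) with hρ
  have hρ0 : 0 < ρ := by positivity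
  filter_upwards [hexp 1 one_pos, hC, hC₁, eventually_norm_lt h5 hφΘ hR hρ0]
    with N hexp hC hC₁ hnorm
  -- Here the data law of a set must be bounded above by the law of its preimage, which requires
  -- null measurability of the set.
  have hm : AEMeasurable (fun d => |g N (φhat N d) - g N φ|) (dataLaw S N φ) :=
    ((aemeasurable_comp_mle hΘ hMLE (hg N).continuousOn N).sub_const _).abs
  have hset : NullMeasurableSet {d | ε ≤ |g N (φhat N d) - g N φ|} (dataLaw S N φ) :=
    nullMeasurableSet_le aemeasurable_const hm
  rw [dataLaw_eq_map S N (hΘpos φ hφΘ)] at hset ⊢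
  rw [Measure.map_apply₀ (measurable_redData _ _).aemeasurable hset]
  refine (measure_mono fun ω hω => ?_).trans (hexp.trans hε₁')
  refine fun hgood => (not_le.2 ?_ : ¬ε ≤ _) hω
  obtain ⟨g1, -⟩ := hgood
  set b := φhat N (redData (S.graph N) φ ω) - φ with hb
  have hφb : φhat N (redData (S.graph N) φ ω) = φ + b := by rw [hb]; abel
  have t1 := hnorm b g1
  have t2 := hC b g1
  have t3 : |fderiv ℝ (g N) φ b| ≤ |C₁| * ‖b‖ := by
    rw [fderiv_eq_dotProduct_gradient]
    exact (abs_dotProduct_le _ _).trans (mul_le_mul_of_nonneg_right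
      (hC₁.trans (le_abs_self _)) (norm_nonneg _))
  have hb1 : ‖b‖ ≤ 1 := t1.le.trans (min_le_left _ _)
  have hb2 : ‖b‖ * (|C₁| + C + 1) ≤ ε / 2 := by
    have := mul_le_mul_of_nonneg_right (t1.le.trans (min_le_right _ _))
      (by positivity : 0 ≤ |C₁| + C + 1)
    refine this.trans (le_of_eq ?_)
    field_simp
  have t4 : C * ‖b‖ ^ 2 ≤ C * ‖b‖ :=
    mul_le_mul_of_nonneg_left (by rw [sq]; exact mul_le_of_le_one_left (norm_nonneg _) hb1) hC0
  rw [hφb]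
  have t5 := abs_sub_abs_le_abs_sub (g N (φ + b) - g N φ) (fderiv ℝ (g N) φ b)
  have t6 : ‖b‖ * (|C₁| + C + 1) = |C₁| * ‖b‖ + C * ‖b‖ + ‖b‖ := by ring
  have := norm_nonneg b
  linarith

/-- The integrand is at most `|t| η` off the exceptional set and at most `2` on it. -/
theorem norm_integral_exp_sub_le {Ω : Type*} [MeasurableSpace Ω] {μ : Measure Ω}
    [IsProbabilityMeasure μ] {X Y : Ω → ℝ} (hX : AEMeasurable X μ) (hY : AEMeasurable Y μ) (t : ℝ)
    {ε η : ℝ} (hε : 0 ≤ ε) (hη : 0 ≤ η) (h : μ {ω | η < |X ω - Y ω|} ≤ ENNReal.ofReal ε) :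
    ‖∫ ω, Complex.exp (((t * X ω : ℝ) : ℂ) * Complex.I) ∂μ -
      ∫ ω, Complex.exp (((t * Y ω : ℝ) : ℂ) * Complex.I) ∂μ‖ ≤ |t| * η + 2 * ε := by
  have hi : ∀ {Z : Ω → ℝ}, AEMeasurable Z μ →
      Integrable (fun ω => Complex.exp (((t * Z ω : ℝ) : ℂ) * Complex.I)) μ := fun {Z} hZ =>
    Integrable.of_bound (AEMeasurable.aestronglyMeasurable (by fun_prop)) 1
      (Eventually.of_forall fun ω => norm_exp_ofReal_mul_I_le _)
  rw [← integral_sub (hi hX) (hi hY)]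
  set s := toMeasurable μ {ω | η < |X ω - Y ω|}
  have hs : MeasurableSet s := measurableSet_toMeasurable _ _
  have hμs : μ.real s ≤ ε := by
    rw [Measure.real, measure_toMeasurable]
    exact ENNReal.toReal_le_of_le_ofReal hε h
  have hpt : ∀ ω, ‖Complex.exp (((t * X ω : ℝ) : ℂ) * Complex.I) -
      Complex.exp (((t * Y ω : ℝ) : ℂ) * Complex.I)‖ ≤
      |t| * η + s.indicator (fun _ => (2 : ℝ)) ω := by
    intro ω
    by_cases hω : ω ∈ s
    · rw [Set.indicator_of_mem hω]
      have := (norm_sub_le _ _).trans (add_le_add (norm_exp_ofReal_mul_I_le (t * X ω))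
        (norm_exp_ofReal_mul_I_le (t * Y ω)))
      have : 0 ≤ |t| * η := by positivity
      linarith
    · rw [Set.indicator_of_notMem hω, add_zero]
      have h1 : |X ω - Y ω| ≤ η := by
        by_contra hlt
        push Not at hlt
        exact hω (subset_toMeasurable _ _ hlt)
      have e : Complex.exp (((t * X ω : ℝ) : ℂ) * Complex.I) -
          Complex.exp (((t * Y ω : ℝ) : ℂ) * Complex.I) =
          Complex.exp (((t * Y ω : ℝ) : ℂ) * Complex.I) *
            (Complex.exp (Complex.I * ((t * (X ω - Y ω) : ℝ) : ℂ)) - 1) := by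
        rw [mul_sub, ← Complex.exp_add, mul_one]
        congr 2
        push_cast; ring
      rw [e, norm_mul, Complex.norm_exp_ofReal_mul_I, one_mul]
      refine (Real.norm_exp_I_mul_ofReal_sub_one_le).trans ?_
      rw [Real.norm_eq_abs, abs_mul]
      exact mul_le_mul_of_nonneg_left h1 (abs_nonneg t)
  have hi2 : Integrable (s.indicator fun _ => (2 : ℝ)) μ := (integrable_const _).indicator hs
  have hi3 : Integrable (fun ω => |t| * η + s.indicator (fun _ => (2 : ℝ)) ω) μ :=
    (integrable_const (|t| * η)).add hi2
  refine (norm_integral_le_of_norm_le hi3 (Eventually.of_forall hpt)).trans ?_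
  rw [integral_add (integrable_const _) hi2, integral_indicator_const _ hs]
  simp only [integral_const, probReal_univ, smul_eq_mul, one_mul]
  linarith

theorem measurable_redScore (G : SimpleGraph (Fin N)) (φ c : Param p) :
    Measurable fun ω => redScore G φ ω c :=
  ((measurable_gaussScore measurable_snd ((measurable_regY G φ c).comp measurable_fst)
    measurable_const).add ((measurable_gaussScore measurable_snd
    ((measurable_regM G φ c).comp measurable_fst) measurable_const).comp measurable_fst)).add
    (((measurable_bernScore φ c).comp measurable_fst).comp measurable_fst)

-- The normalised error is close in probability to the score in a direction of information one, to
-- which the central limit theorem for the score applies.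
include hΘ hΘpos hφ hMLE h5 h6 h7 hg h8 in
theorem tendsto_charFun_mle (t : ℝ) :
    Tendsto (fun N => ∫ d, Complex.exp (((t * ((Real.sqrt (sandwich S φ g N))⁻¹ *
      (g N (φhat N d) - g N φ)) : ℝ) : ℂ) * Complex.I) ∂(dataLaw S N φ)) atTop
      (𝓝 (Complex.exp (-((t ^ 2 / 2 : ℝ) : ℂ)))) := by
  have hφΘ := interior_subset hφ
  have hdir : ∀ᶠ N in atTop,
      infoNorm (fisherInfo S N φ) (deltaDir S φ g N).ofLp = 1 := by
    obtain ⟨D, hD, hrate⟩ := variance_rate hφΘ h5 h8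
    filter_upwards [hrate, h5.posDef] with N hr hB
    exact infoNorm_deltaDir (hB φ hφΘ) hr.1
  have hclt := tendsto_integral_redScore hΘpos h5 h6 h7 hφ hdir t
  rw [Metric.tendsto_nhds] at hclt ⊢
  intro ε hε
  set η := ε / (4 * (|t| + 1)) with hη
  have hη0 : 0 < η := by positivity
  filter_upwards [hclt (ε / 4) (by positivity),
    eventually_delta_close hΘ hΘpos hφ hMLE h5 h6 h7 hg h8 (ε := ε / 8) (η := η) (by positivity) hη0]
    with N h1 h2
  have := S.isProb N
  have hT : AEMeasurable (fun d => (Real.sqrt (sandwich S φ g N))⁻¹ *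
      (g N (φhat N d) - g N φ)) (dataLaw S N φ) :=
    ((aemeasurable_comp_mle hΘ hMLE (hg N).continuousOn N).sub_const _).const_mul _
  have hd := dataLaw_eq_map S N (hΘpos φ hφΘ)
  have hT' := hT
  rw [hd] at hT'
  have hTr := hT'.comp_measurable (measurable_redData (S.graph N) φ)
  have h3 := norm_integral_exp_sub_le hTr
    (measurable_redScore (S.graph N) φ (deltaDir S φ g N)).aemeasurable t (by positivity) hη0.le h2
  have e : ∫ d, Complex.exp (((t * ((Real.sqrt (sandwich S φ g N))⁻¹ *
      (g N (φhat N d) - g N φ)) : ℝ) : ℂ) * Complex.I) ∂(dataLaw S N φ) =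
      ∫ ω, Complex.exp (((t * ((fun d => (Real.sqrt (sandwich S φ g N))⁻¹ *
      (g N (φhat N d) - g N φ)) ∘ redData (S.graph N) φ) ω : ℝ) : ℂ) * Complex.I)
        ∂(redLaw (S.covLaw N)) := by
    rw [hd, integral_map (measurable_redData (S.graph N) φ).aemeasurable
      (AEMeasurable.aestronglyMeasurable (by fun_prop))]
    rfl
  rw [e]
  rw [dist_eq_norm] at h1 ⊢
  have h4 : |t| * η ≤ ε / 4 := by
    have : (|t| + 1) * η = ε / 4 := by rw [hη]; field_simp
    linarith
  refine lt_of_le_of_lt (norm_sub_le_norm_sub_add_norm_sub _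
    (∫ ω, Complex.exp (((t * redScore (S.graph N) φ ω (deltaDir S φ g N) : ℝ) : ℂ) * Complex.I)
      ∂(redLaw (S.covLaw N))) _) ?_
  linarith

end

end

end RenSem

end

/-! ### The theorem. -/

theorem theorem5p2 {p : ℕ} (S : RenSem.Model p) (Θ : Set (RenSem.Param p))
    (hΘ : IsCompact Θ) (hΘpos : ∀ φ ∈ Θ, ∀ j, 0 < RenSem.variances φ j)
    (φ₀ : RenSem.Param p) (hφ₀ : φ₀ ∈ interior Θ)
    (φhat : ∀ N : ℕ, RenSem.Data p N → RenSem.Param p) (hMLE : RenSem.IsMLE S Θ φ₀ φhat)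
    (h5 : RenSem.InfoGrowth S Θ) (h6 : RenSem.InfoStability S Θ) (h7 : RenSem.InfoContinuity S Θ)
    (g : ℕ → RenSem.Param p → ℝ) (hg : ∀ N, AnalyticOn ℝ (g N) Θ)
    (lam : ℕ → Fin (RenSem.numParam p) → ℝ)
    (v : ℕ → OrthonormalBasis (Fin (RenSem.numParam p)) ℝ (RenSem.Param p))
    (δ : Fin (RenSem.numParam p) → ℝ) (r : ℕ)
    (h8 : RenSem.GradientEigenstructure S Θ φ₀ g lam v δ r) :
    (∀ ε : ℝ, 0 < ε → Tendsto (fun N => RenSem.dataLaw S N φ₀ {d | ε ≤ |g N (φhat N d) - g N φ₀|})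
      atTop (𝓝 0)) ∧
    TendstoInDistribution
      (fun N d => (Real.sqrt (RenSem.sandwich S φ₀ g N))⁻¹ * (g N (φhat N d) - g N φ₀))
      atTop (id : ℝ → ℝ) (fun N => RenSem.dataLaw S N φ₀) (gaussianReal 0 1) := by
  have hm : ∀ N, AEMeasurable (fun d => (Real.sqrt (RenSem.sandwich S φ₀ g N))⁻¹ *
      (g N (φhat N d) - g N φ₀)) (RenSem.dataLaw S N φ₀) := fun N =>
    ((RenSem.aemeasurable_comp_mle hΘ hMLE (hg N).continuousOn N).sub_const _).const_mul _
  refine ⟨fun ε hε => RenSem.tendsto_measure_mle hΘ hΘpos hφ₀ hMLE h5 h6 h7 hg h8 hε,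
    hm, aemeasurable_id, ?_⟩
  -- Lévy's continuity theorem reduces the claim to pointwise convergence of characteristic
  -- functions.
  refine ProbabilityMeasure.tendsto_iff_tendsto_charFun.2 fun t => ?_
  have h := RenSem.tendsto_charFun_mle hΘ hΘpos hφ₀ hMLE h5 h6 h7 hg h8 t
  have hlim : charFun (Measure.map id (gaussianReal 0 1)) t =
      Complex.exp (-((t ^ 2 / 2 : ℝ) : ℂ)) := by
    rw [Measure.map_id, charFun_gaussianReal]
    congr 1
    push_cast
    ring
  change Tendsto (fun N => charFun (Measure.map _ (RenSem.dataLaw S N φ₀)) t) atTop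
    (𝓝 (charFun (Measure.map id (gaussianReal 0 1)) t))
  rw [hlim]
  refine h.congr fun N => ?_
  rw [charFun_apply_real, integral_map (hm N)
    (Measurable.aestronglyMeasurable (by fun_prop))]
  simp_rw [← Complex.ofReal_mul]
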